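/- **Setting.** Let $p,N\in\mathbb N$, $E=\{1,\dots,p,p+1\}$. For every $\theta$ in a parameter set $\Theta$ let $\mathbf T(s;\theta)=(\mu_{ij}(s;\theta))_{i,j\le p}$, $s\ge 0$, be a sub-intensity matrix function with measurable, locally integrable entries on $[0,\infty)$: the off-diagonal entries and the exit rates $\mathbf t(s;\theta)=-\mathbf T(s;\theta)\mathbf e$ are non-negative, where $\mathbf e=(1,\dots,1)'$. Let $\mathbf\Lambda(s;\theta)=\begin{pmatrix}\mathbf T(s;\theta)&\mathbf t(s;\theta)\\ 0&0\end{pmatrix}$ be the intensity matrix on $E$, with entries $\mu_{ij}(s;\theta)$, $i,j\in E$ (so $\mu_{i,p+1}=t_i$ and $\mu_{p+1,j}=0$). The product integral $t\mapsto\prod_s^t(\mathbf I+\mathbf A(u)\,du)$ is the unique continuous solution of $F(t)=\mathbf I+\int_s^tF(u)\mathbf A(u)\,du$, $t\ge s$. Put $\bar{\mathbf P}(s,t;\theta)=\prod_s^t(\mathbf I+\mathbf T(u;\theta)\,du)$ and $f(x;\pi,\theta)=\pi\,\bar{\mathbf P}(0,x;\theta)\,\mathbf t(x;\theta)$. Let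 $X^{(1)},\dots,X^{(N)}$ be independent time-inhomogeneous Markov jump processes on $E$ (right-continuous with left limits) with initial distribution $(\pi^{(m)},0)$, $\pi^{(m)}$ a probability vector on $\{1,\dots,p\}$, and transition matrices $\mathbf P(s,t)=\prod_s^t(\mathbf I+\mathbf\Lambda(u;\theta^{(m)})\,du)$. Here $(\pi^{(m)},\theta^{(m)})$ are arbitrary current parameters, under which all probabilities and expectations are taken, and it is assumed that absorption in $p+1$ occurs almost surely. Let $\tau^{(n)}=\inf\{t\ge0:X^{(n)}(t)=p+1\}$, $\boldsymbol\tau=(\tau^{(1)},\dots,\tau^{(N)})$, $I_i^{(n)}(s)=1_{\{X^{(n)}(s)=i\}}$, $B_i=\sum_nI^{(n)}_i(0)$, $N^{(n)}_{ij}(t)=\#\{s\in(0,t]:X^{(n)}(s-)=i,\,X^{(n)}(s)=j\}$. With $S=\max_n\tau^{(n)}$ and $\log 0=-\infty$, the complete-data log-likelihood is $$L(\pi,\theta)=\log\Big[\prod_{i=1}^p\pi_i^{B_i}\prod_{i,j\in E,\,j\ne i}\ \prod_{n=1}^N\exp\Big(\int_{(0,S]}\log\mu_{ij}(s;\theta)\,dN^{(n)}_{ij}(s)-\int_0^SI^{(n)}_i(s)\mu_{ij}(s;\theta)\,ds\Big)\Big].$$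 **Theorem.** *(a) Conditional expected statistics.* For $n\le N$ and $x>0$ define, for $i\le p$ and $0\le s\le x$, $$\bar I_i^{(m)}(s;x)=\frac{\pi^{(m)}\bar{\mathbf P}(0,s;\theta^{(m)})\mathbf e_i\,\mathbf e_i'\bar{\mathbf P}(s,x;\theta^{(m)})\mathbf t(x;\theta^{(m)})}{f(x;\pi^{(m)},\theta^{(m)})},$$ and $\bar I_{p+1}^{(m)}(s;x)=0$, and define measures on $(0,x]$ by, for $i,j\le p$, $j\ne i$, $$d\bar N^{(m)}_{ij}(s;x)=\frac{\pi^{(m)}\bar{\mathbf P}(0,s;\theta^{(m)})\mathbf e_i\,\mu_{ij}(s;\theta^{(m)})\,\mathbf e_j'\bar{\mathbf P}(s,x;\theta^{(m)})\mathbf t(x;\theta^{(m)})}{f(x;\pi^{(m)},\theta^{(m)})}\,ds,$$ $$d\bar N^{(m)}_{i,p+1}(s;x)=\frac{\pi^{(m)}\bar{\mathbf P}(0,s;\theta^{(m)})\mathbf e_i\,t_i(s;\theta^{(m)})}{f(x;\pi^{(m)},\theta^{(m)})}\,d\varepsilon_x(s),$$ where $\varepsilon_x$ is the Dirac measure at $x$,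 and $d\bar N^{(m)}_{p+1,j}=0$. Write $\bar I^{(n,m)}_i(s)=\bar I^{(m)}_i(s;\tau^{(n)})$ and $d\bar N^{(n,m)}_{ij}(s)=d\bar N^{(m)}_{ij}(s;\tau^{(n)})$. Then - $\mathbb E[B_i\mid\boldsymbol\tau]=\bar B^{(m)}_i$ a.s., where $\bar B_i^{(m)}=\sum_{n=1}^N\dfrac{\pi_i^{(m)}\mathbf e_i'\bar{\mathbf P}(0,\tau^{(n)};\theta^{(m)})\mathbf t(\tau^{(n)};\theta^{(m)})}{f(\tau^{(n)};\pi^{(m)},\theta^{(m)})}$ for $i\le p$ and $\bar B_{p+1}^{(m)}=0$; - for every $n$, $i\in E$ and fixed $s\ge0$, $\mathbb E[I_i^{(n)}(s)\mid\boldsymbol\tau]=\bar I_i^{(n,m)}(s)$ a.s. on $\{s\le\tau^{(n)}\}$; - for every $n$, $i,j\in E$, $j\ne i$, and fixed $s\ge0$, $N_{ij}^{(n)}(s)$ is integrable and $\mathbb E[N_{ij}^{(n)}(s)\mid\boldsymbol\tau]=\int_{(0,s]}d\bar N_{ij}^{(n,m)}$ a.s. *(b) Conditional expected log-likelihood.*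 Let $\pi$ be a probability vector on $\{1,\dots,p\}$ and $\theta\in\Theta$ such that $s\mapsto\log^+(\mu_{ij}(s;\theta))\,\mu_{ij}(s;\theta^{(m)})$ is locally integrable on $[0,\infty)$ for all $i\ne j$ in $\{1,\dots,p\}$ (which is automatic if the rates are locally bounded). Then $L(\pi,\theta)$ has a conditional expectation $\mathbb E[L^+\mid\boldsymbol\tau]-\mathbb E[L^-\mid\boldsymbol\tau]\in[-\infty,\infty)$ given $\boldsymbol\tau$, with $\mathbb E[L^+\mid\boldsymbol\tau]<\infty$ a.s., and almost surely it equals $$\bar L_0^{(m)}(\pi)+\sum_{i,j\in E,\ j\ne i}\bar L^{(m)}_{ij}(\theta),\qquad \bar L_0^{(m)}(\pi)=\sum_{i=1}^p\bar B_i^{(m)}\log\pi_i,$$ $$\bar L^{(m)}_{ij}(\theta)=\sum_{n=1}^N\Big(\int_{(0,\tau^{(n)}]}\log\mu_{ij}(s;\theta)\,d\bar N^{(n,m)}_{ij}(s)-\int_0^{\tau^{(n)}}\bar I^{(n,m)}_i(s)\,\mu_{ij}(s;\theta)\,ds\Big),$$ with the convention $0\cdot(-\infty)=0$. -/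

import Mathlib

open MeasureTheory ProbabilityTheory Set Filter Topology
open scoped ENNReal Matrix

noncomputable section

/-! ### Product integrals -/

/-- `F` is the product integral `t ↦ ∏_s^t (I + A(u) du)` on `[s, ∞)`: the continuous solution of
`∂F/∂t = F A`, `F(s) = I`, in integrated form. For `A` locally integrable on `[s, ∞)` it exists and
is unique there. -/
def IsProdIntegral {ι : Type*} [Fintype ι] [DecidableEq ι]
    (A : ℝ → Matrix ι ι ℝ) (s : ℝ) (F : ℝ → Matrix ι ι ℝ) : Prop :=
  ContinuousOn F (Ici s) ∧
    ∀ t, s ≤ t → ∀ i j, F t i j = (1 : Matrix ι ι ℝ) i j + ∫ u in s..t, (F u * A u) i j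

open Classical in
/-- The product integral `∏_s^t (I + A(u) du)`, for `s ≤ t`. -/
def prodIntegral {ι : Type*} [Fintype ι] [DecidableEq ι]
    (A : ℝ → Matrix ι ι ℝ) (s t : ℝ) : Matrix ι ι ℝ :=
  if h : ∃ F, IsProdIntegral A s F then h.choose t else 1

/-! ### Intensities -/

/-- The state space: `Sum.inl i`, `i : Fin p`, are the transient states, and `Sum.inr ()` is the
absorbing state `p + 1`. -/
abbrev State (p : ℕ) : Type := Fin p ⊕ Unit

/-- The absorbing state. -/
abbrev absorbingState {p : ℕ} : State p := Sum.inr ()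

/-- The exit rates `t(s) = -T(s) e`. -/
def exitRate {p : ℕ} (T : ℝ → Matrix (Fin p) (Fin p) ℝ) (s : ℝ) : Fin p → ℝ :=
  -(T s *ᵥ 1)

/-- The intensity matrix `Λ(s)`, with blocks `T(s)`, `t(s)`, `0`, `0`; its entries are `μ_ij(s)`. -/
def intensity {p : ℕ} (T : ℝ → Matrix (Fin p) (Fin p) ℝ) (s : ℝ) :
    Matrix (State p) (State p) ℝ :=
  Matrix.fromBlocks (T s) (Matrix.replicateCol Unit (exitRate T s)) 0 0

/-- Sub-intensity matrix functions on `[0, ∞)`, with locally integrable entries. -/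
structure IsSubIntensity {p : ℕ} (T : ℝ → Matrix (Fin p) (Fin p) ℝ) : Prop where
  measurable : ∀ i j, Measurable fun s => T s i j
  locallyIntegrable : ∀ i j, LocallyIntegrableOn (fun s => T s i j) (Ici 0)
  offDiag_nonneg : ∀ s, 0 ≤ s → ∀ i j, i ≠ j → 0 ≤ T s i j
  exitRate_nonneg : ∀ s, 0 ≤ s → ∀ i, 0 ≤ exitRate T s i

/-! ### Time-inhomogeneous Markov jump processes

Processes are indexed by `ℝ`, but only the times `t ≥ 0` are ever used. -/

/-- The history `σ(X(r) : 0 ≤ r ≤ s)`. -/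
abbrev history {Ω : Type*} {p : ℕ} (X : ℝ → Ω → State p) (s : ℝ) : MeasurableSpace Ω :=
  ⨆ r ∈ Icc 0 s, MeasurableSpace.comap (X r) inferInstance

/-- The indicator `I_i(s) = 1_{X(s) = i}`. -/
def occ {Ω : Type*} {p : ℕ} (X : ℝ → Ω → State p) (i : State p) (s : ℝ) (ω : Ω) : ℝ :=
  if X s ω = i then 1 else 0

/-- `X` is a Markov jump process on `[0, ∞)` with initial distribution `(π, 0)` and transition
probability matrices `P(s,t) = ∏_s^t (I + Λ(u) du)`; its paths are right-continuous with left limits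
in the discrete state space. -/
structure IsMarkovJumpProcess {Ω : Type*} [MeasurableSpace Ω] (P : Measure Ω) {p : ℕ}
    (π : Fin p → ℝ) (T : ℝ → Matrix (Fin p) (Fin p) ℝ) (X : ℝ → Ω → State p) : Prop where
  measurable : ∀ t, 0 ≤ t → Measurable (X t)
  right_continuous : ∀ ω t, 0 ≤ t → ∀ᶠ u in 𝓝[>] t, X u ω = X t ω
  left_limit : ∀ ω t, 0 < t → ∃ i, ∀ᶠ u in 𝓝[<] t, X u ω = i
  initial : ∀ i, P {ω | X 0 ω = Sum.inl i} = ENNReal.ofReal (π i)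
  initial_absorbing : P {ω | X 0 ω = absorbingState} = 0
  markov : ∀ s t, 0 ≤ s → s ≤ t → ∀ j,
    P[occ X j t | history X s] =ᵐ[P] fun ω => prodIntegral (intensity T) s t (X s ω) j

/-- The absorption time `τ = inf {t ≥ 0 : X(t) = p + 1}` (real-valued; used for processes that are
almost surely absorbed). -/
def absorptionTime {Ω : Type*} {p : ℕ} (X : ℝ → Ω → State p) (ω : Ω) : ℝ :=
  sInf {t | 0 ≤ t ∧ X t ω = absorbingState}

/-- The times `s > 0` with `X(s-) = i` and `X(s) = j`. -/
def jumpTimes {Ω : Type*} {p : ℕ} (X : ℝ → Ω → State p) (i j : State p) (ω : Ω) : Set ℝ :=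
  {s | 0 < s ∧ (∀ᶠ u in 𝓝[<] s, X u ω = i) ∧ X s ω = j}

/-- The counting process `N_ij(t)`. -/
def jumpCount {Ω : Type*} {p : ℕ} (X : ℝ → Ω → State p) (i j : State p) (t : ℝ) (ω : Ω) : ℝ :=
  ((jumpTimes X i j ω ∩ Ioc 0 t).ncard : ℝ)

/-- The random measure `dN_ij`: unit masses at the jump times from `i` to `j`. -/
def jumpMeasure {Ω : Type*} {p : ℕ} (X : ℝ → Ω → State p) (i j : State p) (ω : Ω) : Measure ℝ :=
  Measure.sum fun s : jumpTimes X i j ω => Measure.dirac (s : ℝ)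

/-! ### Extended-real logarithm, integral and conditional expectation -/

/-- `log x` for `x ≥ 0`, with `log 0 = -∞`. -/
def elog (x : ℝ) : EReal := ENNReal.log (ENNReal.ofReal x)

/-- `∫ g dν = ∫ g⁺ dν - ∫ g⁻ dν`, meaningful if one of the two is finite. -/
def eintegral (g : ℝ → EReal) (ν : Measure ℝ) : EReal :=
  ((∫⁻ x, (g x).toENNReal ∂ν : ℝ≥0∞) : EReal) - ((∫⁻ x, (-g x).toENNReal ∂ν : ℝ≥0∞) : EReal)

/-- `Z` is the (extended) conditional expectation of `ξ` given `m`: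
`Z = E[ξ⁺ | m] - E[ξ⁻ | m]` almost surely, where almost surely `E[ξ⁺ | m] < ∞`. In particular
`Z < ∞`, while `Z = -∞` is allowed. -/
def HasCondExp {Ω : Type*} [MeasurableSpace Ω] (P : Measure Ω) (m : MeasurableSpace Ω)
    (ξ Z : Ω → EReal) : Prop :=
  AEMeasurable ξ P ∧
    (∀ᵐ ω ∂P, condLExp m P (fun ω => (ξ ω).toENNReal) ω < ⊤) ∧
    ∀ᵐ ω ∂P, Z ω = ((condLExp m P (fun ω => (ξ ω).toENNReal) ω : ℝ≥0∞) : EReal)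
      - ((condLExp m P (fun ω => (-ξ ω).toENNReal) ω : ℝ≥0∞) : EReal)

/-! ### The complete-data likelihood of `N` processes -/

/-- `B_i`, the number of processes that start in state `i`. -/
def startCount {Ω : Type*} {p N : ℕ} (X : Fin N → ℝ → Ω → State p) (i : State p) (ω : Ω) : ℕ :=
  ∑ n, if X n 0 ω = i then 1 else 0

/-- `∫_{(0,H]} log μ_ij(s) dN_ij(s) - ∫_0^H I_i(s) μ_ij(s) ds` for one process. -/
def transitionTerm {Ω : Type*} {p : ℕ} (T : ℝ → Matrix (Fin p) (Fin p) ℝ) (H : ℝ)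
    (X : ℝ → Ω → State p) (i j : State p) (ω : Ω) : EReal :=
  eintegral (fun s => elog (intensity T s i j)) ((jumpMeasure X i j ω).restrict (Ioc 0 H))
    - ((∫ s in (0 : ℝ)..H, occ X i s ω * intensity T s i j : ℝ) : EReal)

/-- The complete-data likelihood on the time interval `[0, H]`. -/
def completeLikelihood {Ω : Type*} {p N : ℕ} (π : Fin p → ℝ) (T : ℝ → Matrix (Fin p) (Fin p) ℝ)
    (H : ℝ) (X : Fin N → ℝ → Ω → State p) (ω : Ω) : ℝ≥0∞ :=
  (∏ i : Fin p, ENNReal.ofReal (π i) ^ startCount X (Sum.inl i) ω) *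
    ∏ i : State p, ∏ j ∈ Finset.univ.erase i, ∏ n, EReal.exp (transitionTerm T H (X n) i j ω)

/-- The complete-data log-likelihood `L^X(π, θ)` on `[0, max_n τ⁽ⁿ⁾]`. -/
def completeLogLikelihood {Ω : Type*} {p N : ℕ} (π : Fin p → ℝ)
    (T : ℝ → Matrix (Fin p) (Fin p) ℝ) (X : Fin N → ℝ → Ω → State p) (ω : Ω) : EReal :=
  ENNReal.log (completeLikelihood π T (⨆ n, absorptionTime (X n) ω) X ω)

/-- The σ-algebra generated by the data `τ = (τ⁽¹⁾, …, τ⁽ᴺ⁾)`. -/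
abbrev dataSigma {Ω : Type*} {p N : ℕ} (X : Fin N → ℝ → Ω → State p) : MeasurableSpace Ω :=
  MeasurableSpace.comap (fun ω n => absorptionTime (X n) ω) inferInstance

/-! ### The explicit conditional expected statistics -/

/-- `P̄(s,t) = ∏_s^t (I + T(u) du)`. -/
def subTransition {p : ℕ} (T : ℝ → Matrix (Fin p) (Fin p) ℝ) (s t : ℝ) :
    Matrix (Fin p) (Fin p) ℝ :=
  prodIntegral T s t

/-- The density `f(x) = π P̄(0,x) t(x)`. -/
def iphDensity {p : ℕ} (π : Fin p → ℝ) (T : ℝ → Matrix (Fin p) (Fin p) ℝ) (x : ℝ) : ℝ :=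
  π ⬝ᵥ (subTransition T 0 x *ᵥ exitRate T x)

/-- `B̄_i`, given absorption times `x = (x₁, …, x_N)`. -/
def Bbar {p N : ℕ} (π : Fin p → ℝ) (T : ℝ → Matrix (Fin p) (Fin p) ℝ) (x : Fin N → ℝ) :
    State p → ℝ
  | Sum.inl i =>
      ∑ n, π i * (subTransition T 0 (x n) *ᵥ exitRate T (x n)) i / iphDensity π T (x n)
  | Sum.inr _ => 0

/-- `Ī_i(s)`, `s ≤ x`, given absorption time `x`. -/
def Ibar {p : ℕ} (π : Fin p → ℝ) (T : ℝ → Matrix (Fin p) (Fin p) ℝ) (x s : ℝ) : State p → ℝ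
  | Sum.inl i =>
      (π ᵥ* subTransition T 0 s) i * (subTransition T s x *ᵥ exitRate T x) i / iphDensity π T x
  | Sum.inr _ => 0

/-- The measure `dN̄_ij` on `(0, x]`, given absorption time `x`: a Lebesgue density for transient
`i, j`, a point mass at `x` for transient `i` and absorbing `j`. -/
def dNbar {p : ℕ} (π : Fin p → ℝ) (T : ℝ → Matrix (Fin p) (Fin p) ℝ) (x : ℝ) :
    State p → State p → Measure ℝ
  | Sum.inl i, Sum.inl j =>
      (volume.restrict (Ioc 0 x)).withDensity fun s =>
        ENNReal.ofReal ((π ᵥ* subTransition T 0 s) i * T s i j *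
          (subTransition T s x *ᵥ exitRate T x) j / iphDensity π T x)
  | Sum.inl i, Sum.inr _ =>
      (Measure.dirac x).withDensity fun s =>
        ENNReal.ofReal ((π ᵥ* subTransition T 0 s) i * exitRate T s i / iphDensity π T x)
  | Sum.inr _, _ => 0

/-- `L̄₀(π)`, given absorption times `x` and current parameters `π₀, T₀`. -/
def Lbar₀ {p N : ℕ} (π₀ : Fin p → ℝ) (T₀ : ℝ → Matrix (Fin p) (Fin p) ℝ) (x : Fin N → ℝ)
    (π : Fin p → ℝ) : EReal :=
  ∑ i : Fin p, (Bbar π₀ T₀ x (Sum.inl i) : EReal) * elog (π i)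

/-- `L̄_ij(θ)`, given absorption times `x` and current parameters `π₀, T₀`. -/
def Lbar {p N : ℕ} (π₀ : Fin p → ℝ) (T₀ : ℝ → Matrix (Fin p) (Fin p) ℝ) (x : Fin N → ℝ)
    (T : ℝ → Matrix (Fin p) (Fin p) ℝ) (i j : State p) : EReal :=
  ∑ n, (eintegral (fun s => elog (intensity T s i j))
      ((dNbar π₀ T₀ (x n) i j).restrict (Ioc 0 (x n)))
    - ((∫ s in (0 : ℝ)..x n, Ibar π₀ T₀ (x n) s i * intensity T s i j : ℝ) : EReal))

end

/-!
The idea is Bayes' formula. For one process let `τ` be its absorption time, `f` the density of `τ`,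
and `Y ≥ 0` a functional of the path. If `y` is the density of the measure `B ↦ E[Y; τ ∈ B]`
(`HasJointDensity`), then `E[Y | τ] = y(τ) / f(τ)`. By independence, conditioning on the absorption
times of the other processes changes nothing (`condLExp_comap_of_iIndep`, `condLExp_dataSigma`).
Everything is done for `[0, ∞]`-valued functionals, where no integrability is required.

The joint densities come from the Markov property on the events `τ ≤ c`, which up to null sets are
the events `X(c) = p + 1`. For the indicator of `X(s) = i` this gives
`y(x) = P(X(s) = i) e_i' P̄(s, x) t(x)`, and integration over `s` yields the occupation times. For
the jump measure of a pair `i ≠ j`, the jumps in an interval are the pathwise limit of the number of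
transitions seen on finer and finer grids. The expected grid counts are Riemann–Stieltjes sums with
limit `∫ P(X(u) = i) μ_ij(u) P(X(c) = l | X(u) = j) du` on the event `X(c) = l`
(`IsMarkovJumpProcess.setLIntegral_jumpMeasure`). A jump into the absorbing state takes place at `τ`
itself, whence the point mass at `τ`. These limits need joint continuity of the product integral in
both time arguments, its flow property and its positivity. All three are derived from its
Peano–Baker series (`flow`), for rates that are merely locally integrable.

The log-likelihood is a finite sum of terms, each of them a difference `A - C` of non-negative
functionals of the path with `A` and `E[A | τ]` finite. Such differences may be conditioned term by
term (`HasSplitCondExp`), although the sum may well be `-∞`, and this notion implies `HasCondExp`.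
Only the jump terms have a positive part, and the integrability hypothesis on `log⁺ μ_ij(θ)` makes
its conditional expectation finite.
-/


noncomputable section

/-! ### Product integrals: existence, uniqueness and the flow property -/

/-- The product rule for indefinite integrals. -/
theorem mul_sub_mul_eq_integral {f g f' g' : ℝ → ℝ} {a b : ℝ}
    (hf' : IntervalIntegrable f' volume a b) (hg' : IntervalIntegrable g' volume a b)
    (hf : ∀ t ∈ uIcc a b, f t = f a + ∫ u in a..t, f' u)
    (hg : ∀ t ∈ uIcc a b, g t = g a + ∫ u in a..t, g' u) :
    f b * g b - f a * g a = ∫ u in a..b, (f' u * g u + f u * g' u) := by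
  have hconst : ∀ c : ℝ, AbsolutelyContinuousOnInterval (fun _ : ℝ => c) a b := fun c =>
    (LipschitzWith.const c).lipschitzOnWith.absolutelyContinuousOnInterval
  have hac : ∀ {h h' : ℝ → ℝ}, IntervalIntegrable h' volume a b →
      AbsolutelyContinuousOnInterval (fun t => h a + ∫ u in a..t, h' u) a b := fun {h h'} hh =>
    (hconst (h a)).add
      (hh.absolutelyContinuousOnInterval_intervalIntegral left_mem_uIcc)
  have h := AbsolutelyContinuousOnInterval.integral_deriv_mul_eq_sub (hac (h := f) hf')
    (hac (h := g) hg')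
  rw [hf b right_mem_uIcc, hg b right_mem_uIcc]
  simp only [intervalIntegral.integral_same, add_zero] at h
  rw [← h]
  refine intervalIntegral.integral_congr_ae ?_
  filter_upwards [hf'.ae_hasDerivAt_integral, hg'.ae_hasDerivAt_integral] with x hx1 hx2 hx
  have hx' := uIoc_subset_uIcc hx
  have h1 := ((hx1 hx' a left_mem_uIcc).const_add (f a)).deriv
  have h2 := ((hx2 hx' a left_mem_uIcc).const_add (g a)).deriv
  simp only [h1, h2]
  rw [hf x hx', hg x hx']

/-- The chain rule for powers of an indefinite integral, which need not be differentiable. -/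
theorem integral_primitive_pow_mul {a : ℝ → ℝ} (ha : ∀ b c, IntervalIntegrable a volume b c)
    (s t : ℝ) (n : ℕ) :
    ∫ u in s..t, (∫ v in s..u, a v) ^ n * a u = (∫ v in s..t, a v) ^ (n + 1) / (n + 1) := by
  have hcont := intervalIntegral.continuous_primitive ha s
  induction n generalizing t with
  | zero => simp
  | succ n ih =>
    have h1 : ∀ b c, IntervalIntegrable (fun u => (∫ v in s..u, a v) ^ n * a u) volume b c :=
      fun b c => (ha b c).continuousOn_mul (hcont.pow n).continuousOn
    have h := mul_sub_mul_eq_integral (a := s) (b := t)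
      (f := fun t => ∫ v in s..t, a v) (f' := a)
      (g := fun t => (∫ v in s..t, a v) ^ (n + 1) / (n + 1))
      (g' := fun u => (∫ v in s..u, a v) ^ n * a u) (ha _ _) (h1 _ _) (by simp)
      (fun t _ => by rw [ih]; simp)
    have h2 : ∀ u, a u * ((∫ v in s..u, a v) ^ (n + 1) / (n + 1))
        + (∫ v in s..u, a v) * ((∫ v in s..u, a v) ^ n * a u)
        = ((n + 2 : ℝ) / (n + 1)) * ((∫ v in s..u, a v) ^ (n + 1) * a u) := by
      intro u; field_simp; ring
    simp only [h2, intervalIntegral.integral_const_mul, intervalIntegral.integral_same,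
      zero_mul, sub_zero] at h
    have h3 : (n : ℝ) + 1 ≠ 0 := by positivity
    have h4 : (n : ℝ) + 2 ≠ 0 := by positivity
    push_cast
    rw [show (n : ℝ) + 1 + 1 = n + 2 by ring]
    field_simp at h ⊢
    linear_combination -h

/-- With absolute values the formula holds for either order of the limits `s` and `t`. -/
theorem abs_integral_abs_primitive_pow_mul {a : ℝ → ℝ}
    (ha : ∀ b c, IntervalIntegrable a volume b c) (ha0 : ∀ u, 0 ≤ a u) (s t : ℝ) (n : ℕ) :
    |∫ u in s..t, |∫ v in s..u, a v| ^ n * a u| = |∫ v in s..t, a v| ^ (n + 1) / (n + 1) := by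
  have key : ∃ c : ℝ, |c| = 1 ∧ ∀ u ∈ uIcc s t,
      |∫ v in s..u, a v| ^ n * a u = c * ((∫ v in s..u, a v) ^ n * a u) := by
    rcases le_total s t with h | h
    · refine ⟨1, by simp, fun u hu => ?_⟩
      rw [uIcc_of_le h] at hu
      rw [abs_of_nonneg (intervalIntegral.integral_nonneg hu.1 fun v _ => ha0 v)]; ring
    · refine ⟨(-1) ^ n, by simp, fun u hu => ?_⟩
      rw [uIcc_of_ge h] at hu
      rw [intervalIntegral.integral_symm, abs_neg,
        abs_of_nonneg (intervalIntegral.integral_nonneg hu.2 fun v _ => ha0 v),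
        neg_pow (∫ v in u..s, a v), ← mul_assoc, ← mul_assoc, ← mul_pow]
      norm_num
  obtain ⟨c, hc, h⟩ := key
  rw [intervalIntegral.integral_congr h, intervalIntegral.integral_const_mul,
    integral_primitive_pow_mul ha, abs_mul, hc, one_mul, abs_div, abs_pow,
    abs_of_nonneg (by positivity : (0 : ℝ) ≤ n + 1)]

/-- Matrix functions on `ℝ` whose entries are integrable on bounded intervals. -/
def EntrywiseIntegrable {ι : Type*} (A : ℝ → Matrix ι ι ℝ) : Prop :=
  ∀ i j a b, IntervalIntegrable (fun s => A s i j) volume a b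

section Flow

variable {ι : Type*} [Fintype ι]

/-- The sum of the absolute values of the entries. -/
def entrySum (A : ℝ → Matrix ι ι ℝ) (u : ℝ) : ℝ := ∑ i, ∑ j, |A u i j|

theorem entrySum_nonneg (A : ℝ → Matrix ι ι ℝ) (u : ℝ) : 0 ≤ entrySum A u :=
  Finset.sum_nonneg fun _ _ => Finset.sum_nonneg fun _ _ => abs_nonneg _

theorem EntrywiseIntegrable.intervalIntegrable_entrySum {A : ℝ → Matrix ι ι ℝ}
    (hA : EntrywiseIntegrable A) (a b : ℝ) : IntervalIntegrable (entrySum A) volume a b := by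
  have : entrySum A = ∑ i, ∑ j, fun u => |A u i j| := by
    ext u; simp [entrySum, Finset.sum_apply]
  rw [this]
  exact IntervalIntegrable.sum _ fun i _ => IntervalIntegrable.sum _ fun j _ => (hA i j a b).abs

theorem EntrywiseIntegrable.vecMul {A : ℝ → Matrix ι ι ℝ} (hA : EntrywiseIntegrable A)
    {f : ℝ → ι → ℝ} {a b : ℝ} (hf : ContinuousOn f (uIcc a b)) (j : ι) :
    IntervalIntegrable (fun u => (f u ᵥ* A u) j) volume a b := by
  have : (fun u => (f u ᵥ* A u) j) = ∑ i, fun u => f u i * A u i j := by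
    ext u; simp [Matrix.vecMul, dotProduct, Finset.sum_apply]
  rw [this]
  exact IntervalIntegrable.sum _ fun i _ =>
    (hA i j a b).continuousOn_mul ((continuous_apply i).comp_continuousOn hf)

theorem EntrywiseIntegrable.mul {A : ℝ → Matrix ι ι ℝ} (hA : EntrywiseIntegrable A)
    {F : ℝ → Matrix ι ι ℝ} {a b : ℝ} (hF : ContinuousOn F (uIcc a b)) (i j : ι) :
    IntervalIntegrable (fun u => (F u * A u) i j) volume a b :=
  hA.vecMul (f := fun u => F u i) ((continuous_apply i).comp_continuousOn hF) j

theorem abs_vecMul_le {A : ℝ → Matrix ι ι ℝ} {f : ι → ℝ} {C : ℝ} (hf : ∀ i, |f i| ≤ C) (u : ℝ)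
    (j : ι) : |(f ᵥ* A u) j| ≤ C * entrySum A u := by
  have hC : ∀ i : ι, 0 ≤ C := fun i => (abs_nonneg _).trans (hf i)
  calc |(f ᵥ* A u) j| ≤ ∑ i, |f i * A u i j| := Finset.abs_sum_le_sum_abs _ _
    _ ≤ ∑ i, C * ∑ k, |A u i k| := by
        refine Finset.sum_le_sum fun i _ => ?_
        rw [abs_mul]
        refine mul_le_mul (hf i) ?_ (abs_nonneg _) (hC i)
        exact Finset.single_le_sum (f := fun k => |A u i k|) (fun _ _ => abs_nonneg _)
          (Finset.mem_univ j)
    _ = C * entrySum A u := by rw [entrySum, Finset.mul_sum]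

/-- One step of the Picard iteration improves the bound `C Gⁿ / n!` to `C Gⁿ⁺¹ / (n+1)!`. -/
theorem abs_integral_vecMul_le {A : ℝ → Matrix ι ι ℝ} (hA : EntrywiseIntegrable A) {s t C : ℝ}
    (hC : 0 ≤ C) {n : ℕ} {f : ℝ → ι → ℝ}
    (hf : ∀ u ∈ uIcc s t, ∀ i, |f u i| ≤ C * (|∫ v in s..u, entrySum A v| ^ n / n.factorial))
    (j : ι) : |∫ u in s..t, (f u ᵥ* A u) j| ≤
      C * (|∫ v in s..t, entrySum A v| ^ (n + 1) / (n + 1).factorial) := by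
  have hcont := intervalIntegral.continuous_primitive hA.intervalIntegrable_entrySum s
  have hint : IntervalIntegrable (fun u => C / n.factorial *
      (|∫ v in s..u, entrySum A v| ^ n * entrySum A u)) volume s t :=
    ((hA.intervalIntegrable_entrySum s t).continuousOn_mul
      ((hcont.abs.pow n).continuousOn)).const_mul _
  have h := intervalIntegral.norm_integral_le_abs_of_norm_le
    (f := fun u => (f u ᵥ* A u) j) (μ := volume) (a := s) (b := t) (g := fun u => C / n.factorial *
      (|∫ v in s..u, entrySum A v| ^ n * entrySum A u)) ?_ hint
  · rw [Real.norm_eq_abs, intervalIntegral.integral_const_mul, abs_mul,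
      abs_integral_abs_primitive_pow_mul hA.intervalIntegrable_entrySum (entrySum_nonneg A)] at h
    refine h.trans (le_of_eq ?_)
    rw [abs_of_nonneg (by positivity), Nat.factorial_succ]
    push_cast
    field_simp
  · filter_upwards [ae_restrict_mem measurableSet_uIoc] with u hu
    rw [Real.norm_eq_abs]
    refine (abs_vecMul_le (A := A) (hf u (uIoc_subset_uIcc hu)) u j).trans (le_of_eq ?_)
    ring

/-- The homogeneous linear integral equation has only the zero solution. -/
theorem eq_zero_of_eq_integral_vecMul {A : ℝ → Matrix ι ι ℝ} (hA : EntrywiseIntegrable A)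
    {s t : ℝ} {f : ℝ → ι → ℝ} (hf : ContinuousOn f (uIcc s t))
    (h : ∀ u ∈ uIcc s t, ∀ j, f u j = ∫ v in s..u, (f v ᵥ* A v) j) : f t = 0 := by
  obtain ⟨C, hC⟩ := isCompact_uIcc.exists_bound_of_continuousOn hf
  have hC0 : 0 ≤ C := (norm_nonneg _).trans (hC s left_mem_uIcc)
  have hn : ∀ n : ℕ, ∀ u ∈ uIcc s t, ∀ i,
      |f u i| ≤ C * (|∫ v in s..u, entrySum A v| ^ n / n.factorial) := by
    intro n
    induction n with
    | zero => exact fun u hu i => by simpa using (norm_le_pi_norm (f u) i).trans (hC u hu)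
    | succ n ih =>
      intro u hu i
      rw [h u hu]
      exact abs_integral_vecMul_le hA hC0
        (fun w hw => ih w (uIcc_subset_uIcc left_mem_uIcc hu hw)) i
  ext i
  have hlim := ((Real.summable_pow_div_factorial
    |∫ v in s..t, entrySum A v|).tendsto_atTop_zero).const_mul C
  rw [mul_zero] at hlim
  have := ge_of_tendsto' hlim fun n => hn n t right_mem_uIcc i
  simpa using this

/-- Two solutions of the same linear integral equation agree. -/
theorem eq_of_eq_integral_vecMul {A : ℝ → Matrix ι ι ℝ} (hA : EntrywiseIntegrable A)
    {s t : ℝ} {f g : ℝ → ι → ℝ} {c : ι → ℝ} (hf : ContinuousOn f (uIcc s t))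
    (hg : ContinuousOn g (uIcc s t))
    (hf' : ∀ u ∈ uIcc s t, ∀ j, f u j = c j + ∫ v in s..u, (f v ᵥ* A v) j)
    (hg' : ∀ u ∈ uIcc s t, ∀ j, g u j = c j + ∫ v in s..u, (g v ᵥ* A v) j) : f t = g t := by
  have := eq_zero_of_eq_integral_vecMul hA (f := fun u => f u - g u) (hf.sub hg) ?_
  · exact sub_eq_zero.1 this
  intro u hu j
  have hsub := uIcc_subset_uIcc (left_mem_uIcc (a := s) (b := t)) hu
  simp only [Matrix.sub_vecMul, Pi.sub_apply]
  rw [intervalIntegral.integral_sub (hA.vecMul (hf.mono hsub) j) (hA.vecMul (hg.mono hsub) j),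
    hf' u hu, hg' u hu]
  ring

variable [DecidableEq ι]

/-- The terms of the Peano–Baker series of the product integral based at `s`. -/
def peanoBaker (A : ℝ → Matrix ι ι ℝ) (s : ℝ) : ℕ → ℝ → Matrix ι ι ℝ
  | 0, _ => 1
  | n + 1, t => Matrix.of fun i j => ∫ u in s..t, (peanoBaker A s n u * A u) i j

/-- The product integral `∏_s^t (I + A(u) du)` for arbitrary real `s`, `t`, as the sum of the
Peano–Baker series; for `t < s` this is the inverse of `∏_t^s (I + A(u) du)`. -/
def flow (A : ℝ → Matrix ι ι ℝ) (s t : ℝ) : Matrix ι ι ℝ :=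
  Matrix.of fun i j => ∑' n, peanoBaker A s n t i j

variable {A : ℝ → Matrix ι ι ℝ}

theorem continuous_peanoBaker (hA : EntrywiseIntegrable A) (s : ℝ) (n : ℕ) :
    Continuous (peanoBaker A s n) := by
  induction n with
  | zero => exact continuous_const
  | succ n ih =>
    refine continuous_matrix fun i j => ?_
    exact intervalIntegral.continuous_primitive (fun a b => hA.mul ih.continuousOn i j) s

theorem abs_peanoBaker_le (hA : EntrywiseIntegrable A) (s t : ℝ) (n : ℕ) (i j : ι) :
    |peanoBaker A s n t i j| ≤ |∫ v in s..t, entrySum A v| ^ n / n.factorial := by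
  induction n generalizing t i j with
  | zero =>
    simp only [peanoBaker, Matrix.one_apply, pow_zero, Nat.factorial_zero, Nat.cast_one, div_one]
    split_ifs <;> simp
  | succ n ih =>
    have := abs_integral_vecMul_le hA zero_le_one (s := s) (t := t) (n := n)
      (f := fun u => peanoBaker A s n u i) (fun u _ k => by simpa using ih u i k) j
    rw [one_mul] at this
    exact this

theorem abs_primitive_le_of_mem {a : ℝ → ℝ} (ha : ∀ b c, IntervalIntegrable a volume b c)
    (ha0 : ∀ u, 0 ≤ a u) {s t u : ℝ} (hu : u ∈ uIcc s t) :
    |∫ v in s..u, a v| ≤ |∫ v in s..t, a v| := by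
  refine intervalIntegral.abs_integral_mono_interval ?_ (ae_of_all _ fun v => ha0 v) (ha s t)
  rcases le_total s t with h | h
  · rw [uIcc_of_le h] at hu
    rw [uIoc_of_le h, uIoc_of_le hu.1]
    exact Ioc_subset_Ioc_right hu.2
  · rw [uIcc_of_ge h] at hu
    rw [uIoc_of_ge h, uIoc_of_ge hu.2]
    exact Ioc_subset_Ioc_left hu.1

theorem continuousOn_flow (hA : EntrywiseIntegrable A) (s a b : ℝ) (hs : s ∈ Icc a b) :
    ContinuousOn (flow A s) (Icc a b) := by
  have hent : ∀ i j, ContinuousOn (fun t => flow A s t i j) (Icc a b) := by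
    intro i j
    refine continuousOn_tsum (u := fun n : ℕ => (∫ v in a..b, entrySum A v) ^ n / n.factorial)
      (fun n => ((continuous_peanoBaker hA s n).matrix_elem i j).continuousOn)
      (Real.summable_pow_div_factorial _) fun n t ht => ?_
    rw [Real.norm_eq_abs]
    refine (abs_peanoBaker_le hA s t n i j).trans ?_
    gcongr
    have hab : a ≤ b := hs.1.trans hs.2
    have h0 : 0 ≤ ∫ v in a..b, entrySum A v :=
      intervalIntegral.integral_nonneg hab fun v _ => entrySum_nonneg A v
    rw [← abs_of_nonneg h0]
    refine intervalIntegral.abs_integral_mono_interval ?_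
      (ae_of_all _ fun v => entrySum_nonneg A v) (hA.intervalIntegrable_entrySum a b)
    rw [uIoc_of_le hab]
    exact fun x hx => ⟨(le_min hs.1 ht.1).trans_lt hx.1, hx.2.trans (max_le hs.2 ht.2)⟩
  exact continuousOn_pi.2 fun i => continuousOn_pi.2 fun j => hent i j

theorem continuous_flow_right (hA : EntrywiseIntegrable A) (s : ℝ) : Continuous (flow A s) := by
  refine continuous_iff_continuousAt.2 fun t => ?_
  refine (continuousOn_flow hA s (min s t - 1) (max s t + 1) ?_).continuousAt
    (Icc_mem_nhds ?_ ?_)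
  · constructor
    · linarith [min_le_left s t]
    · linarith [le_max_left s t]
  · linarith [min_le_right s t]
  · linarith [le_max_right s t]

theorem flow_eq_integral (hA : EntrywiseIntegrable A) (s t : ℝ) (i j : ι) :
    flow A s t i j = (1 : Matrix ι ι ℝ) i j + ∫ u in s..t, (flow A s u * A u) i j := by
  have hsum : ∀ u i j, Summable fun n => peanoBaker A s n u i j := fun u i j =>
    Summable.of_norm_bounded (Real.summable_pow_div_factorial _)
      fun n => abs_peanoBaker_le hA s u n i j
  have hmain : HasSum (fun n => ∫ u in s..t, (peanoBaker A s n u * A u) i j)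
      (∫ u in s..t, (flow A s u * A u) i j) := by
    have hsumm := Real.summable_pow_div_factorial |∫ v in s..t, entrySum A v|
    refine intervalIntegral.hasSum_integral_of_dominated_convergence
      (fun n u => |∫ v in s..t, entrySum A v| ^ n / n.factorial * entrySum A u)
      (fun n => ?_) (fun n => ?_) ?_ ?_ ?_
    · exact ((hA.mul (continuous_peanoBaker hA s n).continuousOn i j).def' ).1
    · refine ae_of_all _ fun u hu => ?_
      refine abs_vecMul_le (f := peanoBaker A s n u i) (fun k => ?_) u j
      refine (abs_peanoBaker_le hA s u n i k).trans ?_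
      have := abs_primitive_le_of_mem hA.intervalIntegrable_entrySum (entrySum_nonneg A)
        (uIoc_subset_uIcc hu)
      gcongr
    · exact ae_of_all _ fun u _ => hsumm.mul_right _
    · simp_rw [tsum_mul_right]
      exact (hA.intervalIntegrable_entrySum s t).const_mul _
    · refine ae_of_all _ fun u _ => ?_
      simp only [Matrix.mul_apply]
      exact hasSum_sum fun k _ => ((hsum u i k).hasSum).mul_right _
  rw [flow, Matrix.of_apply, (hsum t i j).tsum_eq_zero_add]
  congr 1
  exact hmain.tsum_eq

theorem flow_self (hA : EntrywiseIntegrable A) (s : ℝ) : flow A s s = 1 := by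
  ext i j
  rw [flow_eq_integral hA]
  simp

/-- Uniqueness: a continuous solution of the defining equation is the product integral. -/
theorem eq_flow_of_eq_integral (hA : EntrywiseIntegrable A) {s t : ℝ} {F : ℝ → Matrix ι ι ℝ}
    (hF : ContinuousOn F (uIcc s t)) (h : ∀ u ∈ uIcc s t, ∀ i j,
      F u i j = (1 : Matrix ι ι ℝ) i j + ∫ v in s..u, (F v * A v) i j) : F t = flow A s t := by
  ext i j
  have := eq_of_eq_integral_vecMul hA (f := fun u => F u i) (g := fun u => flow A s u i)
    (c := (1 : Matrix ι ι ℝ) i) ((continuous_apply i).comp_continuousOn hF)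
    ((continuous_apply i).comp_continuousOn (continuous_flow_right hA s).continuousOn)
    (fun u hu j => h u hu i j) (fun u _ j => flow_eq_integral hA s u i j)
  exact congrFun this j

/-- Both sides solve the same integral equation from time `r` on. -/
theorem flow_mul_flow (hA : EntrywiseIntegrable A) (s r t : ℝ) :
    flow A s r * flow A r t = flow A s t := by
  have hc := continuous_flow_right hA
  ext i j
  refine congrFun (eq_of_eq_integral_vecMul hA (s := r) (t := t) (c := flow A s r i)
    (f := fun u => (flow A s r * flow A r u) i) (g := fun u => flow A s u i)
    ((continuous_apply i).comp (continuous_const.matrix_mul (hc r))).continuousOn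
    ((continuous_apply i).comp (hc s)).continuousOn (fun u _ k => ?_) fun u _ k => ?_) j
  · have h1 : ∀ v, ((flow A s r * flow A r v) i ᵥ* A v) k
        = ∑ l, flow A s r i l * (flow A r v * A v) l k := by
      intro v
      rw [← Matrix.mul_apply, ← Matrix.mul_assoc]; rfl
    simp_rw [h1]
    have h2 : ∑ l, flow A s r i l * (1 : Matrix ι ι ℝ) l k = flow A s r i k := by
      rw [← Matrix.mul_apply, mul_one]
    rw [intervalIntegral.integral_finsetSum fun l _ =>
      (hA.mul (hc r).continuousOn l k).const_mul _]
    simp_rw [intervalIntegral.integral_const_mul, Matrix.mul_apply (M := flow A s r),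
      flow_eq_integral hA r u, mul_add, Finset.sum_add_distrib, h2]
  · have h3 := intervalIntegral.integral_add_adjacent_intervals
      (hA.mul (a := s) (b := r) (hc s).continuousOn i k)
      (hA.mul (a := r) (b := u) (hc s).continuousOn i k)
    have h4 := flow_eq_integral hA s u i k
    rw [← h3, ← add_assoc, ← flow_eq_integral hA s r i k] at h4
    exact h4

theorem flow_eq_inv_mul (hA : EntrywiseIntegrable A) (s t : ℝ) :
    flow A s t = (flow A 0 s)⁻¹ * flow A 0 t := by
  have h : flow A s 0 * flow A 0 s = 1 := by rw [flow_mul_flow hA, flow_self hA]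
  rw [Matrix.inv_eq_left_inv h, flow_mul_flow hA]

/-- Joint continuity follows from continuity in `t`, since `∏_s^t` is the quotient of `∏_0^t` by
`∏_0^s`. -/
theorem continuous_flow (hA : EntrywiseIntegrable A) :
    Continuous fun q : ℝ × ℝ => flow A q.1 q.2 := by
  have hc := continuous_flow_right hA 0
  have hdet : ∀ s, (flow A 0 s).det ≠ 0 := by
    intro s
    have h : flow A 0 s * flow A s 0 = 1 := by rw [flow_mul_flow hA, flow_self hA]
    have := congrArg Matrix.det h
    rw [Matrix.det_mul, Matrix.det_one] at this
    exact left_ne_zero_of_mul_eq_one this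
  have hinv : Continuous fun s => (flow A 0 s)⁻¹ := by
    simp_rw [Matrix.inv_def, Ring.inverse_eq_inv']
    exact (hc.matrix_det.inv₀ hdet).smul hc.matrix_adjugate
  rw [show (fun q : ℝ × ℝ => flow A q.1 q.2) = fun q => (flow A 0 q.1)⁻¹ * flow A 0 q.2 from
    funext fun q => flow_eq_inv_mul hA q.1 q.2]
  exact (hinv.comp continuous_fst).matrix_mul (hc.comp continuous_snd)

theorem continuous_flow_elem (hA : EntrywiseIntegrable A) (i j : ι) :
    Continuous fun q : ℝ × ℝ => flow A q.1 q.2 i j :=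
  (continuous_flow hA).matrix_elem i j

theorem flow_nonneg_of_nonneg (h0 : ∀ u i j, 0 ≤ A u i j) {s t : ℝ}
    (hst : s ≤ t) (i j : ι) : 0 ≤ flow A s t i j := by
  refine tsum_nonneg fun n => ?_
  have : ∀ t, s ≤ t → ∀ i j, 0 ≤ peanoBaker A s n t i j := by
    induction n with
    | zero =>
      intro t _ i j
      simp only [peanoBaker, Matrix.one_apply]
      split_ifs <;> simp
    | succ n ih =>
      intro t ht i j
      refine intervalIntegral.integral_nonneg ht fun u hu => ?_
      exact Finset.sum_nonneg fun k _ => mul_nonneg (ih u hu.1 i k) (h0 u k j)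
  exact this t hst i j

/-- Product integrals of functions with non-negative off-diagonal entries are non-negative: adding
a multiple `λ(u) I` of the identity makes all entries non-negative, and it multiplies the product
integral by a positive scalar. -/
theorem flow_nonneg (hA : EntrywiseIntegrable A) (h0 : ∀ u i j, i ≠ j → 0 ≤ A u i j) {s t : ℝ}
    (hst : s ≤ t) (i j : ι) : 0 ≤ flow A s t i j := by
  set l : ℝ → ℝ := fun u => ∑ i, |A u i i| with hl
  have hlint : ∀ a b, IntervalIntegrable l volume a b := by
    intro a b
    have : l = ∑ i, fun u => |A u i i| := by ext u; simp [hl, Finset.sum_apply]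
    rw [this]
    exact IntervalIntegrable.sum _ fun i _ => (hA i i a b).abs
  set B : ℝ → Matrix ι ι ℝ := fun u => A u + l u • 1 with hB
  have hBint : EntrywiseIntegrable B := by
    intro i j a b
    simp only [hB, Matrix.add_apply, Matrix.smul_apply, smul_eq_mul]
    exact (hA i j a b).add ((hlint a b).mul_const _)
  have hB0 : ∀ u i j, 0 ≤ B u i j := by
    intro u i j
    simp only [hB, Matrix.add_apply, Matrix.smul_apply, smul_eq_mul]
    by_cases hij : i = j
    · subst hij
      have h1 : |A u i i| ≤ l u :=
        Finset.single_le_sum (f := fun i => |A u i i|) (fun _ _ => abs_nonneg _) (Finset.mem_univ i)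
      have h2 := neg_abs_le (A u i i)
      rw [Matrix.one_apply_eq, mul_one]
      linarith
    · simpa [Matrix.one_apply_ne hij] using h0 u i j hij
  set C : ℝ → Matrix Unit Unit ℝ := fun u => Matrix.of fun _ _ => l u with hC
  have hCint : EntrywiseIntegrable C := fun _ _ => hlint
  have hCint' : EntrywiseIntegrable (fun u => - C u) := fun _ _ a b => (hlint a b).neg
  -- `c` and `r` are the exponentials of `∫ l` and of `-∫ l`, as product integrals in dimension one
  set c : ℝ → ℝ := fun t => flow C s t () () with hc
  set r : ℝ → ℝ := fun t => flow (fun u => - C u) s t () () with hr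
  have hceq : ∀ t, c t = 1 + ∫ u in s..t, c u * l u := by
    intro t
    simp only [hc]
    rw [flow_eq_integral hCint]
    simp [Matrix.mul_apply, hC]
  have hreq : ∀ t, r t = 1 + ∫ u in s..t, - (r u * l u) := by
    intro t
    simp only [hr]
    rw [flow_eq_integral hCint']
    simp [Matrix.mul_apply, hC]
  have hccont : Continuous c := (continuous_flow_right hCint s).matrix_elem _ _
  have hrcont : Continuous r := (continuous_flow_right hCint' s).matrix_elem _ _
  have hcs : c s = 1 := by rw [hceq]; simp
  have hrs : r s = 1 := by rw [hreq]; simp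
  have hrc : r t * c t = 1 := by
    have := mul_sub_mul_eq_integral (f := r) (g := c) (a := s) (b := t)
      ((hlint s t).continuousOn_mul hrcont.continuousOn).neg
      ((hlint s t).continuousOn_mul hccont.continuousOn)
      (fun t _ => by rw [hrs]; exact hreq t) (fun t _ => by rw [hcs]; exact hceq t)
    have h2 : ∀ u, -(r u * l u) * c u + r u * (c u * l u) = 0 := fun u => by ring
    simp only [Pi.neg_apply, h2, hrs, hcs, intervalIntegral.integral_zero] at this
    linarith
  have hr0 : 0 ≤ r t := by
    have hc0 : 0 ≤ c t := flow_nonneg_of_nonneg (fun u _ _ => by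
      simp only [hC, Matrix.of_apply, hl]
      exact Finset.sum_nonneg fun _ _ => abs_nonneg _) hst _ _
    by_contra! h
    nlinarith
  have hK := continuous_flow_right hBint s
  have key : ∀ t, r t • flow B s t = flow A s t := by
    intro t
    refine eq_flow_of_eq_integral hA (F := fun t => r t • flow B s t)
      (hrcont.smul hK).continuousOn fun u _ i j => ?_
    have := mul_sub_mul_eq_integral (f := r) (g := fun t => flow B s t i j) (a := s) (b := u)
      ((hlint s u).continuousOn_mul hrcont.continuousOn).neg
      (hBint.mul hK.continuousOn i j)
      (fun t _ => by rw [hrs]; exact hreq t)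
      (fun t _ => by rw [flow_self hBint]; exact flow_eq_integral hBint s t i j)
    rw [hrs, flow_self hBint, one_mul, sub_eq_iff_eq_add] at this
    rw [Matrix.smul_apply, smul_eq_mul, this, add_comm]
    congr 1
    refine intervalIntegral.integral_congr fun v _ => ?_
    simp only [Pi.neg_apply, hB, Matrix.mul_add, Matrix.mul_smul, Matrix.mul_one, Matrix.add_apply,
      Matrix.smul_apply, Matrix.smul_mul, smul_eq_mul]
    ring
  rw [← key t, Matrix.smul_apply, smul_eq_mul]
  exact mul_nonneg hr0 (flow_nonneg_of_nonneg hB0 hst i j)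

end Flow

/-! ### Product integrals on the half-line and intensities -/

/-- The function `A` on `[0, ∞)`, extended by zero to negative times. -/
def zeroExtend {ι : Type*} (A : ℝ → Matrix ι ι ℝ) (s : ℝ) : Matrix ι ι ℝ :=
  if 0 ≤ s then A s else 0

theorem zeroExtend_of_nonneg {ι : Type*} (A : ℝ → Matrix ι ι ℝ) {s : ℝ} (hs : 0 ≤ s) :
    zeroExtend A s = A s := if_pos hs

theorem entrywiseIntegrable_zeroExtend {ι : Type*} {A : ℝ → Matrix ι ι ℝ}
    (hA : ∀ i j, LocallyIntegrableOn (fun s => A s i j) (Ici 0)) :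
    EntrywiseIntegrable (zeroExtend A) := by
  intro i j a b
  have h1 : (fun s => zeroExtend A s i j) = (Ici (0 : ℝ)).indicator fun s => A s i j := by
    ext s
    by_cases hs : 0 ≤ s
    · simp [zeroExtend, hs]
    · simp [zeroExtend, hs]
  rw [h1, intervalIntegrable_iff, IntegrableOn, integrable_indicator_iff measurableSet_Ici,
    IntegrableOn, Measure.restrict_restrict measurableSet_Ici]
  refine ((hA i j).integrableOn_compact_subset (t := Icc 0 (max a b)) Icc_subset_Ici_self
    isCompact_Icc).mono_set ?_
  exact fun x hx => ⟨hx.1, hx.2.2⟩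

/-- The product integral on `[0, ∞)` exists, and it is the flow of the extension by zero. -/
theorem prodIntegral_eq_flow {ι : Type*} [Fintype ι] [DecidableEq ι] {A : ℝ → Matrix ι ι ℝ}
    (hA : EntrywiseIntegrable (zeroExtend A)) {s t : ℝ} (hs : 0 ≤ s) (hst : s ≤ t) :
    prodIntegral A s t = flow (zeroExtend A) s t := by
  have hcongr : ∀ (F : ℝ → Matrix ι ι ℝ) t, s ≤ t → ∀ i j,
      ∫ u in s..t, (F u * A u) i j = ∫ u in s..t, (F u * zeroExtend A u) i j := by
    intro F t ht i j
    refine intervalIntegral.integral_congr fun u hu => ?_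
    rw [uIcc_of_le ht] at hu
    simp only [zeroExtend_of_nonneg A (hs.trans hu.1)]
  have hex : ∃ F, IsProdIntegral A s F := by
    refine ⟨flow (zeroExtend A) s, (continuous_flow_right hA s).continuousOn, fun t ht i j => ?_⟩
    rw [hcongr _ _ ht]
    exact flow_eq_integral hA s t i j
  rw [prodIntegral, dif_pos hex]
  obtain ⟨h1, h2⟩ := hex.choose_spec
  have hsub : uIcc s t ⊆ Ici s := by rw [uIcc_of_le hst]; exact Icc_subset_Ici_self
  refine eq_flow_of_eq_integral hA (h1.mono hsub) fun u hu i j => ?_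
  rw [← hcongr _ _ (hsub hu)]
  exact h2 u (hsub hu) i j

theorem zeroExtend_intensity {p : ℕ} (T : ℝ → Matrix (Fin p) (Fin p) ℝ) :
    zeroExtend (intensity T) = intensity (zeroExtend T) := by
  ext s i j
  by_cases hs : 0 ≤ s
  · simp [zeroExtend, hs, intensity, exitRate]
  · rcases i with i | i <;> rcases j with j | j <;> simp [zeroExtend, hs, intensity, exitRate]

section Intensity

variable {p : ℕ} {T : ℝ → Matrix (Fin p) (Fin p) ℝ}

theorem intervalIntegrable_exitRate (hT : EntrywiseIntegrable T) (i : Fin p) (a b : ℝ) :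
    IntervalIntegrable (fun s => exitRate T s i) volume a b := by
  have : (fun s => exitRate T s i) = - ∑ j, fun s => T s i j := by
    ext s; simp [exitRate, Matrix.mulVec, dotProduct, Finset.sum_apply]
  rw [this]
  exact (IntervalIntegrable.sum _ fun j _ => hT i j a b).neg

theorem EntrywiseIntegrable.intensity (hT : EntrywiseIntegrable T) :
    EntrywiseIntegrable (intensity T) := by
  rintro (i | i) (j | j) a b
  · exact hT i j a b
  · exact intervalIntegrable_exitRate hT i a b
  · exact intervalIntegrable_const
  · exact intervalIntegrable_const

/-- The product integral of `Λ` is block triangular: its transient block is the product integral of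
`T`, and its rows sum to one. -/
theorem flow_intensity (hT : EntrywiseIntegrable T) (s t : ℝ) :
    flow (_root_.intensity T) s t = Matrix.fromBlocks (flow T s t)
      (Matrix.of fun i (_ : Unit) => 1 - ∑ j, flow T s t i j) 0 1 := by
  have hc := continuous_flow_right hT s
  symm
  refine eq_flow_of_eq_integral hT.intensity (F := fun t => Matrix.fromBlocks (flow T s t)
      (Matrix.of fun i (_ : Unit) => 1 - ∑ j, flow T s t i j) 0 1) ?_ fun u _ i j => ?_
  · refine (hc.matrix_fromBlocks (continuous_matrix fun i j => ?_) continuous_const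
      continuous_const).continuousOn
    exact continuous_const.sub (continuous_finsetSum _ fun k _ => hc.matrix_elem i k)
  rcases i with i | i <;> rcases j with j | j
  · simpa [_root_.intensity, Matrix.fromBlocks_multiply, Matrix.one_apply] using
      flow_eq_integral hT s u i j
  · have h1 : ∀ v, (flow T s v * Matrix.replicateCol Unit (exitRate T v)) i j
        = - ∑ k, (flow T s v * T v) i k := by
      intro v
      simp only [Matrix.mul_apply, Matrix.replicateCol_apply, exitRate, Matrix.mulVec, dotProduct,
        Pi.neg_apply, Pi.one_apply, mul_one, mul_neg, Finset.sum_neg_distrib, Finset.mul_sum]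
      rw [Finset.sum_comm]
    simp only [_root_.intensity, Matrix.fromBlocks_multiply, Matrix.fromBlocks_apply₁₂,
      Matrix.mul_zero, add_zero, h1, intervalIntegral.integral_neg, Matrix.of_apply]
    rw [intervalIntegral.integral_finsetSum fun k _ => hT.mul hc.continuousOn i k]
    simp_rw [flow_eq_integral hT s u, Finset.sum_add_distrib]
    simp [Matrix.one_apply]
  · simp [_root_.intensity, Matrix.fromBlocks_multiply]
  · simp [_root_.intensity, Matrix.fromBlocks_multiply]

end Intensity

/-! ### Paths with finitely many jumps -/

instance instDiscreteMeasurableSpaceState {p : ℕ} : DiscreteMeasurableSpace (State p) :=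
  ⟨fun _ => measurableSet_sum_iff.2 ⟨.of_discrete, .of_discrete⟩⟩

/-- The paths of `X` are right-continuous on `[0, ∞)`, with left limits in the discrete space of
states. -/
structure HasRegularPaths {Ω : Type*} {p : ℕ} (X : ℝ → Ω → State p) : Prop where
  right_continuous : ∀ ω t, 0 ≤ t → ∀ᶠ u in 𝓝[>] t, X u ω = X t ω
  left_limit : ∀ ω t, 0 < t → ∃ i, ∀ᶠ u in 𝓝[<] t, X u ω = i

/-- The ordered pairs of distinct states. -/
abbrev transitions (p : ℕ) : Finset (State p × State p) := Finset.univ.filter fun q => q.1 ≠ q.2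

section Paths

variable {Ω : Type*} {p : ℕ} {X : ℝ → Ω → State p}

/-- The times at which the path changes its state. -/
def allJumpTimes (X : ℝ → Ω → State p) (ω : Ω) : Set ℝ :=
  {s | ∃ i j, i ≠ j ∧ s ∈ jumpTimes X i j ω}

theorem jumpTimes_subset_allJumpTimes {i j : State p} (hij : i ≠ j) (ω : Ω) :
    jumpTimes X i j ω ⊆ allJumpTimes X ω := fun _ hs => ⟨i, j, hij, hs⟩

theorem jumpMeasure_apply (X : ℝ → Ω → State p) (i j : State p) (ω : Ω) {A : Set ℝ}
    (hA : MeasurableSet A) : jumpMeasure X i j ω A = (jumpTimes X i j ω ∩ A).encard := by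
  rw [jumpMeasure, Measure.sum_apply _ hA, ← ENNReal.tsum_set_one, Set.inter_comm]
  simp_rw [Measure.dirac_apply' _ hA]
  rw [tsum_subtype (jumpTimes X i j ω) (fun s => A.indicator (1 : ℝ → ℝ≥0∞) s),
    tsum_subtype (A ∩ jumpTimes X i j ω) (fun _ => (1 : ℝ≥0∞)), Set.indicator_indicator,
    Set.inter_comm]
  rfl

theorem jumpMeasure_Iic_zero (X : ℝ → Ω → State p) (i j : State p) (ω : Ω) :
    jumpMeasure X i j ω (Iic 0) = 0 := by
  rw [jumpMeasure_apply X i j ω measurableSet_Iic]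
  have : jumpTimes X i j ω ∩ Iic 0 = ∅ := by
    ext s; simp only [mem_inter_iff, mem_Iic, mem_empty_iff_false, iff_false, not_and, not_le]
    exact fun h => h.1
  simp [this]

theorem jumpMeasure_Ioc_max (X : ℝ → Ω → State p) (i j : State p) (ω : Ω) (a b : ℝ) :
    jumpMeasure X i j ω (Ioc a b) = jumpMeasure X i j ω (Ioc (max a 0) (max b 0)) := by
  rw [jumpMeasure_apply X i j ω measurableSet_Ioc, jumpMeasure_apply X i j ω measurableSet_Ioc]
  congr 2
  ext s
  simp only [mem_inter_iff, mem_Ioc, max_lt_iff, le_max_iff]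
  constructor
  · exact fun h => ⟨h.1, ⟨h.2.1, h.1.1⟩, Or.inl h.2.2⟩
  · exact fun h => ⟨h.1, h.2.1.1, h.2.2.resolve_right (not_le.2 h.1.1)⟩

variable (hX : HasRegularPaths X)

include hX

/-- A path without jumps in `(a, b]` is locally constant on `[a, b]`, and hence constant there. -/
theorem HasRegularPaths.eq_of_no_jump {ω : Ω} {a b : ℝ} (ha : 0 ≤ a)
    (h : allJumpTimes X ω ∩ Ioc a b = ∅) {t : ℝ} (ht : t ∈ Icc a b) : X t ω = X a ω := by
  refine isPreconnected_Icc.constant (f := fun t => X t ω) (s := Icc a b) (fun s hs => ?_) ht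
    (left_mem_Icc.2 (ht.1.trans ht.2))
  have hs0 : 0 ≤ s := ha.trans hs.1
  have hev : ∀ᶠ u in 𝓝[Icc a b] s, X u ω = X s ω := by
    have hright := hX.right_continuous ω s hs0
    rcases hs.1.eq_or_lt with rfl | has
    · have : ∀ᶠ u in 𝓝[≥] a, X u ω = X a ω := by
        rw [← Ioi_insert, nhdsWithin_insert, eventually_sup]
        exact ⟨by simp, hright⟩
      exact this.filter_mono (nhdsWithin_mono _ Icc_subset_Ici_self)
    · obtain ⟨i, hi⟩ := hX.left_limit ω s (hs0.lt_of_ne (by linarith))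
      have his : X s ω = i := by
        by_contra hne
        have : s ∈ allJumpTimes X ω ∩ Ioc a b :=
          ⟨⟨i, X s ω, fun h => hne h.symm, ha.trans_lt has, hi, rfl⟩, has, hs.2⟩
        rw [h] at this
        exact this
      have : ∀ᶠ u in 𝓝 s, X u ω = X s ω := by
        rw [← nhdsWithin_univ, ← Iio_union_Ici (a := s), ← Ioi_insert, nhdsWithin_union,
          nhdsWithin_insert, eventually_sup, eventually_sup]
        exact ⟨his ▸ hi, by simp, hright⟩
      exact this.filter_mono nhdsWithin_le_nhds
  exact tendsto_nhds_of_eventually_eq hev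

/-- Jump times have no accumulation point: the path is constant shortly before and after any time. -/
theorem HasRegularPaths.finite_allJumpTimes (ω : Ω) (b : ℝ) :
    (allJumpTimes X ω ∩ Iic b).Finite := by
  have hpos : ∀ s ∈ allJumpTimes X ω, 0 < s := fun s ⟨_, _, _, h⟩ => h.1
  have hconst : ∀ {s : ℝ} {i : State p}, (∀ᶠ u in 𝓝 s, X u ω = i) → s ∉ allJumpTimes X ω := by
    rintro s i h ⟨k, l, hkl, -, h1, h2⟩
    obtain ⟨u, hu1, hu2⟩ := (h1.and (h.filter_mono nhdsWithin_le_nhds)).exists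
    exact hkl (hu1.symm.trans (hu2.trans (h.self_of_nhds.symm.trans h2)))
  have hside : ∀ (i : State p) {t : ℝ} {U : Set ℝ}, IsOpen U → (∀ᶠ u in 𝓝[U] t, X u ω = i) →
      ∀ᶠ u in 𝓝[U] t, u ∉ allJumpTimes X ω := by
    intro i t U hU h
    filter_upwards [eventually_eventually_nhdsWithin.2 h, self_mem_nhdsWithin] with s hs hsU
    rw [hU.nhdsWithin_eq hsU] at hs
    exact hconst hs
  by_contra hinf
  obtain ⟨t, htK, ht⟩ := Set.Infinite.exists_accPt_of_subset_isCompact (K := Icc 0 b) hinf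
    isCompact_Icc (fun s hs => ⟨(hpos s hs.1).le, hs.2⟩)
  rw [accPt_iff_frequently_nhdsNE] at ht
  refine ht ?_
  have : ∀ᶠ u in 𝓝[≠] t, u ∉ allJumpTimes X ω := by
    rw [← Iio_union_Ioi, nhdsWithin_union, eventually_sup]
    refine ⟨?_, hside _ isOpen_Ioi (hX.right_continuous ω t htK.1)⟩
    rcases htK.1.eq_or_lt with rfl | h0
    · filter_upwards [self_mem_nhdsWithin] with u hu hJ
      exact lt_asymm hu (hpos u hJ)
    · obtain ⟨i, hi⟩ := hX.left_limit ω t h0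
      exact hside i isOpen_Iio hi
  exact this.mono fun u hu h => hu h.1

theorem HasRegularPaths.jumpMeasure_Ioc_lt_top {i j : State p} (hij : i ≠ j) (ω : Ω) (a b : ℝ) :
    jumpMeasure X i j ω (Ioc a b) < ⊤ := by
  rw [jumpMeasure_apply X i j ω measurableSet_Ioc]
  have : (jumpTimes X i j ω ∩ Ioc a b).Finite := (hX.finite_allJumpTimes ω b).subset
    (inter_subset_inter (jumpTimes_subset_allJumpTimes hij ω) fun x hx => hx.2)
  rw [this.encard_eq_coe_toFinset_card]
  simp

/-- If at most one jump falls into `(a, b]`, then the states at the end points record it. -/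
theorem HasRegularPaths.jumpMeasure_Ioc_of_subsingleton {i j : State p} (hij : i ≠ j) {ω : Ω}
    {a b : ℝ} (ha : 0 ≤ a) (hab : a ≤ b) (h : (allJumpTimes X ω ∩ Ioc a b).Subsingleton) :
    jumpMeasure X i j ω (Ioc a b) = {ω | X a ω = i ∧ X b ω = j}.indicator 1 ω := by
  rw [jumpMeasure_apply X i j ω measurableSet_Ioc]
  have hsub : jumpTimes X i j ω ∩ Ioc a b ⊆ allJumpTimes X ω ∩ Ioc a b :=
    inter_subset_inter_left _ (jumpTimes_subset_allJumpTimes hij ω)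
  rcases h.eq_empty_or_singleton with h0 | ⟨s, hs⟩
  · have hconst := hX.eq_of_no_jump ha h0 (right_mem_Icc.2 hab)
    have hnot : ω ∉ {ω | X a ω = i ∧ X b ω = j} := fun hh =>
      hij (hh.1.symm.trans (hconst.symm.trans hh.2))
    rw [h0, subset_empty_iff] at hsub
    rw [indicator_of_notMem hnot, hsub]
    simp
  · have hsmem : s ∈ allJumpTimes X ω ∩ Ioc a b := by rw [hs]; rfl
    have hleft : ∀ᶠ u in 𝓝[<] s, X u ω = X a ω := by
      filter_upwards [Ioo_mem_nhdsLT hsmem.2.1] with u hu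
      refine hX.eq_of_no_jump ha ?_ (b := u) ⟨hu.1.le, le_rfl⟩
      by_contra hne
      obtain ⟨v, hv⟩ := nonempty_iff_ne_empty.2 hne
      have : v ∈ allJumpTimes X ω ∩ Ioc a b :=
        ⟨hv.1, hv.2.1, hv.2.2.trans (hu.2.le.trans hsmem.2.2)⟩
      rw [hs] at this
      exact absurd hv.2.2 (not_le.2 (this ▸ hu.2))
    have hright : X b ω = X s ω := by
      refine hX.eq_of_no_jump (ha.trans hsmem.2.1.le) ?_ (b := b) ⟨hsmem.2.2, le_rfl⟩
      by_contra hne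
      obtain ⟨v, hv⟩ := nonempty_iff_ne_empty.2 hne
      have : v ∈ allJumpTimes X ω ∩ Ioc a b :=
        ⟨hv.1, hsmem.2.1.trans hv.2.1, hv.2.2⟩
      rw [hs] at this
      exact absurd hv.2.1 (by rw [this]; exact lt_irrefl s)
    by_cases hc : X a ω = i ∧ X b ω = j
    · have : jumpTimes X i j ω ∩ Ioc a b = {s} := by
        refine Subset.antisymm (hs ▸ hsub) (singleton_subset_iff.2 ⟨⟨?_, ?_, ?_⟩, hsmem.2⟩)
        · exact ha.trans_lt hsmem.2.1
        · exact hc.1 ▸ hleft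
        · exact hright ▸ hc.2
      rw [indicator_of_mem (show ω ∈ {ω | X a ω = i ∧ X b ω = j} from hc), this]
      simp
    · have : jumpTimes X i j ω ∩ Ioc a b = ∅ := by
        rw [eq_empty_iff_forall_notMem]
        intro v hv
        have hvs : v = s := by simpa [hs] using hsub hv
        subst hvs
        obtain ⟨u, hu1, hu2⟩ := (hleft.and hv.1.2.1).exists
        exact hc ⟨hu1.symm.trans hu2, hright.trans hv.1.2.2⟩
      rw [indicator_of_notMem (show ω ∉ {ω | X a ω = i ∧ X b ω = j} from hc), this]
      simp

theorem HasRegularPaths.indicator_le_sum_jumpMeasure {i j : State p} (hij : i ≠ j) (ω : Ω)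
    {a b : ℝ} (ha : 0 ≤ a) (hab : a ≤ b) :
    {ω | X a ω = i ∧ X b ω = j}.indicator 1 ω ≤
      ∑ q ∈ transitions p, jumpMeasure X q.1 q.2 ω (Ioc a b) := by
  by_cases hc : ω ∈ {ω | X a ω = i ∧ X b ω = j}
  · have hne : (allJumpTimes X ω ∩ Ioc a b).Nonempty := by
      rw [nonempty_iff_ne_empty]
      intro h0
      have := hX.eq_of_no_jump ha h0 (right_mem_Icc.2 hab)
      exact hij (hc.1.symm.trans (this.symm.trans hc.2))
    obtain ⟨s, ⟨k, l, hkl, hs⟩, hsab⟩ := hne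
    rw [indicator_of_mem hc]
    refine le_trans ?_ (Finset.single_le_sum (f := fun q : State p × State p =>
      jumpMeasure X q.1 q.2 ω (Ioc a b)) (fun _ _ => zero_le)
      (Finset.mem_filter.2 ⟨Finset.mem_univ (k, l), hkl⟩))
    simp only [Pi.one_apply]
    rw [jumpMeasure_apply X k l ω measurableSet_Ioc]
    have : (1 : ℕ∞) ≤ (jumpTimes X k l ω ∩ Ioc a b).encard :=
      Set.one_le_encard_iff_nonempty.2 ⟨s, hs, hsab⟩
    exact_mod_cast this
  · rw [indicator_of_notMem hc]
    exact zero_le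

omit hX

/-- The `k`-th point of the partition of `[a, b]` into `n + 1` pieces of equal length. -/
def gridPoint (a b : ℝ) (n k : ℕ) : ℝ := a + (b - a) * k / (n + 1)

theorem gridPoint_zero (a b : ℝ) (n : ℕ) : gridPoint a b n 0 = a := by simp [gridPoint]

theorem gridPoint_last (a b : ℝ) (n : ℕ) : gridPoint a b n (n + 1) = b := by
  have : (n : ℝ) + 1 ≠ 0 := by positivity
  simp [gridPoint, this]

theorem gridPoint_mono {a b : ℝ} (hab : a ≤ b) (n : ℕ) : Monotone (gridPoint a b n) := by
  intro k l hkl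
  have : (k : ℝ) ≤ l := by exact_mod_cast hkl
  unfold gridPoint
  have := sub_nonneg.2 hab
  gcongr

theorem gridPoint_succ_sub (a b : ℝ) (n k : ℕ) :
    gridPoint a b n (k + 1) - gridPoint a b n k = (b - a) / (n + 1) := by
  simp only [gridPoint]; push_cast; ring

theorem gridPoint_mem_Icc {a b : ℝ} (hab : a ≤ b) {n k : ℕ} (hk : k ≤ n + 1) :
    gridPoint a b n k ∈ Icc a b :=
  ⟨(gridPoint_zero a b n).symm.le.trans (gridPoint_mono hab n (Nat.zero_le k)),
    (gridPoint_mono hab n hk).trans (gridPoint_last a b n).le⟩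

theorem tendsto_mesh (a b : ℝ) : Tendsto (fun n : ℕ => (b - a) / (n + 1 : ℝ)) atTop (𝓝 0) := by
  have := (tendsto_one_div_add_atTop_nhds_zero_nat (𝕜 := ℝ)).const_mul (b - a)
  simpa [div_eq_mul_inv] using this

theorem measure_Ioc_eq_sum (μ : Measure ℝ) {t : ℕ → ℝ} (ht : Monotone t) (m : ℕ) :
    μ (Ioc (t 0) (t m)) = ∑ k ∈ Finset.range m, μ (Ioc (t k) (t (k + 1))) := by
  induction m with
  | zero => simp
  | succ m ih =>
    rw [Finset.sum_range_succ, ← ih, ← measure_union _ measurableSet_Ioc,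
      Ioc_union_Ioc_eq_Ioc (ht (Nat.zero_le m)) (ht (Nat.le_succ m))]
    rw [Set.disjoint_left]
    exact fun x hx hx' => absurd hx.2 (not_le.2 hx'.1)

theorem measure_Ioc_eq_sum_gridPoint (μ : Measure ℝ) {a b : ℝ} (hab : a ≤ b) (n : ℕ) :
    μ (Ioc a b) = ∑ k ∈ Finset.range (n + 1),
      μ (Ioc (gridPoint a b n k) (gridPoint a b n (k + 1))) := by
  rw [← measure_Ioc_eq_sum μ (gridPoint_mono hab n), gridPoint_zero, gridPoint_last]

/-- The number of transitions from `i` to `j` seen on the grid of mesh `(b - a) / (n + 1)`. -/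
def gridCount (X : ℝ → Ω → State p) (i j : State p) (a b : ℝ) (n : ℕ) (ω : Ω) : ℝ≥0∞ :=
  ∑ k ∈ Finset.range (n + 1),
    {ω | X (gridPoint a b n k) ω = i ∧ X (gridPoint a b n (k + 1)) ω = j}.indicator 1 ω

include hX

/-- The grid counts are dominated by the total number of jumps. -/
theorem HasRegularPaths.gridCount_le {i j : State p} (hij : i ≠ j) {a b : ℝ} (ha : 0 ≤ a)
    (hab : a ≤ b) (n : ℕ) (ω : Ω) :
    gridCount X i j a b n ω ≤ ∑ q ∈ transitions p, jumpMeasure X q.1 q.2 ω (Ioc a b) := by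
  simp_rw [measure_Ioc_eq_sum_gridPoint _ hab n]
  rw [Finset.sum_comm]
  exact Finset.sum_le_sum fun k hk => hX.indicator_le_sum_jumpMeasure hij ω
    (ha.trans (gridPoint_mem_Icc hab (Finset.mem_range.1 hk).le).1)
    (gridPoint_mono hab n (Nat.le_succ k))

/-- Once the mesh is finer than the gaps between jumps, the grid shows every jump. -/
theorem HasRegularPaths.tendsto_gridCount {i j : State p} (hij : i ≠ j) {a b : ℝ} (ha : 0 ≤ a)
    (hab : a ≤ b) (ω : Ω) :
    Tendsto (fun n => gridCount X i j a b n ω) atTop (𝓝 (jumpMeasure X i j ω (Ioc a b))) := by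
  refine tendsto_nhds_of_eventually_eq ?_
  have hfin : (allJumpTimes X ω ∩ Ioc a b).Finite := (hX.finite_allJumpTimes ω b).subset
    (inter_subset_inter_right _ fun x hx => hx.2)
  have hgap : ∃ δ > 0, ∀ x ∈ allJumpTimes X ω ∩ Ioc a b, ∀ y ∈ allJumpTimes X ω ∩ Ioc a b,
      x ≠ y → δ ≤ |x - y| := by
    by_cases hn : (allJumpTimes X ω ∩ Ioc a b).Nontrivial
    · exact ⟨_, hfin.infsep_pos_iff_nontrivial.2 hn, fun x hx y hy hxy => by
        rw [← Real.dist_eq]; exact infsep_le_dist_of_mem hx hy hxy⟩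
    · exact ⟨1, one_pos, fun x hx y hy hxy => absurd (not_nontrivial_iff.1 hn hx hy) hxy⟩
  obtain ⟨δ, hδ, hgap⟩ := hgap
  filter_upwards [(tendsto_mesh a b).eventually (gt_mem_nhds hδ)] with n hn
  rw [gridCount, measure_Ioc_eq_sum_gridPoint _ hab n]
  refine Finset.sum_congr rfl fun k hk => ?_
  have hk' := Finset.mem_range.1 hk
  have h1 := gridPoint_mem_Icc hab (n := n) hk'.le
  have h2 := gridPoint_mem_Icc hab (n := n) (Nat.succ_le_of_lt hk')
  refine (hX.jumpMeasure_Ioc_of_subsingleton hij (ha.trans h1.1)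
    (gridPoint_mono hab n (Nat.le_succ k)) ?_).symm
  intro x hx y hy
  by_contra hxy
  have h3 := hgap x ⟨hx.1, h1.1.trans_lt hx.2.1, hx.2.2.trans h2.2⟩ y
    ⟨hy.1, h1.1.trans_lt hy.2.1, hy.2.2.trans h2.2⟩ hxy
  have h4 := gridPoint_succ_sub a b n k
  have h5 : |x - y| ≤ gridPoint a b n (k + 1) - gridPoint a b n k := by
    rw [abs_le]
    constructor <;> linarith [hx.2.1, hx.2.2, hy.2.1, hy.2.2]
  linarith

end Paths

/-! ### Measurability of functionals of the path -/

section Measurability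

variable {Ω : Type*} [MeasurableSpace Ω] {p : ℕ} {X : ℝ → Ω → State p}
  (hX : HasRegularPaths X) (hm : ∀ t, 0 ≤ t → Measurable (X t))

include hm

theorem measurableSet_state {t : ℝ} (ht : 0 ≤ t) (i : State p) : MeasurableSet {ω | X t ω = i} :=
  hm t ht (measurableSet_singleton i)

theorem measurable_gridCount (i j : State p) {a b : ℝ} (ha : 0 ≤ a) (hab : a ≤ b) (n : ℕ) :
    Measurable (gridCount X i j a b n) := by
  refine Finset.measurable_fun_sum _ fun k hk => measurable_one.indicator ?_
  have hk' := Finset.mem_range.1 hk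
  exact (measurableSet_state hm (ha.trans (gridPoint_mem_Icc hab hk'.le).1) i).inter
    (measurableSet_state hm (ha.trans (gridPoint_mem_Icc hab (Nat.succ_le_of_lt hk')).1) j)

include hX

/-- The number of jumps in an interval is a limit of functionals of finitely many states. -/
theorem measurable_jumpMeasure_Ioc {i j : State p} (hij : i ≠ j) (a b : ℝ) :
    Measurable fun ω => jumpMeasure X i j ω (Ioc a b) := by
  have key : ∀ {a b : ℝ}, 0 ≤ a → a ≤ b → Measurable fun ω => jumpMeasure X i j ω (Ioc a b) :=
    fun {a b} ha hab => measurable_of_tendsto_metrizable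
      (fun n => measurable_gridCount hm i j ha hab n)
      (tendsto_pi_nhds.2 fun ω => hX.tendsto_gridCount hij ha hab ω)
  rw [show (fun ω => jumpMeasure X i j ω (Ioc a b)) = fun ω =>
    jumpMeasure X i j ω (Ioc (max a 0) (max b 0)) from
    funext fun ω => jumpMeasure_Ioc_max X i j ω a b]
  rcases le_total (max a 0) (max b 0) with h | h
  · exact key (le_max_right _ _) h
  · simp only [Ioc_eq_empty (not_lt.2 h), measure_empty, measurable_const]

/-- The jump measure is a random measure: it depends measurably on the path. -/
theorem measurable_jumpMeasure {i j : State p} (hij : i ≠ j) : Measurable (jumpMeasure X i j) := by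
  have hK : ∀ K : ℕ, Measurable fun ω => (jumpMeasure X i j ω).restrict (Ioc 0 (K : ℝ)) := by
    intro K
    have hfin : ∀ ω, IsFiniteMeasure ((jumpMeasure X i j ω).restrict (Ioc 0 (K : ℝ))) := fun ω =>
      ⟨by rw [Measure.restrict_apply_univ]; exact hX.jumpMeasure_Ioc_lt_top hij ω 0 K⟩
    refine Measurable.measure_of_isPiSystem (BorelSpace.measurable_eq.trans
      (borel_eq_generateFrom_Ioc ℝ)) (isPiSystem_Ioc id id) ?_ ?_
    · rintro _ ⟨a, b, -, rfl⟩
      simp only [Measure.restrict_apply measurableSet_Ioc, Ioc_inter_Ioc]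
      exact measurable_jumpMeasure_Ioc hX hm hij _ _
    · simp_rw [Measure.restrict_apply_univ]
      exact measurable_jumpMeasure_Ioc hX hm hij _ _
  refine Measure.measurable_of_measurable_coe _ fun A hA => ?_
  have hsup : ∀ ω, jumpMeasure X i j ω A =
      ⨆ K : ℕ, (jumpMeasure X i j ω).restrict (Ioc 0 (K : ℝ)) A := by
    intro ω
    simp_rw [Measure.restrict_apply hA]
    rw [← Monotone.measure_iUnion]
    · have : ⋃ K : ℕ, Ioc (0 : ℝ) K = Ioi 0 := by
        ext x
        simp only [mem_iUnion, mem_Ioc, mem_Ioi]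
        exact ⟨fun ⟨_, h⟩ => h.1, fun h => (exists_nat_ge x).imp fun _ hn => ⟨h, hn⟩⟩
      rw [← inter_iUnion, this, measure_inter_conull]
      rw [compl_Ioi]
      exact jumpMeasure_Iic_zero X i j ω
    · intro K L hKL
      exact inter_subset_inter_right _ (Ioc_subset_Ioc_right (by exact_mod_cast hKL))
  simp_rw [hsup]
  exact Measurable.iSup fun K => (Measure.measurable_coe hA).comp (hK K)

theorem measurable_absorptionTime : Measurable (absorptionTime X) := by
  refine measurable_of_Iio fun c => ?_
  -- by right-continuity, absorption before `c` is seen at rational times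
  have hset : ∀ ω c, (∃ t, 0 ≤ t ∧ t < c ∧ X t ω = absorbingState) →
      ∃ q : ℚ, 0 ≤ (q : ℝ) ∧ (q : ℝ) < c ∧ X q ω = absorbingState := by
    rintro ω c ⟨t, ht0, htc, ht⟩
    have hev := (hX.right_continuous ω t ht0).and (Ioo_mem_nhdsGT htc)
    obtain ⟨u, hu, hsub⟩ := (mem_nhdsGT_iff_exists_Ioo_subset).1 hev
    obtain ⟨q, hq1, hq2⟩ := exists_rat_btwn (mem_Ioi.1 hu)
    have := hsub ⟨hq1, hq2⟩
    exact ⟨q, ht0.trans hq1.le, this.2.2, this.1.trans ht⟩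
  have hQ : ∀ c : ℝ, MeasurableSet
      {ω | ∃ q : ℚ, 0 ≤ (q : ℝ) ∧ (q : ℝ) < c ∧ X q ω = absorbingState} := by
    intro c
    simp only [ofPred_exists]
    refine MeasurableSet.iUnion fun q => ?_
    by_cases h : 0 ≤ (q : ℝ) ∧ (q : ℝ) < c
    · simpa [h.1, h.2] using measurableSet_state hm h.1 absorbingState
    · have : {ω | 0 ≤ (q : ℝ) ∧ (q : ℝ) < c ∧ X q ω = absorbingState} = ∅ := by
        ext ω; simp only [mem_ofPred_eq, mem_empty_iff_false, iff_false]; tauto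
      rw [this]; exact MeasurableSet.empty
  -- paths that are never absorbed have `absorptionTime = sInf ∅ = 0`
  have hnever : MeasurableSet {ω | ∃ t, 0 ≤ t ∧ X t ω = absorbingState} := by
    have : {ω | ∃ t, 0 ≤ t ∧ X t ω = absorbingState} = ⋃ n : ℕ,
        {ω | ∃ q : ℚ, 0 ≤ (q : ℝ) ∧ (q : ℝ) < n ∧ X q ω = absorbingState} := by
      ext ω
      simp only [mem_ofPred_eq, mem_iUnion]
      constructor
      · rintro ⟨t, h0, h⟩
        obtain ⟨n, hn⟩ := exists_nat_gt t
        exact ⟨n, hset ω n ⟨t, h0, hn, h⟩⟩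
      · rintro ⟨n, q, h0, -, h⟩
        exact ⟨q, h0, h⟩
    rw [this]
    exact MeasurableSet.iUnion fun n => hQ n
  have hbdd : ∀ ω, BddBelow {t | 0 ≤ t ∧ X t ω = absorbingState} := fun ω => ⟨0, fun t ht => ht.1⟩
  by_cases hc : 0 < c
  · have : absorptionTime X ⁻¹' Iio c =
        {ω | ∃ q : ℚ, 0 ≤ (q : ℝ) ∧ (q : ℝ) < c ∧ X q ω = absorbingState} ∪
          {ω | ∃ t, 0 ≤ t ∧ X t ω = absorbingState}ᶜ := by
      ext ω
      simp only [mem_preimage, mem_Iio, mem_union, mem_compl_iff, mem_ofPred_eq, absorptionTime]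
      constructor
      · intro h
        by_cases hne : ∃ t, 0 ≤ t ∧ X t ω = absorbingState
        · left
          obtain ⟨t, ht, htc⟩ := (csInf_lt_iff (hbdd ω) hne).1 h
          exact hset ω c ⟨t, ht.1, htc, ht.2⟩
        · exact Or.inr hne
      · rintro (⟨q, h0, hqc, hq⟩ | hne)
        · exact (csInf_le (hbdd ω) ⟨h0, hq⟩).trans_lt hqc
        · have : {t | 0 ≤ t ∧ X t ω = absorbingState} = ∅ := by
            rw [eq_empty_iff_forall_notMem]; exact fun t ht => hne ⟨t, ht⟩
          rw [this, Real.sInf_empty]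
          exact hc
    rw [this]
    exact (hQ c).union hnever.compl
  · have : absorptionTime X ⁻¹' Iio c = ∅ := by
      rw [eq_empty_iff_forall_notMem]
      intro ω h
      exact absurd (lt_of_le_of_lt (Real.sInf_nonneg fun t ht => ht.1) h) hc
    rw [this]
    exact MeasurableSet.empty

/-- Occupation indicators are jointly measurable in time and chance. -/
theorem measurable_occ_prod (i : State p) :
    Measurable fun q : ℝ × Ω => occ X i (max q.1 0) q.2 := by
  have hocc : ∀ t, 0 ≤ t → Measurable (occ X i t) := fun t ht =>
    Measurable.ite (measurableSet_state hm ht i) measurable_const measurable_const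
  -- by right-continuity, the path is the limit of its values at grid points strictly to the right
  refine measurable_of_tendsto_metrizable (f := fun (n : ℕ) (q : ℝ × Ω) =>
    occ X i ((⌊max q.1 0 * (n + 1)⌋₊ + 1 : ℝ) / (n + 1)) q.2) (fun n => ?_)
    (tendsto_pi_nhds.2 fun q => ?_)
  · have h1 : Measurable fun q : ℕ × Ω => occ X i ((q.1 + 1 : ℝ) / (n + 1)) q.2 :=
      measurable_from_prod_countable_right fun k => hocc ((k + 1 : ℝ) / (n + 1)) (by positivity)
    exact h1.comp (g := fun q : ℕ × Ω => occ X i ((q.1 + 1 : ℝ) / (n + 1)) q.2)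
      (f := fun q : ℝ × Ω => (⌊max q.1 0 * (n + 1)⌋₊, q.2))
      ((Nat.measurable_floor.comp (by fun_prop)).prodMk measurable_snd)
  · set t := max q.1 0 with ht
    have ht0 : 0 ≤ t := le_max_right _ _
    have hlim : Tendsto (fun n : ℕ => (⌊t * (n + 1)⌋₊ + 1 : ℝ) / (n + 1)) atTop (𝓝[>] t) := by
      refine tendsto_nhdsWithin_iff.2 ⟨?_, Eventually.of_forall fun n => ?_⟩
      · have h0 := (tendsto_one_div_add_atTop_nhds_zero_nat (𝕜 := ℝ)).const_add t
        rw [add_zero] at h0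
        refine tendsto_of_tendsto_of_tendsto_of_le_of_le tendsto_const_nhds h0 (fun n => ?_)
          fun n => ?_
        · have hn : (0 : ℝ) < n + 1 := by positivity
          rw [le_div_iff₀ hn]
          exact (Nat.lt_floor_add_one _).le
        · have hn : (0 : ℝ) < n + 1 := by positivity
          simp only
          rw [div_le_iff₀ hn, add_mul, one_div, inv_mul_cancel₀ hn.ne']
          gcongr
          exact Nat.floor_le (by positivity)
      · have hn : (0 : ℝ) < n + 1 := by positivity
        rw [mem_Ioi, lt_div_iff₀ hn]
        exact Nat.lt_floor_add_one _
    refine tendsto_nhds_of_eventually_eq ?_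
    filter_upwards [hlim.eventually (hX.right_continuous q.2 t ht0)] with n hn
    simp only [occ, hn]

end Measurability

/-! ### Transition probabilities -/

section Transition

variable {p : ℕ} {T : ℝ → Matrix (Fin p) (Fin p) ℝ}

/-- The transition matrix `P(s, t) = ∏_s^t (I + Λ(u) du)`, with `Λ` extended by zero to negative
times, as a continuous function of `(s, t)` on the plane. -/
def transition (T : ℝ → Matrix (Fin p) (Fin p) ℝ) (s t : ℝ) : Matrix (State p) (State p) ℝ :=
  flow (intensity (zeroExtend T)) s t

/-- The distribution of the state at time `s`. -/
def stateProb (π : Fin p → ℝ) (T : ℝ → Matrix (Fin p) (Fin p) ℝ) (s : ℝ) : State p → ℝ :=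
  Sum.elim π 0 ᵥ* transition T 0 s

/-- The density at `x` of the absorption time, given that the state at time `s` is `j`. -/
def exitDensity (T : ℝ → Matrix (Fin p) (Fin p) ℝ) (j : Fin p) (s x : ℝ) : ℝ :=
  (flow (zeroExtend T) s x *ᵥ exitRate (zeroExtend T) x) j

theorem IsSubIntensity.entrywiseIntegrable (hT : IsSubIntensity T) :
    EntrywiseIntegrable (zeroExtend T) := entrywiseIntegrable_zeroExtend hT.locallyIntegrable

theorem IsSubIntensity.entrywiseIntegrable_intensity (hT : IsSubIntensity T) :
    EntrywiseIntegrable (intensity (zeroExtend T)) := hT.entrywiseIntegrable.intensity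

theorem IsSubIntensity.measurable_zeroExtend (hT : IsSubIntensity T) (i j : Fin p) :
    Measurable fun s => zeroExtend T s i j := by
  have : (fun s => zeroExtend T s i j) = fun s => if 0 ≤ s then T s i j else 0 := by
    ext s; simp only [zeroExtend]; split_ifs <;> rfl
  rw [this]
  exact Measurable.ite measurableSet_Ici (hT.measurable i j) measurable_const

theorem IsSubIntensity.measurable_exitRate (hT : IsSubIntensity T) (i : Fin p) :
    Measurable fun s => exitRate T s i := by
  simp only [exitRate, Pi.neg_apply, Matrix.mulVec, dotProduct]
  exact (Finset.measurable_fun_sum _ fun j _ => (hT.measurable i j).mul_const _).neg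

theorem IsSubIntensity.measurable_exitRate_zeroExtend (hT : IsSubIntensity T) (i : Fin p) :
    Measurable fun s => exitRate (zeroExtend T) s i := by
  simp only [exitRate, Pi.neg_apply, Matrix.mulVec, dotProduct]
  exact (Finset.measurable_fun_sum _ fun j _ => (hT.measurable_zeroExtend i j).mul_const _).neg

theorem IsSubIntensity.measurable_intensity (hT : IsSubIntensity T) (i j : State p) :
    Measurable fun s => intensity T s i j := by
  rcases i with i | i <;> rcases j with j | j
  · exact hT.measurable i j
  · exact hT.measurable_exitRate i
  · exact measurable_const
  · exact measurable_const

theorem IsSubIntensity.measurable_intensity_zeroExtend (hT : IsSubIntensity T) (i j : State p) :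
    Measurable fun s => intensity (zeroExtend T) s i j := by
  rcases i with i | i <;> rcases j with j | j
  · exact hT.measurable_zeroExtend i j
  · exact hT.measurable_exitRate_zeroExtend i
  · exact measurable_const
  · exact measurable_const

theorem exitRate_zeroExtend {s : ℝ} (hs : 0 ≤ s) :
    exitRate (zeroExtend T) s = exitRate T s := by
  simp [exitRate, zeroExtend_of_nonneg T hs]

theorem intensity_zeroExtend {s : ℝ} (hs : 0 ≤ s) :
    intensity (zeroExtend T) s = intensity T s := by
  simp [intensity, exitRate_zeroExtend hs, zeroExtend_of_nonneg T hs]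

theorem IsSubIntensity.exitRate_zeroExtend_nonneg (hT : IsSubIntensity T) (s : ℝ) (i : Fin p) :
    0 ≤ exitRate (zeroExtend T) s i := by
  by_cases hs : 0 ≤ s
  · rw [exitRate_zeroExtend hs]; exact hT.exitRate_nonneg s hs i
  · simp [exitRate, zeroExtend, hs]

theorem IsSubIntensity.intensity_zeroExtend_nonneg (hT : IsSubIntensity T) (s : ℝ)
    {i j : State p} (hij : i ≠ j) : 0 ≤ intensity (zeroExtend T) s i j := by
  rcases i with i | i <;> rcases j with j | j
  · by_cases hs : 0 ≤ s
    · rw [intensity_zeroExtend hs]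
      exact hT.offDiag_nonneg s hs i j fun h => hij (by rw [h])
    · simp [intensity, zeroExtend, hs]
  · exact hT.exitRate_zeroExtend_nonneg s i
  · exact le_rfl
  · exact le_rfl

theorem IsSubIntensity.intensity_nonneg (hT : IsSubIntensity T) {s : ℝ} (hs : 0 ≤ s)
    {i j : State p} (hij : i ≠ j) : 0 ≤ intensity T s i j := by
  rw [← intensity_zeroExtend hs]; exact hT.intensity_zeroExtend_nonneg s hij

theorem IsSubIntensity.transition_nonneg (hT : IsSubIntensity T) {s t : ℝ} (hst : s ≤ t)
    (i j : State p) : 0 ≤ transition T s t i j :=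
  flow_nonneg hT.entrywiseIntegrable_intensity
    (fun u _ _ h => hT.intensity_zeroExtend_nonneg u h) hst i j

theorem IsSubIntensity.flow_zeroExtend_nonneg (hT : IsSubIntensity T) {s t : ℝ} (hst : s ≤ t)
    (i j : Fin p) : 0 ≤ flow (zeroExtend T) s t i j :=
  flow_nonneg hT.entrywiseIntegrable (fun u i j h =>
    hT.intensity_zeroExtend_nonneg u (i := Sum.inl i) (j := Sum.inl j) fun hh =>
      h (Sum.inl_injective hh)) hst i j

theorem IsSubIntensity.continuous_transition (hT : IsSubIntensity T) (i j : State p) :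
    Continuous fun q : ℝ × ℝ => transition T q.1 q.2 i j :=
  continuous_flow_elem hT.entrywiseIntegrable_intensity i j

theorem IsSubIntensity.transition_inl_inl (hT : IsSubIntensity T) (s t : ℝ) (i j : Fin p) :
    transition T s t (Sum.inl i) (Sum.inl j) = flow (zeroExtend T) s t i j := by
  rw [transition, flow_intensity hT.entrywiseIntegrable]; rfl

theorem IsSubIntensity.transition_absorbing (hT : IsSubIntensity T) (s t : ℝ) (j : State p) :
    transition T s t absorbingState j = (1 : Matrix (State p) (State p) ℝ) absorbingState j := by
  rw [transition, flow_intensity hT.entrywiseIntegrable]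
  rcases j with j | j <;> simp [absorbingState]

theorem IsSubIntensity.sum_transition (hT : IsSubIntensity T) (s t : ℝ) (i : State p) :
    ∑ j, transition T s t i j = 1 := by
  rw [transition, flow_intensity hT.entrywiseIntegrable, Fintype.sum_sum_type]
  rcases i with i | i <;> simp

/-- The distribution function of the absorption time, given a transient state. -/
theorem IsSubIntensity.transition_inl_absorbing (hT : IsSubIntensity T) (s t : ℝ) (i : Fin p) :
    transition T s t (Sum.inl i) absorbingState = ∫ x in s..t, exitDensity T i s x := by
  rw [transition, flow_eq_integral hT.entrywiseIntegrable_intensity]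
  rw [Matrix.one_apply_ne (by simp), zero_add]
  refine intervalIntegral.integral_congr fun x _ => ?_
  rw [flow_intensity hT.entrywiseIntegrable, intensity, Matrix.fromBlocks_multiply]
  simp only [absorbingState, Matrix.fromBlocks_apply₁₂, Matrix.mul_zero, add_zero]
  rfl

theorem prodIntegral_intensity (hT : IsSubIntensity T) {s t : ℝ} (hs : 0 ≤ s) (hst : s ≤ t) :
    prodIntegral (intensity T) s t = transition T s t := by
  rw [prodIntegral_eq_flow (by rw [zeroExtend_intensity]; exact hT.entrywiseIntegrable_intensity)
    hs hst, zeroExtend_intensity, transition]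

theorem subTransition_eq_flow (hT : IsSubIntensity T) {s t : ℝ} (hs : 0 ≤ s) (hst : s ≤ t) :
    subTransition T s t = flow (zeroExtend T) s t :=
  prodIntegral_eq_flow hT.entrywiseIntegrable hs hst

theorem subTransition_mulVec_exitRate (hT : IsSubIntensity T) {s x : ℝ} (hs : 0 ≤ s) (hsx : s ≤ x)
    (j : Fin p) : (subTransition T s x *ᵥ exitRate T x) j = exitDensity T j s x := by
  rw [subTransition_eq_flow hT hs hsx, exitDensity, exitRate_zeroExtend (hs.trans hsx)]

theorem stateProb_inl (hT : IsSubIntensity T) (π : Fin p → ℝ) (s : ℝ) (i : Fin p) :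
    stateProb π T s (Sum.inl i) = (π ᵥ* flow (zeroExtend T) 0 s) i := by
  simp [stateProb, Matrix.vecMul, dotProduct, hT.transition_inl_inl]

theorem vecMul_subTransition (hT : IsSubIntensity T) (π : Fin p → ℝ) {s : ℝ} (hs : 0 ≤ s)
    (i : Fin p) : (π ᵥ* subTransition T 0 s) i = stateProb π T s (Sum.inl i) := by
  rw [subTransition_eq_flow hT le_rfl hs, stateProb_inl hT]

theorem IsSubIntensity.continuous_stateProb (hT : IsSubIntensity T) (π : Fin p → ℝ)
    (i : State p) : Continuous fun s => stateProb π T s i := by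
  simp only [stateProb, Matrix.vecMul, dotProduct]
  exact continuous_finsetSum _ fun k _ => continuous_const.mul
    ((hT.continuous_transition k i).comp (continuous_const.prodMk continuous_id))

theorem IsSubIntensity.stateProb_nonneg (hT : IsSubIntensity T) {π : Fin p → ℝ}
    (hπ : π ∈ stdSimplex ℝ (Fin p)) {s : ℝ} (hs : 0 ≤ s) (i : State p) :
    0 ≤ stateProb π T s i := by
  simp only [stateProb, Matrix.vecMul, dotProduct]
  refine Finset.sum_nonneg fun k _ => mul_nonneg ?_ (hT.transition_nonneg hs k i)
  rcases k with k | k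
  · exact hπ.1 k
  · exact le_rfl

theorem stateProb_zero (hT : IsSubIntensity T) (π : Fin p → ℝ) (i : Fin p) :
    stateProb π T 0 (Sum.inl i) = π i := by
  rw [stateProb_inl hT, flow_self hT.entrywiseIntegrable, Matrix.vecMul_one]

theorem IsSubIntensity.exitDensity_nonneg (hT : IsSubIntensity T) {s x : ℝ} (hsx : s ≤ x)
    (j : Fin p) : 0 ≤ exitDensity T j s x := by
  simp only [exitDensity, Matrix.mulVec, dotProduct]
  exact Finset.sum_nonneg fun k _ => mul_nonneg (hT.flow_zeroExtend_nonneg hsx j k)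
    (hT.exitRate_zeroExtend_nonneg x k)

theorem IsSubIntensity.measurable_exitDensity (hT : IsSubIntensity T) (j : Fin p) :
    Measurable fun q : ℝ × ℝ => exitDensity T j q.1 q.2 := by
  simp only [exitDensity, Matrix.mulVec, dotProduct]
  exact Finset.measurable_fun_sum _ fun k _ =>
    (continuous_flow_elem hT.entrywiseIntegrable j k).measurable.mul
      ((hT.measurable_exitRate_zeroExtend k).comp measurable_snd)

theorem IsSubIntensity.continuous_exitDensity_left (hT : IsSubIntensity T) (j : Fin p) (x : ℝ) :
    Continuous fun s => exitDensity T j s x := by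
  simp only [exitDensity, Matrix.mulVec, dotProduct]
  exact continuous_finsetSum _ fun k _ => ((continuous_flow_elem hT.entrywiseIntegrable j k).comp
    (continuous_id.prodMk continuous_const)).mul continuous_const

theorem IsSubIntensity.intervalIntegrable_exitDensity (hT : IsSubIntensity T) (j : Fin p)
    (s a b : ℝ) : IntervalIntegrable (fun x => exitDensity T j s x) volume a b := by
  have : (fun x => exitDensity T j s x) = ∑ k, fun x => flow (zeroExtend T) s x j k *
      exitRate (zeroExtend T) x k := by
    ext x; simp [exitDensity, Matrix.mulVec, dotProduct, Finset.sum_apply]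
  rw [this]
  refine IntervalIntegrable.sum _ fun k _ =>
    (intervalIntegrable_exitRate hT.entrywiseIntegrable k a b).continuousOn_mul ?_
  exact ((continuous_flow_right hT.entrywiseIntegrable s).matrix_elem j k).continuousOn

end Transition

/-! ### Finite-dimensional distributions -/

section Law

variable {Ω : Type*} [MeasurableSpace Ω] {P : Measure Ω} [IsProbabilityMeasure P] {p : ℕ}
  {π : Fin p → ℝ} {T : ℝ → Matrix (Fin p) (Fin p) ℝ} {X : ℝ → Ω → State p}

omit [IsProbabilityMeasure P] in
theorem IsMarkovJumpProcess.hasRegularPaths (hX : IsMarkovJumpProcess P π T X) :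
    HasRegularPaths X := ⟨hX.right_continuous, hX.left_limit⟩

omit [IsProbabilityMeasure P] in
theorem IsMarkovJumpProcess.history_le (hX : IsMarkovJumpProcess P π T X) (s : ℝ) :
    history X s ≤ ‹MeasurableSpace Ω› :=
  iSup₂_le fun r hr => (hX.measurable r hr.1).comap_le

omit [MeasurableSpace Ω] in
theorem measurable_history {r s : ℝ} (hr : r ∈ Icc 0 s) : Measurable[history X s] (X r) :=
  measurable_iff_comap_le.2 (le_iSup₂_of_le r hr le_rfl)

omit [MeasurableSpace Ω] in
theorem occ_eq_indicator (i : State p) (s : ℝ) : occ X i s = {ω | X s ω = i}.indicator 1 := by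
  ext ω
  simp [occ, indicator_apply]

/-- The Markov property on events of the past. -/
theorem IsMarkovJumpProcess.measureReal_inter (hX : IsMarkovJumpProcess P π T X)
    (hT : IsSubIntensity T) {s t : ℝ} (hs : 0 ≤ s) (hst : s ≤ t) {S : Set Ω}
    (hS : MeasurableSet[history X s] S) (i j : State p) :
    P.real ((S ∩ {ω | X s ω = i}) ∩ {ω | X t ω = j}) =
      P.real (S ∩ {ω | X s ω = i}) * transition T s t i j := by
  have hm := hX.history_le s
  have hset : MeasurableSet {ω | X t ω = j} := measurableSet_state hX.measurable (hs.trans hst) j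
  have hS' : MeasurableSet[history X s] (S ∩ {ω | X s ω = i}) :=
    hS.inter (measurable_history ⟨hs, le_rfl⟩ (measurableSet_singleton i))
  have hint : Integrable (occ X j t) P := by
    rw [occ_eq_indicator]
    exact (integrable_const (1 : ℝ)).indicator hset
  have h1 := setIntegral_condExp hm hint hS'
  have h2 : ∫ ω in S ∩ {ω | X s ω = i}, (P[occ X j t | history X s]) ω ∂P =
      ∫ ω in S ∩ {ω | X s ω = i}, transition T s t i j ∂P := by
    refine setIntegral_congr_ae (hm _ hS') ?_
    filter_upwards [hX.markov s t hs hst j] with ω hω hmem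
    rw [hω, prodIntegral_intensity hT hs hst, hmem.2]
  rw [h2, setIntegral_const, occ_eq_indicator, setIntegral_indicator hset] at h1
  simp only [Pi.one_apply, setIntegral_const, smul_eq_mul, mul_one] at h1
  exact h1.symm

theorem IsMarkovJumpProcess.measureReal_state (hX : IsMarkovJumpProcess P π T X)
    (hT : IsSubIntensity T) (hπ : π ∈ stdSimplex ℝ (Fin p)) {s : ℝ} (hs : 0 ≤ s) (i : State p) :
    P.real {ω | X s ω = i} = stateProb π T s i := by
  have h0 : ∀ k, P.real {ω | X 0 ω = k} = Sum.elim π 0 k := by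
    rintro (k | k)
    · rw [measureReal_def, hX.initial, ENNReal.toReal_ofReal (hπ.1 k)]; rfl
    · rw [measureReal_def, hX.initial_absorbing]; rfl
  have h1 : ∀ k, P.real ({ω | X 0 ω = k} ∩ {ω | X s ω = i})
      = Sum.elim π 0 k * transition T 0 s k i := by
    intro k
    have := hX.measureReal_inter hT le_rfl hs (S := univ) MeasurableSet.univ k i
    rwa [univ_inter, h0] at this
  have h2 : {ω | X s ω = i} = ⋃ k ∈ (Finset.univ : Finset (State p)),
      {ω | X 0 ω = k} ∩ {ω | X s ω = i} := by
    ext ω; simp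
  rw [h2, measureReal_biUnion_finset]
  · simp_rw [h1]; rfl
  · intro k _ l _ hkl
    rw [Function.onFun, Set.disjoint_left]
    rintro ω ⟨h, -⟩ ⟨h', -⟩
    exact hkl (h.symm.trans h')
  · exact fun k _ => (measurableSet_state hX.measurable le_rfl k).inter
      (measurableSet_state hX.measurable hs i)

theorem IsMarkovJumpProcess.measureReal_state_state (hX : IsMarkovJumpProcess P π T X)
    (hT : IsSubIntensity T) (hπ : π ∈ stdSimplex ℝ (Fin p)) {s t : ℝ} (hs : 0 ≤ s) (hst : s ≤ t)
    (i j : State p) : P.real ({ω | X s ω = i} ∩ {ω | X t ω = j}) =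
      stateProb π T s i * transition T s t i j := by
  have := hX.measureReal_inter hT hs hst (S := univ) MeasurableSet.univ i j
  rwa [univ_inter, hX.measureReal_state hT hπ hs] at this

theorem IsMarkovJumpProcess.measureReal_state_state_state (hX : IsMarkovJumpProcess P π T X)
    (hT : IsSubIntensity T) (hπ : π ∈ stdSimplex ℝ (Fin p)) {s t c : ℝ} (hs : 0 ≤ s)
    (hst : s ≤ t) (htc : t ≤ c) (i j l : State p) :
    P.real ({ω | X s ω = i ∧ X t ω = j} ∩ {ω | X c ω = l}) =
      stateProb π T s i * transition T s t i j * transition T t c j l := by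
  have := hX.measureReal_inter hT (hs.trans hst) htc (S := {ω | X s ω = i})
    (measurable_history ⟨hs, hst⟩ (measurableSet_singleton i)) j l
  rwa [hX.measureReal_state_state hT hπ hs hst] at this

/-! ### Expected numbers of jumps -/

/-- Riemann–Stieltjes sums in which the integrand is evaluated at nearby points. -/
theorem tendsto_sum_integral_gridPoint {Ψ : ℝ → ℝ → ℝ → ℝ} {l : ℝ → ℝ}
    (hΨ : Continuous fun q : ℝ × ℝ × ℝ => Ψ q.1 q.2.1 q.2.2)
    (hl : ∀ a b, IntervalIntegrable l volume a b) {a b : ℝ} (hab : a ≤ b) :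
    Tendsto (fun n => ∑ k ∈ Finset.range (n + 1),
      ∫ u in gridPoint a b n k..gridPoint a b n (k + 1),
        Ψ (gridPoint a b n k) u (gridPoint a b n (k + 1)) * l u) atTop
      (𝓝 (∫ u in a..b, Ψ u u u * l u)) := by
  have hdiag : Continuous fun u => Ψ u u u :=
    hΨ.comp (continuous_id.prodMk (continuous_id.prodMk continuous_id))
  have hint1 : ∀ a b, IntervalIntegrable (fun u => Ψ u u u * l u) volume a b := fun a b =>
    (hl a b).continuousOn_mul hdiag.continuousOn
  have hint2 : ∀ s t a b, IntervalIntegrable (fun u => Ψ s u t * l u) volume a b :=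
    fun s t a b => (hl a b).continuousOn_mul (hΨ.comp (continuous_const.prodMk
      (continuous_id.prodMk continuous_const))).continuousOn
  set I := ∫ u in a..b, |l u| with hI
  have hI0 : 0 ≤ I := intervalIntegral.integral_nonneg hab fun u _ => abs_nonneg _
  have huc := (isCompact_Icc (a := a) (b := b)).prod
    ((isCompact_Icc (a := a) (b := b)).prod (isCompact_Icc (a := a) (b := b)))
    |>.uniformContinuousOn_of_continuous hΨ.continuousOn
  rw [Metric.uniformContinuousOn_iff] at huc
  rw [Metric.tendsto_atTop]
  intro ε hε
  obtain ⟨δ, hδ, huc⟩ := huc (ε / (I + 1)) (by positivity)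
  obtain ⟨n₀, hn₀⟩ := eventually_atTop.1 ((tendsto_mesh a b).eventually (gt_mem_nhds hδ))
  refine ⟨n₀, fun n hn => ?_⟩
  have hmesh := hn₀ n hn
  have hsplit : ∀ (g : ℝ → ℝ), (∀ a b, IntervalIntegrable g volume a b) →
      ∫ u in a..b, g u = ∑ k ∈ Finset.range (n + 1),
        ∫ u in gridPoint a b n k..gridPoint a b n (k + 1), g u := by
    intro g hg
    rw [intervalIntegral.sum_integral_adjacent_intervals fun k _ => hg _ _, gridPoint_zero,
      gridPoint_last]
  rw [Real.dist_eq, hsplit _ hint1, ← Finset.sum_sub_distrib]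
  refine (Finset.abs_sum_le_sum_abs _ _).trans_lt ?_
  have hpiece : ∀ k ∈ Finset.range (n + 1),
      |(∫ u in gridPoint a b n k..gridPoint a b n (k + 1),
        Ψ (gridPoint a b n k) u (gridPoint a b n (k + 1)) * l u) -
        ∫ u in gridPoint a b n k..gridPoint a b n (k + 1), Ψ u u u * l u| ≤
      ∫ u in gridPoint a b n k..gridPoint a b n (k + 1), ε / (I + 1) * |l u| := by
    intro k hk
    have hk' := Finset.mem_range.1 hk
    have h1 := gridPoint_mem_Icc hab (n := n) hk'.le
    have h2 := gridPoint_mem_Icc hab (n := n) (Nat.succ_le_of_lt hk')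
    have h3 := gridPoint_succ_sub a b n k
    have h4 := gridPoint_mono hab n (Nat.le_succ k)
    rw [← intervalIntegral.integral_sub (hint2 _ _ _ _) (hint1 _ _), ← Real.norm_eq_abs]
    refine intervalIntegral.norm_integral_le_of_norm_le h4 (ae_of_all _ fun u hu => ?_)
      ((hl _ _).abs.const_mul _)
    rw [← sub_mul, norm_mul, Real.norm_eq_abs, Real.norm_eq_abs]
    have hu' : u ∈ Icc a b := ⟨h1.1.trans hu.1.le, hu.2.trans h2.2⟩
    have := huc (gridPoint a b n k, u, gridPoint a b n (k + 1)) ⟨h1, hu', h2⟩ (u, u, u)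
      ⟨hu', hu', hu'⟩ ?_
    · rw [Real.dist_eq] at this
      exact mul_le_mul_of_nonneg_right this.le (abs_nonneg _)
    · simp only [Prod.dist_eq, Real.dist_eq, max_lt_iff, sub_self, abs_zero]
      refine ⟨?_, hδ, ?_⟩
      · rw [abs_lt]; constructor <;> linarith [hu.1, hu.2]
      · rw [abs_lt]; constructor <;> linarith [hu.1, hu.2]
  refine (Finset.sum_le_sum hpiece).trans_lt ?_
  rw [← hsplit (fun u => ε / (I + 1) * |l u|) (fun a b => (hl a b).abs.const_mul _),
    intervalIntegral.integral_const_mul, ← hI, div_mul_eq_mul_div, div_lt_iff₀ (by positivity)]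
  nlinarith

/-- The rate `P(X(u) = i) μ_ij(u) P(X(c) = l | X(u) = j)`, the density in `u` of the expected number
of jumps from `i` to `j`, on the event that the state at time `c` is `l`. -/
def jumpRate (π : Fin p → ℝ) (T : ℝ → Matrix (Fin p) (Fin p) ℝ) (i j l : State p) (c u : ℝ) : ℝ :=
  stateProb π T u i * intensity (zeroExtend T) u i j * transition T u c j l

omit [IsProbabilityMeasure P] in
theorem IsSubIntensity.intervalIntegrable_jumpRate (hT : IsSubIntensity T) (π : Fin p → ℝ)
    (i j l : State p) (c a b : ℝ) :
    IntervalIntegrable (jumpRate π T i j l c) volume a b :=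
  ((hT.entrywiseIntegrable_intensity i j a b).continuousOn_mul
    (hT.continuous_stateProb π i).continuousOn).mul_continuousOn
    ((hT.continuous_transition j l).comp (continuous_id.prodMk continuous_const)).continuousOn

/-- By the Markov property the expected grid count is a sum of products
`P(X(s) = i) P_ij(s, t) P_jl(t, c)` over grid intervals `(s, t]`, and `P_ij(s, t) = ∫_s^t (P Λ)_ij`
turns it into a Riemann–Stieltjes sum. -/
theorem IsMarkovJumpProcess.tendsto_setLIntegral_gridCount (hX : IsMarkovJumpProcess P π T X)
    (hT : IsSubIntensity T) (hπ : π ∈ stdSimplex ℝ (Fin p)) {i j : State p} (hij : i ≠ j)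
    {a b c : ℝ} (ha : 0 ≤ a) (hab : a ≤ b) (hbc : b ≤ c) (l : State p) :
    Tendsto (fun n => ∫⁻ ω in {ω | X c ω = l}, gridCount X i j a b n ω ∂P) atTop
      (𝓝 (ENNReal.ofReal (∫ u in a..b, jumpRate π T i j l c u))) := by
  have hΛ := hT.entrywiseIntegrable_intensity
  have hval : ∀ n, ∫⁻ ω in {ω | X c ω = l}, gridCount X i j a b n ω ∂P =
      ENNReal.ofReal (∑ k ∈ Finset.range (n + 1), stateProb π T (gridPoint a b n k) i *
        transition T (gridPoint a b n k) (gridPoint a b n (k + 1)) i j *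
        transition T (gridPoint a b n (k + 1)) c j l) := by
    intro n
    simp only [gridCount]
    rw [lintegral_finsetSum']
    · rw [ENNReal.ofReal_sum_of_nonneg]
      · refine Finset.sum_congr rfl fun k hk => ?_
        have hk' := Finset.mem_range.1 hk
        have h1 := gridPoint_mem_Icc hab (n := n) hk'.le
        have h2 := gridPoint_mem_Icc hab (n := n) (Nat.succ_le_of_lt hk')
        have h3 := gridPoint_mono hab n (Nat.le_succ k)
        have hset : MeasurableSet {ω | X (gridPoint a b n k) ω = i ∧
            X (gridPoint a b n (k + 1)) ω = j} :=
          (measurableSet_state hX.measurable (ha.trans h1.1) i).inter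
            (measurableSet_state hX.measurable (ha.trans h2.1) j)
        rw [← hX.measureReal_state_state_state hT hπ (ha.trans h1.1) h3 (h2.2.trans hbc) i j l,
          ofReal_measureReal, lintegral_indicator_one hset, Measure.restrict_apply hset]
      · intro k hk
        have hk' := Finset.mem_range.1 hk
        have h1 := gridPoint_mem_Icc hab (n := n) hk'.le
        have h2 := gridPoint_mem_Icc hab (n := n) (Nat.succ_le_of_lt hk')
        have h3 := gridPoint_mono hab n (Nat.le_succ k)
        exact mul_nonneg (mul_nonneg (hT.stateProb_nonneg hπ (ha.trans h1.1) i)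
          (hT.transition_nonneg h3 i j)) (hT.transition_nonneg (h2.2.trans hbc) j l)
    · intro k hk
      have hk' := Finset.mem_range.1 hk
      have h1 := gridPoint_mem_Icc hab (n := n) hk'.le
      have h2 := gridPoint_mem_Icc hab (n := n) (Nat.succ_le_of_lt hk')
      exact (measurable_one.indicator
          ((measurableSet_state hX.measurable (ha.trans h1.1) i).inter
            (measurableSet_state hX.measurable (ha.trans h2.1) j))).aemeasurable
  simp_rw [hval]
  refine ENNReal.tendsto_ofReal ?_
  -- write each transition probability as an integral and pass to the limit term by term
  have hlim := tendsto_finsetSum Finset.univ fun m (_ : m ∈ (Finset.univ : Finset (State p))) =>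
    tendsto_sum_integral_gridPoint (a := a) (b := b)
      (Ψ := fun s u t => stateProb π T s i * transition T s u i m * transition T t c j l)
      (l := fun u => intensity (zeroExtend T) u m j) (by
        have h1 := hT.continuous_stateProb π i
        have h2 := hT.continuous_transition i m
        have h3 := hT.continuous_transition j l
        exact ((h1.comp continuous_fst).mul (h2.comp (continuous_fst.prodMk
          (continuous_fst.comp continuous_snd)))).mul (h3.comp
            ((continuous_snd.comp continuous_snd).prodMk continuous_const)))
      (hΛ m j) hab
  have hR : ∑ m, ∫ u in a..b, stateProb π T u i * transition T u u i m * transition T u c j l *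
      intensity (zeroExtend T) u m j = ∫ u in a..b, jumpRate π T i j l c u := by
    rw [Finset.sum_eq_single i]
    · refine intervalIntegral.integral_congr fun u _ => ?_
      simp only [jumpRate, transition, flow_self hΛ, Matrix.one_apply_eq]
      ring
    · intro m _ hm
      simp [transition, flow_self hΛ, Matrix.one_apply_ne (Ne.symm hm)]
    · simp
  rw [hR] at hlim
  refine hlim.congr fun n => ?_
  rw [Finset.sum_comm]
  refine Finset.sum_congr rfl fun k _ => ?_
  set s := gridPoint a b n k
  set t := gridPoint a b n (k + 1)
  have hflow : transition T s t i j =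
      ∑ m, ∫ u in s..t, transition T s u i m * intensity (zeroExtend T) u m j := by
    rw [transition, flow_eq_integral hΛ, Matrix.one_apply_ne hij, zero_add]
    simp_rw [Matrix.mul_apply]
    rw [intervalIntegral.integral_finsetSum]
    · rfl
    · exact fun m _ => (hΛ m j s t).continuousOn_mul
        ((continuous_flow_right hΛ s).matrix_elem i m).continuousOn
  rw [hflow, Finset.mul_sum, Finset.sum_mul]
  refine Finset.sum_congr rfl fun m _ => ?_
  rw [← intervalIntegral.integral_const_mul, ← intervalIntegral.integral_mul_const]
  exact intervalIntegral.integral_congr fun u _ => by ring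

omit [IsProbabilityMeasure P] in
theorem lintegral_eq_sum_setLIntegral_state (hX : IsMarkovJumpProcess P π T X) {c : ℝ}
    (hc : 0 ≤ c) (f : Ω → ℝ≥0∞) :
    ∫⁻ ω, f ω ∂P = ∑ l, ∫⁻ ω in {ω | X c ω = l}, f ω ∂P := by
  have : (⋃ l ∈ (Finset.univ : Finset (State p)), {ω | X c ω = l}) = univ := by
    ext ω; simp
  rw [← setLIntegral_univ, ← this, lintegral_biUnion_finset]
  · intro k _ l _ hkl
    rw [Function.onFun, Set.disjoint_left]
    exact fun ω h h' => hkl (h.symm.trans h')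
  · exact fun l _ => measurableSet_state hX.measurable hc l

/-- Fatou's lemma for the grid counts. This bound makes them dominated, all pairs of states taken
together. -/
theorem IsMarkovJumpProcess.lintegral_jumpMeasure_lt_top (hX : IsMarkovJumpProcess P π T X)
    (hT : IsSubIntensity T) (hπ : π ∈ stdSimplex ℝ (Fin p)) {i j : State p} (hij : i ≠ j)
    {a b : ℝ} (ha : 0 ≤ a) (hab : a ≤ b) :
    ∫⁻ ω, jumpMeasure X i j ω (Ioc a b) ∂P < ⊤ := by
  have h1 := tendsto_finsetSum Finset.univ fun l (_ : l ∈ (Finset.univ : Finset (State p))) =>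
    hX.tendsto_setLIntegral_gridCount hT hπ hij ha hab le_rfl l
  simp_rw [← lintegral_eq_sum_setLIntegral_state hX (ha.trans hab)] at h1
  have h2 : ∀ ω, jumpMeasure X i j ω (Ioc a b) =
      liminf (fun n => gridCount X i j a b n ω) atTop := fun ω =>
    (hX.hasRegularPaths.tendsto_gridCount hij ha hab ω).liminf_eq.symm
  simp_rw [h2]
  refine (lintegral_liminf_le fun n =>
    measurable_gridCount hX.measurable i j ha hab n).trans_lt ?_
  rw [h1.liminf_eq]
  exact ENNReal.sum_lt_top.2 fun l _ => ENNReal.ofReal_lt_top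

/-- The expected number of jumps from `i` to `j` on the event `X(c) = l`. -/
theorem IsMarkovJumpProcess.setLIntegral_jumpMeasure (hX : IsMarkovJumpProcess P π T X)
    (hT : IsSubIntensity T) (hπ : π ∈ stdSimplex ℝ (Fin p)) {i j : State p} (hij : i ≠ j)
    {a b c : ℝ} (ha : 0 ≤ a) (hab : a ≤ b) (hbc : b ≤ c) (l : State p) :
    ∫⁻ ω in {ω | X c ω = l}, jumpMeasure X i j ω (Ioc a b) ∂P =
      ENNReal.ofReal (∫ u in a..b, jumpRate π T i j l c u) := by
  refine tendsto_nhds_unique ?_ (hX.tendsto_setLIntegral_gridCount hT hπ hij ha hab hbc l)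
  refine tendsto_lintegral_of_dominated_convergence
    (fun ω => ∑ q ∈ transitions p, jumpMeasure X q.1 q.2 ω (Ioc a b))
    (fun n => measurable_gridCount hX.measurable i j ha hab n)
    (fun n => ae_of_all _ fun ω => hX.hasRegularPaths.gridCount_le hij ha hab n ω) ?_
    (ae_of_all _ fun ω => hX.hasRegularPaths.tendsto_gridCount hij ha hab ω)
  refine ((setLIntegral_le_lintegral _ _).trans_lt ?_).ne
  rw [lintegral_finsetSum']
  · exact ENNReal.sum_lt_top.2 fun q hq =>
      hX.lintegral_jumpMeasure_lt_top hT hπ (Finset.mem_filter.1 hq).2 ha hab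
  · exact fun q hq => (measurable_jumpMeasure_Ioc hX.hasRegularPaths hX.measurable
      (Finset.mem_filter.1 hq).2 a b).aemeasurable

theorem IsMarkovJumpProcess.lintegral_jumpMeasure (hX : IsMarkovJumpProcess P π T X)
    (hT : IsSubIntensity T) (hπ : π ∈ stdSimplex ℝ (Fin p)) {i j : State p} (hij : i ≠ j)
    {a b : ℝ} (ha : 0 ≤ a) (hab : a ≤ b) :
    ∫⁻ ω, jumpMeasure X i j ω (Ioc a b) ∂P =
      ENNReal.ofReal (∫ u in a..b, stateProb π T u i * intensity (zeroExtend T) u i j) := by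
  rw [lintegral_eq_sum_setLIntegral_state hX (ha.trans hab)]
  simp_rw [hX.setLIntegral_jumpMeasure hT hπ hij ha hab le_rfl]
  rw [← ENNReal.ofReal_sum_of_nonneg, ← intervalIntegral.integral_finsetSum]
  · congr 1
    refine intervalIntegral.integral_congr fun u _ => ?_
    simp only [jumpRate]
    rw [← Finset.mul_sum, hT.sum_transition, mul_one]
  · exact fun l _ => hT.intervalIntegrable_jumpRate π i j l b a b
  · refine fun l _ => intervalIntegral.integral_nonneg hab fun u hu => ?_
    exact mul_nonneg (mul_nonneg (hT.stateProb_nonneg hπ (ha.trans hu.1) i)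
      (hT.intensity_zeroExtend_nonneg u hij)) (hT.transition_nonneg hu.2 j l)

end Law

/-! ### Absorption -/

/-- The path is absorbed at the positive time `τ`, and it stays in the absorbing state. -/
structure IsAbsorbedPath {Ω : Type*} {p : ℕ} (X : ℝ → Ω → State p) (ω : Ω) : Prop where
  pos : 0 < absorptionTime X ω
  eq_absorbing_iff : ∀ t, 0 ≤ t → (X t ω = absorbingState ↔ absorptionTime X ω ≤ t)

section AbsorbedPath

variable {Ω : Type*} {p : ℕ} {X : ℝ → Ω → State p} {ω : Ω} (h : IsAbsorbedPath X ω)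

include h

theorem IsAbsorbedPath.jumpTimes_absorbing {j : State p} (hj : absorbingState ≠ j) :
    jumpTimes X absorbingState j ω = ∅ := by
  rw [eq_empty_iff_forall_notMem]
  rintro s ⟨hs, hl, hr⟩
  obtain ⟨u, hu1, hu2⟩ := (hl.and (Ioo_mem_nhdsLT hs)).exists
  have h1 := (h.eq_absorbing_iff u hu2.1.le).1 hu1
  have h2 := (h.eq_absorbing_iff s hs.le).2 (h1.trans hu2.2.le)
  exact hj (h2.symm.trans hr)

theorem IsAbsorbedPath.lt_of_mem_jumpTimes {i : State p} {j : Fin p} {s : ℝ}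
    (hs : s ∈ jumpTimes X i (Sum.inl j) ω) : s < absorptionTime X ω := by
  by_contra! hle
  have := (h.eq_absorbing_iff s hs.1.le).2 hle
  rw [hs.2.2] at this
  exact Sum.inl_ne_inr this

theorem IsAbsorbedPath.eq_of_mem_jumpTimes {i : Fin p} {s : ℝ}
    (hs : s ∈ jumpTimes X (Sum.inl i) absorbingState ω) : s = absorptionTime X ω := by
  refine le_antisymm ?_ ((h.eq_absorbing_iff s hs.1.le).1 hs.2.2)
  by_contra! hlt
  obtain ⟨u, hu1, hu2⟩ := (hs.2.1.and (Ioo_mem_nhdsLT hlt)).exists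
  have := (h.eq_absorbing_iff u (h.pos.le.trans hu2.1.le)).2 hu2.1.le
  rw [hu1] at this
  exact Sum.inl_ne_inr this

theorem IsAbsorbedPath.jumpTimes_subset {i j : State p} (hij : i ≠ j) :
    jumpTimes X i j ω ⊆ Ioc 0 (absorptionTime X ω) := by
  intro s hs
  refine ⟨hs.1, ?_⟩
  rcases i with i | i
  · rcases j with j | j
    · exact (h.lt_of_mem_jumpTimes hs).le
    · exact (h.eq_of_mem_jumpTimes hs).le
  · rw [h.jumpTimes_absorbing hij] at hs
    exact hs.elim

theorem IsAbsorbedPath.jumpMeasure_absorbing {j : State p} (hj : absorbingState ≠ j) :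
    jumpMeasure X absorbingState j ω = 0 := by
  ext A hA
  rw [jumpMeasure_apply _ _ _ _ hA, h.jumpTimes_absorbing hj]
  simp

omit h in
theorem jumpMeasure_compl_eq_zero {i j : State p} {A : Set ℝ}
    (hA : MeasurableSet A) (hsub : jumpTimes X i j ω ⊆ A) : jumpMeasure X i j ω Aᶜ = 0 := by
  rw [jumpMeasure_apply _ _ _ _ hA.compl]
  have : jumpTimes X i j ω ∩ Aᶜ = ∅ := by
    rw [← disjoint_iff_inter_eq_empty]
    exact disjoint_compl_right.mono_left hsub
  simp [this]

/-- No jumps occur after absorption. -/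
theorem IsAbsorbedPath.jumpMeasure_restrict {i j : State p} (hij : i ≠ j) {H : ℝ}
    (hH : absorptionTime X ω ≤ H) :
    (jumpMeasure X i j ω).restrict (Ioc 0 H) = jumpMeasure X i j ω := by
  refine Measure.restrict_eq_self_of_ae_mem ?_
  exact jumpMeasure_compl_eq_zero measurableSet_Ioc
    ((h.jumpTimes_subset hij).trans (Ioc_subset_Ioc_right hH))

end AbsorbedPath

section Law

variable {Ω : Type*} [MeasurableSpace Ω] {P : Measure Ω} [IsProbabilityMeasure P] {p : ℕ}
  {π : Fin p → ℝ} {T : ℝ → Matrix (Fin p) (Fin p) ℝ} {X : ℝ → Ω → State p}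

/-- The absorbing state is almost surely not left between rational times, hence by right-continuity
not at all. -/
theorem IsMarkovJumpProcess.ae_isAbsorbedPath (hX : IsMarkovJumpProcess P π T X)
    (hT : IsSubIntensity T) (hπ : π ∈ stdSimplex ℝ (Fin p))
    (habs : ∀ᵐ ω ∂P, ∃ t, 0 ≤ t ∧ X t ω = absorbingState) : ∀ᵐ ω ∂P, IsAbsorbedPath X ω := by
  have h0 : ∀ᵐ ω ∂P, X 0 ω ≠ absorbingState := by
    rw [ae_iff]; simpa using hX.initial_absorbing
  have hrat : ∀ᵐ ω ∂P, ∀ q r : ℚ, 0 ≤ (q : ℝ) → (q : ℝ) ≤ r → X q ω = absorbingState →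
      X r ω = absorbingState := by
    rw [ae_all_iff]; intro q
    rw [ae_all_iff]; intro r
    by_cases hq : 0 ≤ (q : ℝ)
    swap
    · exact ae_of_all _ fun ω h => absurd h hq
    by_cases hqr : (q : ℝ) ≤ r
    swap
    · exact ae_of_all _ fun ω _ h => absurd h hqr
    have hk : ∀ k : Fin p, ∀ᵐ ω ∂P, ¬ (X q ω = absorbingState ∧ X r ω = Sum.inl k) := by
      intro k
      have := hX.measureReal_state_state hT hπ hq hqr absorbingState (Sum.inl k)
      rw [hT.transition_absorbing, Matrix.one_apply_ne (by simp), mul_zero,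
        measureReal_eq_zero_iff] at this
      rw [ae_iff]
      simp only [not_not]
      exact this
    filter_upwards [ae_all_iff.2 hk] with ω hω _ _ h
    rcases hr : X r ω with k | k
    · exact absurd ⟨h, hr⟩ (hω k)
    · rfl
  filter_upwards [h0, hrat, habs] with ω hω0 hω habsω
  have hmono : ∀ s t, 0 ≤ s → s < t → X s ω = absorbingState → X t ω = absorbingState := by
    intro s t hs hst h
    obtain ⟨u, hu, hsub⟩ := (mem_nhdsGT_iff_exists_Ioo_subset).1
      ((hX.right_continuous ω s hs).and (Ioo_mem_nhdsGT hst))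
    obtain ⟨q, hq1, hq2⟩ := exists_rat_btwn (mem_Ioi.1 hu)
    obtain ⟨v, hv, hsub'⟩ := (mem_nhdsGT_iff_exists_Ioo_subset).1
      (hX.right_continuous ω t (hs.trans hst.le))
    obtain ⟨r, hr1, hr2⟩ := exists_rat_btwn (mem_Ioi.1 hv)
    have hq := hsub ⟨hq1, hq2⟩
    rw [← hsub' ⟨hr1, hr2⟩]
    exact hω q r (hs.trans hq1.le) (hq.2.2.trans hr1).le (hq.1.trans h)
  have hbdd : BddBelow {t | 0 ≤ t ∧ X t ω = absorbingState} := ⟨0, fun t ht => ht.1⟩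
  have hτ0 : 0 ≤ absorptionTime X ω := Real.sInf_nonneg fun t ht => ht.1
  have hτ : X (absorptionTime X ω) ω = absorbingState := by
    obtain ⟨u, hu, hsub⟩ := (mem_nhdsGT_iff_exists_Ioo_subset).1
      (hX.right_continuous ω _ hτ0)
    obtain ⟨t, ht, htu⟩ := (csInf_lt_iff hbdd habsω).1 (mem_Ioi.1 hu)
    rcases (csInf_le hbdd ht).eq_or_lt with heq | hlt
    · rw [absorptionTime, heq]; exact ht.2
    · rw [← hsub ⟨hlt, htu⟩]; exact ht.2
  have hpos : 0 < absorptionTime X ω := hτ0.lt_of_ne fun h => hω0 (h ▸ hτ)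
  refine ⟨hpos, fun t ht => ⟨fun h => csInf_le hbdd ⟨ht, h⟩, fun h => ?_⟩⟩
  rcases h.eq_or_lt with rfl | h
  · exact hτ
  · exact hmono _ _ hτ0 h hτ

/-! ### Joint laws with the absorption time -/

omit [IsProbabilityMeasure P] in
theorem ofReal_intervalIntegral {f : ℝ → ℝ} {a b : ℝ} (hab : a ≤ b)
    (hf : IntervalIntegrable f volume a b) (h0 : ∀ u ∈ Ioc a b, 0 ≤ f u) :
    ENNReal.ofReal (∫ u in a..b, f u) = ∫⁻ u in Ioc a b, ENNReal.ofReal (f u) := by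
  rw [intervalIntegral.integral_of_le hab, ofReal_integral_eq_lintegral_ofReal]
  · exact (intervalIntegrable_iff_integrableOn_Ioc_of_le hab).1 hf
  · filter_upwards [ae_restrict_mem measurableSet_Ioc] with u hu using h0 u hu

omit [IsProbabilityMeasure P] in
/-- Tonelli's theorem for the triangle `0 < s ≤ x`. -/
theorem setLIntegral_lintegral_Ioc_swap {g : ℝ → ℝ≥0∞} {k : ℝ → ℝ → ℝ≥0∞} (hg : Measurable g)
    (hk : Measurable fun q : ℝ × ℝ => k q.1 q.2) (B : Set ℝ) :
    ∫⁻ x in B, ∫⁻ s in Ioc 0 x, g s * k s x =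
      ∫⁻ s in Ioi 0, g s * ∫⁻ x in Ici s ∩ B, k s x := by
  have hset : MeasurableSet {q : ℝ × ℝ | q.2 ≤ q.1} :=
    measurableSet_le measurable_snd measurable_fst
  have h1 : ∀ x, ∫⁻ s in Ioc 0 x, g s * k s x =
      ∫⁻ s in Ioi 0, {q : ℝ × ℝ | q.2 ≤ q.1}.indicator (fun q => g q.2 * k q.2 q.1) (x, s) := by
    intro x
    rw [← Ioi_inter_Iic, inter_comm, ← Measure.restrict_restrict measurableSet_Iic,
      ← lintegral_indicator measurableSet_Iic]
    rfl
  have h2 : ∀ s, g s * ∫⁻ x in Ici s ∩ B, k s x =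
      ∫⁻ x in B, {q : ℝ × ℝ | q.2 ≤ q.1}.indicator (fun q => g q.2 * k q.2 q.1) (x, s) := by
    intro s
    rw [← Measure.restrict_restrict measurableSet_Ici,
      ← lintegral_const_mul (g s) (f := fun x => k s x)
        (hk.comp (measurable_const.prodMk measurable_id)),
      ← lintegral_indicator measurableSet_Ici]
    rfl
  simp_rw [h1, h2]
  refine lintegral_lintegral_swap (f := fun x s => {q : ℝ × ℝ | q.2 ≤ q.1}.indicator
    (fun q => g q.2 * k q.2 q.1) (x, s)) ?_
  refine (Measurable.indicator ?_ hset).aemeasurable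
  exact (hg.comp measurable_snd).mul (hk.comp (measurable_snd.prodMk measurable_fst))

/-- `y` is the density in `x` of `E[Y; τ ∈ dx]`. -/
def HasJointDensity (P : Measure Ω) (X : ℝ → Ω → State p) (Y : Ω → ℝ≥0∞) (y : ℝ → ℝ≥0∞) : Prop :=
  ∀ B, MeasurableSet B → ∫⁻ ω in absorptionTime X ⁻¹' B, Y ω ∂P = ∫⁻ x in B, y x

omit [IsProbabilityMeasure P] in
/-- By uniqueness of measures, the events `τ ≤ c` suffice. -/
theorem hasJointDensity_of_Iic (hτ : Measurable (absorptionTime X)) {Y : Ω → ℝ≥0∞} {y : ℝ → ℝ≥0∞}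
    (hfin : ∫⁻ ω, Y ω ∂P ≠ ⊤)
    (h : ∀ c, ∫⁻ ω in {ω | absorptionTime X ω ≤ c}, Y ω ∂P = ∫⁻ x in Iic c, y x) :
    HasJointDensity P X Y y := by
  intro B hB
  have : IsFiniteMeasure (P.withDensity Y) := isFiniteMeasure_withDensity hfin
  have hext : (P.withDensity Y).map (absorptionTime X) = volume.withDensity y := by
    refine Measure.ext_of_Iic _ _ fun c => ?_
    rw [Measure.map_apply hτ measurableSet_Iic, withDensity_apply _ (hτ measurableSet_Iic),
      withDensity_apply _ measurableSet_Iic]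
    exact h c
  have := congrArg (fun μ => μ B) hext
  simpa only [Measure.map_apply hτ hB, withDensity_apply _ (hτ hB), withDensity_apply _ hB]
    using this

omit [IsProbabilityMeasure P] in
theorem setLIntegral_absorptionTime_le (hgood : ∀ᵐ ω ∂P, IsAbsorbedPath X ω) {c : ℝ} (hc : 0 ≤ c)
    (Y : Ω → ℝ≥0∞) :
    ∫⁻ ω in {ω | absorptionTime X ω ≤ c}, Y ω ∂P =
      ∫⁻ ω in {ω | X c ω = absorbingState}, Y ω ∂P := by
  refine setLIntegral_congr ?_
  filter_upwards [hgood] with ω hω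
  exact propext (hω.eq_absorbing_iff c hc).symm

omit [IsProbabilityMeasure P] in
theorem IsMarkovJumpProcess.measurable_absorptionTime (hX : IsMarkovJumpProcess P π T X) :
    Measurable (absorptionTime X) :=
  _root_.measurable_absorptionTime hX.hasRegularPaths hX.measurable

omit [IsProbabilityMeasure P] in
theorem setLIntegral_exitDensity (hT : IsSubIntensity T) {w : ℝ} (hw : 0 ≤ w) (j : Fin p)
    {s c : ℝ} (hsc : s ≤ c) :
    ∫⁻ x in Ici s ∩ Iic c, ENNReal.ofReal (w * exitDensity T j s x) =
      ENNReal.ofReal (w * transition T s c (Sum.inl j) absorbingState) := by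
  rw [hT.transition_inl_absorbing, ← intervalIntegral.integral_const_mul,
    ofReal_intervalIntegral hsc ((hT.intervalIntegrable_exitDensity j s s c).const_mul _)
      (fun u hu => mul_nonneg hw (hT.exitDensity_nonneg hu.1.le j)), Ici_inter_Iic,
    setLIntegral_congr Ioc_ae_eq_Icc]

/-- The joint law of the state at a fixed time and of the absorption time. -/
theorem IsMarkovJumpProcess.hasJointDensity_state (hX : IsMarkovJumpProcess P π T X)
    (hT : IsSubIntensity T) (hπ : π ∈ stdSimplex ℝ (Fin p))
    (hgood : ∀ᵐ ω ∂P, IsAbsorbedPath X ω) {s : ℝ} (hs : 0 ≤ s) (i : Fin p) :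
    HasJointDensity P X ({ω | X s ω = Sum.inl i}.indicator 1) ((Ici s).indicator fun x =>
      ENNReal.ofReal (stateProb π T s (Sum.inl i) * exitDensity T i s x)) := by
  have hset := measurableSet_state hX.measurable hs (Sum.inl i)
  refine hasJointDensity_of_Iic hX.measurable_absorptionTime ?_ fun c => ?_
  · rw [lintegral_indicator_one hset]; exact measure_ne_top _ _
  rw [lintegral_indicator measurableSet_Ici, Measure.restrict_restrict measurableSet_Ici]
  rcases le_or_gt s c with hsc | hsc
  · rw [setLIntegral_absorptionTime_le hgood (hs.trans hsc), lintegral_indicator_one hset,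
      Measure.restrict_apply hset, ← ofReal_measureReal,
      hX.measureReal_state_state hT hπ hs hsc,
      setLIntegral_exitDensity hT (hT.stateProb_nonneg hπ hs _) i hsc]
  · rw [Ici_inter_Iic, Icc_eq_empty (not_le.2 hsc), Measure.restrict_empty, lintegral_zero_measure,
      lintegral_indicator_one hset, Measure.restrict_apply hset]
    refine measure_mono_null_ae ?_ (measure_empty (μ := P))
    filter_upwards [hgood] with ω hω hmem
    have h1 := (hω.eq_absorbing_iff s hs).2 (le_trans hmem.2 hsc.le)
    rw [hmem.1] at h1
    exact Sum.inl_ne_inr h1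

/-- The density of the absorption time. -/
def absorptionDensity (π : Fin p → ℝ) (T : ℝ → Matrix (Fin p) (Fin p) ℝ) (x : ℝ) : ℝ :=
  ∑ i, π i * exitDensity T i 0 x

omit [IsProbabilityMeasure P] in
theorem iphDensity_eq (hT : IsSubIntensity T) {x : ℝ} (hx : 0 ≤ x) :
    iphDensity π T x = absorptionDensity π T x := by
  simp only [iphDensity, absorptionDensity, dotProduct,
    subTransition_mulVec_exitRate hT le_rfl hx]

/-- The law of the absorption time. -/
theorem IsMarkovJumpProcess.hasJointDensity_one (hX : IsMarkovJumpProcess P π T X)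
    (hT : IsSubIntensity T) (hπ : π ∈ stdSimplex ℝ (Fin p))
    (hgood : ∀ᵐ ω ∂P, IsAbsorbedPath X ω) :
    HasJointDensity P X 1 ((Ici 0).indicator fun x =>
      ENNReal.ofReal (absorptionDensity π T x)) := by
  intro B hB
  have h1 : ∀ ω ∈ {ω | IsAbsorbedPath X ω}, (1 : Ω → ℝ≥0∞) ω =
      ∑ i : Fin p, {ω | X 0 ω = Sum.inl i}.indicator (1 : Ω → ℝ≥0∞) ω := by
    intro ω hω
    rcases h : X 0 ω with i | i
    · rw [Finset.sum_eq_single i]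
      · simp [indicator, h]
      · intro j _ hj
        simp [indicator, h, Ne.symm hj]
      · simp
    · exact absurd ((hω.eq_absorbing_iff 0 le_rfl).1 h) (not_le.2 hω.pos)
  have h2 : ∀ x, (Ici 0).indicator (fun x => ENNReal.ofReal (absorptionDensity π T x)) x =
      ∑ i : Fin p, (Ici 0).indicator (fun x => ENNReal.ofReal
        (stateProb π T 0 (Sum.inl i) * exitDensity T i 0 x)) x := by
    intro x
    by_cases hx : x ∈ Ici (0 : ℝ)
    · simp only [indicator_of_mem hx, stateProb_zero hT, absorptionDensity]
      exact ENNReal.ofReal_sum_of_nonneg fun i _ =>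
        mul_nonneg (hπ.1 i) (hT.exitDensity_nonneg hx i)
    · simp [indicator_of_notMem hx]
  rw [lintegral_congr_ae (ae_restrict_of_ae (hgood.mono h1)), lintegral_congr h2,
    lintegral_finsetSum', lintegral_finsetSum']
  · exact Finset.sum_congr rfl fun i _ =>
      hX.hasJointDensity_state hT hπ hgood le_rfl i B hB
  · intro i _
    exact (Measurable.indicator ((hT.measurable_exitDensity i).comp
      (measurable_const.prodMk measurable_id) |>.const_mul _ |>.ennreal_ofReal)
        measurableSet_Ici).aemeasurable
  · intro i _
    exact (measurable_one.indicator
      (measurableSet_state hX.measurable le_rfl (Sum.inl i))).aemeasurable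

/-- The joint law of the time spent in a state and of the absorption time. -/
theorem IsMarkovJumpProcess.hasJointDensity_occupation (hX : IsMarkovJumpProcess P π T X)
    (hT : IsSubIntensity T) (hπ : π ∈ stdSimplex ℝ (Fin p))
    (hgood : ∀ᵐ ω ∂P, IsAbsorbedPath X ω) {g : ℝ → ℝ≥0∞} (hg : Measurable g) (i : Fin p) :
    HasJointDensity P X
      (fun ω => ∫⁻ s in Ioi 0, g s * ENNReal.ofReal (occ X (Sum.inl i) (max s 0) ω))
      (fun x => ∫⁻ s in Ioc 0 x, g s *
        ENNReal.ofReal (stateProb π T s (Sum.inl i) * exitDensity T i s x)) := by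
  intro B hB
  have hocc := measurable_occ_prod hX.hasRegularPaths hX.measurable (Sum.inl i)
  have hk : Measurable fun q : ℝ × ℝ =>
      ENNReal.ofReal (stateProb π T q.1 (Sum.inl i) * exitDensity T i q.1 q.2) :=
    (((hT.continuous_stateProb π (Sum.inl i)).measurable.comp measurable_fst).mul
      (hT.measurable_exitDensity i)).ennreal_ofReal
  rw [setLIntegral_lintegral_Ioc_swap hg hk, lintegral_lintegral_swap]
  · refine setLIntegral_congr_fun measurableSet_Ioi fun s hs => ?_
    have hs0 : 0 ≤ s := (mem_Ioi.1 hs).le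
    have h1 := hX.hasJointDensity_state hT hπ hgood hs0 i B hB
    have hset := measurableSet_state hX.measurable hs0 (Sum.inl i)
    have h2 : ∀ ω, ENNReal.ofReal (occ X (Sum.inl i) (max s 0) ω) =
        {ω | X s ω = Sum.inl i}.indicator 1 ω := by
      intro ω
      rw [max_eq_left hs0, occ, indicator_apply]
      simp only [mem_ofPred_eq]
      split_ifs <;> simp
    simp only [h2]
    rw [lintegral_const_mul _ (measurable_one.indicator hset), h1,
      lintegral_indicator measurableSet_Ici, Measure.restrict_restrict measurableSet_Ici]
  · exact ((hg.comp measurable_snd).mul (hocc.comp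
      (measurable_snd.prodMk measurable_fst)).ennreal_ofReal).aemeasurable

/-- The joint law of the jumps between transient states and of the absorption time. -/
theorem IsMarkovJumpProcess.hasJointDensity_jump (hX : IsMarkovJumpProcess P π T X)
    (hT : IsSubIntensity T) (hπ : π ∈ stdSimplex ℝ (Fin p))
    (hgood : ∀ᵐ ω ∂P, IsAbsorbedPath X ω) {i j : Fin p} (hij : i ≠ j) {g : ℝ → ℝ≥0∞}
    (hg : Measurable g) :
    HasJointDensity P X (fun ω => ∫⁻ s, g s ∂jumpMeasure X (Sum.inl i) (Sum.inl j) ω)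
      (fun x => ∫⁻ s in Ioc 0 x, g s * ENNReal.ofReal
        (stateProb π T s (Sum.inl i) * zeroExtend T s i j * exitDensity T j s x)) := by
  have hij' : (Sum.inl i : State p) ≠ Sum.inl j := fun h => hij (Sum.inl_injective h)
  have hR := hX.hasRegularPaths
  set J := jumpMeasure X (Sum.inl i) (Sum.inl j) with hJ
  have hJm : Measurable J := measurable_jumpMeasure hR hX.measurable hij'
  set w : ℝ → ℝ := fun s => stateProb π T s (Sum.inl i) * zeroExtend T s i j with hw
  have hw0 : ∀ s, 0 ≤ s → 0 ≤ w s := fun s hs =>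
    mul_nonneg (hT.stateProb_nonneg hπ hs _) (hT.intensity_zeroExtend_nonneg s hij')
  have hk : Measurable fun q : ℝ × ℝ => ENNReal.ofReal (w q.1 * exitDensity T j q.1 q.2) :=
    ((((hT.continuous_stateProb π (Sum.inl i)).measurable.mul
      (hT.measurable_zeroExtend i j)).comp measurable_fst).mul
      (hT.measurable_exitDensity j)).ennreal_ofReal
  -- the jump time in `(a, b]` and the absorption time in `(-∞, c]`; there are no jumps after `c`
  have hbox : ∀ {a b : ℝ}, 0 ≤ a → a ≤ b → ∀ c,
      ∫⁻ ω in {ω | absorptionTime X ω ≤ c}, J ω (Ioc a b) ∂P =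
        ∫⁻ x in Iic c, ∫⁻ s in Ioc 0 x, (Ioc a b).indicator 1 s *
          ENNReal.ofReal (w s * exitDensity T j s x) := by
    intro a b ha hab c
    rw [setLIntegral_lintegral_Ioc_swap (measurable_one.indicator measurableSet_Ioc) hk]
    have hind : ∀ s, (Ioc a b).indicator (1 : ℝ → ℝ≥0∞) s *
        ∫⁻ x in Ici s ∩ Iic c, ENNReal.ofReal (w s * exitDensity T j s x) =
        (Ioc a b).indicator (fun s => ∫⁻ x in Ici s ∩ Iic c,
          ENNReal.ofReal (w s * exitDensity T j s x)) s := by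
      intro s
      simp only [indicator_apply, Pi.one_apply]
      split_ifs <;> simp
    simp_rw [hind]
    rw [lintegral_indicator measurableSet_Ioc, Measure.restrict_restrict measurableSet_Ioc,
      inter_eq_left.2 (show Ioc a b ⊆ Ioi 0 from fun x hx => ha.trans_lt hx.1)]
    have hzero : ∀ s, c < s → ∫⁻ x in Ici s ∩ Iic c,
        ENNReal.ofReal (w s * exitDensity T j s x) = 0 := by
      intro s hs
      rw [Ici_inter_Iic, Icc_eq_empty (not_le.2 hs)]; simp
    rcases lt_or_ge c a with hca | hac
    · rw [setLIntegral_congr_fun (g := fun _ => 0) measurableSet_Ioc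
        (fun s hs => hzero s (hca.trans hs.1)), lintegral_zero]
      refine (lintegral_congr_ae ?_).trans lintegral_zero
      filter_upwards [ae_restrict_of_ae hgood, ae_restrict_mem
        (hX.measurable_absorptionTime measurableSet_Iic)] with ω hω hmem
      refine measure_mono_null ?_ (jumpMeasure_compl_eq_zero measurableSet_Ioc
        (hω.jumpTimes_subset hij'))
      exact fun x hx hx' => absurd (hx'.2.trans hmem) (not_le.2 (hca.trans hx.1))
    · set b' := min b c with hb'
      have hab' : a ≤ b' := le_min hab hac
      have hsplit : Ioc a b = Ioc a b' ∪ Ioc b' b :=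
        (Ioc_union_Ioc_eq_Ioc hab' (min_le_left b c)).symm
      have hdisj : Disjoint (Ioc a b') (Ioc b' b) := by
        rw [Set.disjoint_left]
        exact fun x hx hx' => absurd hx.2 (not_le.2 hx'.1)
      have hright : ∀ s ∈ Ioc b' b, c < s := by
        intro s hs
        by_contra! h
        exact absurd hs.1 (not_lt.2 (le_min hs.2 h))
      have hL : ∫⁻ ω in {ω | absorptionTime X ω ≤ c}, J ω (Ioc a b) ∂P =
          ∫⁻ ω in {ω | absorptionTime X ω ≤ c}, J ω (Ioc a b') ∂P := by
        refine lintegral_congr_ae ?_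
        filter_upwards [ae_restrict_of_ae hgood, ae_restrict_mem
          (hX.measurable_absorptionTime measurableSet_Iic)] with ω hω hmem
        rw [hsplit, measure_union hdisj measurableSet_Ioc]
        have : J ω (Ioc b' b) = 0 := by
          refine measure_mono_null ?_ (jumpMeasure_compl_eq_zero measurableSet_Ioc
            (hω.jumpTimes_subset hij'))
          exact fun x hx hx' => absurd (hx'.2.trans hmem) (not_le.2 (hright x hx))
        rw [this, add_zero]
      rw [hL, setLIntegral_absorptionTime_le hgood (ha.trans hac),
        hX.setLIntegral_jumpMeasure hT hπ hij' ha hab' (min_le_right _ _), hsplit,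
        lintegral_union measurableSet_Ioc hdisj,
        setLIntegral_congr_fun (g := fun _ => 0) (s := Ioc b' b) measurableSet_Ioc
        (fun s hs => hzero s (hright s hs)), lintegral_zero, add_zero,
        ofReal_intervalIntegral hab' (hT.intervalIntegrable_jumpRate _ _ _ _ _ _ _)]
      · refine setLIntegral_congr_fun measurableSet_Ioc fun s hs => ?_
        exact (setLIntegral_exitDensity hT (hw0 s (ha.trans hs.1.le)) j
          (hs.2.trans (min_le_right _ _))).symm
      · exact fun s hs => mul_nonneg (hw0 s (ha.trans hs.1.le))
          (hT.transition_nonneg (hs.2.trans (min_le_right _ _)) _ _)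
  intro B hB
  -- the two sides, as measures in the jump time
  have hext : (P.restrict (absorptionTime X ⁻¹' B)).bind J =
      (volume.restrict (Ioi 0)).withDensity fun s => ∫⁻ x in Ici s ∩ B,
        ENNReal.ofReal (w s * exitDensity T j s x) := by
    have key : ∀ {a b : ℝ}, 0 ≤ a → a ≤ b →
        (P.restrict (absorptionTime X ⁻¹' B)).bind J (Ioc a b) < ⊤ ∧
        (P.restrict (absorptionTime X ⁻¹' B)).bind J (Ioc a b) =
        (volume.restrict (Ioi 0)).withDensity (fun s => ∫⁻ x in Ici s ∩ B,
          ENNReal.ofReal (w s * exitDensity T j s x)) (Ioc a b) := by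
      intro a b ha hab
      have hfin := hX.lintegral_jumpMeasure_lt_top hT hπ hij' ha hab
      rw [Measure.bind_apply measurableSet_Ioc hJm.aemeasurable]
      refine ⟨(setLIntegral_le_lintegral _ _).trans_lt hfin, ?_⟩
      rw [hasJointDensity_of_Iic hX.measurable_absorptionTime hfin.ne (hbox ha hab) B hB,
        setLIntegral_lintegral_Ioc_swap (measurable_one.indicator measurableSet_Ioc) hk,
        withDensity_apply _ measurableSet_Ioc, ← lintegral_indicator measurableSet_Ioc]
      refine lintegral_congr fun s => ?_
      simp only [indicator_apply, Pi.one_apply]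
      split_ifs <;> simp
    have hmax : ∀ a b : ℝ, (P.restrict (absorptionTime X ⁻¹' B)).bind J (Ioc a b) =
        (P.restrict (absorptionTime X ⁻¹' B)).bind J (Ioc (max a 0) (max b 0)) := by
      intro a b
      rw [Measure.bind_apply measurableSet_Ioc hJm.aemeasurable,
        Measure.bind_apply measurableSet_Ioc hJm.aemeasurable]
      exact lintegral_congr fun ω => jumpMeasure_Ioc_max X _ _ ω a b
    refine Measure.ext_of_Ioc' _ _ (fun a b hab => ?_) fun a b hab => ?_
    · rw [hmax]; exact (key (le_max_right _ _) (max_le_max_right 0 hab.le)).1.ne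
    · rw [hmax, (key (le_max_right _ _) (max_le_max_right 0 hab.le)).2,
        withDensity_apply _ measurableSet_Ioc, withDensity_apply _ measurableSet_Ioc,
        Measure.restrict_restrict measurableSet_Ioc, Measure.restrict_restrict measurableSet_Ioc]
      congr 2
      ext x
      simp only [mem_inter_iff, mem_Ioc, mem_Ioi, max_lt_iff, le_max_iff]
      constructor
      · exact fun h => ⟨⟨h.1.1.1, h.1.2.resolve_right (not_le.2 h.2)⟩, h.2⟩
      · exact fun h => ⟨⟨⟨h.1.1, h.2⟩, Or.inl h.1.2⟩, h.2⟩
  have hinner : Measurable fun s => ∫⁻ x in Ici s ∩ B,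
      ENNReal.ofReal (w s * exitDensity T j s x) := by
    have : ∀ s, ∫⁻ x in Ici s ∩ B, ENNReal.ofReal (w s * exitDensity T j s x) =
        ∫⁻ x in B, {q : ℝ × ℝ | q.1 ≤ q.2}.indicator (fun q =>
          ENNReal.ofReal (w q.1 * exitDensity T j q.1 q.2)) (s, x) := by
      intro s
      rw [← Measure.restrict_restrict measurableSet_Ici, ← lintegral_indicator measurableSet_Ici]
      rfl
    simp_rw [this]
    exact (hk.indicator (measurableSet_le measurable_fst measurable_snd)).lintegral_prod_right'
  rw [← Measure.lintegral_bind hJm.aemeasurable hg.aemeasurable, hext,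
    lintegral_withDensity_eq_lintegral_mul _ hinner hg, setLIntegral_lintegral_Ioc_swap hg hk]
  exact lintegral_congr fun s => mul_comm _ _

/-- The joint law of the last jump and of the absorption time. -/
theorem IsMarkovJumpProcess.hasJointDensity_exit (hX : IsMarkovJumpProcess P π T X)
    (hT : IsSubIntensity T) (hπ : π ∈ stdSimplex ℝ (Fin p))
    (hgood : ∀ᵐ ω ∂P, IsAbsorbedPath X ω) (i : Fin p) {g : ℝ → ℝ≥0∞} (hg : Measurable g) :
    HasJointDensity P X (fun ω => ∫⁻ s, g s ∂jumpMeasure X (Sum.inl i) absorbingState ω)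
      ((Ioi 0).indicator fun x => g x * ENNReal.ofReal
        (stateProb π T x (Sum.inl i) * exitRate (zeroExtend T) x i)) := by
  have hij : (Sum.inl i : State p) ≠ absorbingState := by simp
  have hR := hX.hasRegularPaths
  set J := jumpMeasure X (Sum.inl i) absorbingState with hJ
  have hJm : Measurable J := measurable_jumpMeasure hR hX.measurable hij
  set w : ℝ → ℝ := fun s => stateProb π T s (Sum.inl i) * exitRate (zeroExtend T) s i with hw
  have hwm : Measurable w := (hT.continuous_stateProb π (Sum.inl i)).measurable.mul
    (hT.measurable_exitRate_zeroExtend i)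
  have hext : P.bind J = (volume.restrict (Ioi 0)).withDensity fun s => ENNReal.ofReal (w s) := by
    have key : ∀ {a b : ℝ}, 0 ≤ a → a ≤ b → P.bind J (Ioc a b) < ⊤ ∧ P.bind J (Ioc a b) =
        ∫⁻ s in Ioc a b, ENNReal.ofReal (w s) := by
      intro a b ha hab
      have hfin := hX.lintegral_jumpMeasure_lt_top hT hπ hij ha hab
      rw [Measure.bind_apply measurableSet_Ioc hJm.aemeasurable]
      refine ⟨hfin, ?_⟩
      rw [hX.lintegral_jumpMeasure hT hπ hij ha hab, ofReal_intervalIntegral hab]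
      · rfl
      · exact (hT.entrywiseIntegrable_intensity _ _ a b).continuousOn_mul
          (hT.continuous_stateProb π _).continuousOn
      · exact fun u hu => mul_nonneg (hT.stateProb_nonneg hπ (ha.trans hu.1.le) _)
          (hT.intensity_zeroExtend_nonneg u hij)
    have hmax : ∀ a b : ℝ, P.bind J (Ioc a b) = P.bind J (Ioc (max a 0) (max b 0)) := by
      intro a b
      rw [Measure.bind_apply measurableSet_Ioc hJm.aemeasurable,
        Measure.bind_apply measurableSet_Ioc hJm.aemeasurable]
      exact lintegral_congr fun ω => jumpMeasure_Ioc_max X _ _ ω a b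
    refine Measure.ext_of_Ioc' _ _ (fun a b hab => ?_) fun a b hab => ?_
    · rw [hmax]; exact (key (le_max_right _ _) (max_le_max_right 0 hab.le)).1.ne
    · rw [hmax, (key (le_max_right _ _) (max_le_max_right 0 hab.le)).2,
        withDensity_apply _ measurableSet_Ioc, Measure.restrict_restrict measurableSet_Ioc]
      congr 2
      ext x
      simp only [mem_inter_iff, mem_Ioc, mem_Ioi, max_lt_iff, le_max_iff]
      constructor
      · exact fun h => ⟨⟨h.1.1, h.2.resolve_right (not_le.2 h.1.2)⟩, h.1.2⟩
      · exact fun h => ⟨⟨h.1.1, h.2⟩, Or.inl h.1.2⟩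
  intro B hB
  have hτB := hX.measurable_absorptionTime hB
  -- the only jump into the absorbing state occurs at the absorption time
  have h1 : ∫⁻ ω in absorptionTime X ⁻¹' B, ∫⁻ s, g s ∂J ω ∂P =
      ∫⁻ ω, ∫⁻ s, B.indicator g s ∂J ω ∂P := by
    rw [← lintegral_indicator hτB]
    refine lintegral_congr_ae ?_
    filter_upwards [hgood] with ω hω
    have hae : ∀ᵐ s ∂J ω, s = absorptionTime X ω :=
      jumpMeasure_compl_eq_zero (measurableSet_singleton _) fun s hs =>
        hω.eq_of_mem_jumpTimes hs
    by_cases hmem : ω ∈ absorptionTime X ⁻¹' B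
    · rw [indicator_of_mem hmem]
      refine lintegral_congr_ae ?_
      filter_upwards [hae] with s hs
      rw [indicator_of_mem (by rw [hs]; exact hmem)]
    · rw [indicator_of_notMem hmem, ← lintegral_zero (μ := J ω)]
      refine lintegral_congr_ae ?_
      filter_upwards [hae] with s hs
      rw [indicator_of_notMem (by rw [hs]; exact hmem)]
  rw [h1, ← Measure.lintegral_bind hJm.aemeasurable (hg.indicator hB).aemeasurable, hext,
    lintegral_withDensity_eq_lintegral_mul _ hwm.ennreal_ofReal (hg.indicator hB),
    lintegral_indicator measurableSet_Ioi, Measure.restrict_restrict measurableSet_Ioi,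
    inter_comm, ← Measure.restrict_restrict hB, ← lintegral_indicator hB]
  refine lintegral_congr fun x => ?_
  by_cases hx : x ∈ B
  · simp only [Pi.mul_apply, indicator_of_mem hx, hw, mul_comm]
  · simp only [Pi.mul_apply, indicator_of_notMem hx, mul_zero]

end Law

/-! ### Conditioning on one of several independent observations -/

section Independence

variable {Ω : Type*} [mΩ : MeasurableSpace Ω] {P : Measure Ω} [IsProbabilityMeasure P] {ι : Type*}
  [Fintype ι] {𝓕 : ι → MeasurableSpace Ω} {τ : ι → Ω → ℝ}

omit [IsProbabilityMeasure P] in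
/-- On boxes of data, the other observations contribute a factor. -/
theorem setLIntegral_iInter_of_iIndep [DecidableEq ι] (h𝓕 : ∀ n, 𝓕 n ≤ mΩ) (hind : iIndep 𝓕 P)
    (hτ : ∀ n, Measurable[𝓕 n] (τ n)) {n : ι} {Y : Ω → ℝ≥0∞} (hY : Measurable[𝓕 n] Y)
    {B : ι → Set ℝ} (hB : ∀ m, MeasurableSet (B m)) :
    ∫⁻ ω in ⋂ m, τ m ⁻¹' B m, Y ω ∂P =
      (∫⁻ ω in τ n ⁻¹' B n, Y ω ∂P) * ∏ m ∈ Finset.univ.erase n, P (τ m ⁻¹' B m) := by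
  have hset : ∀ m, MeasurableSet[𝓕 m] (τ m ⁻¹' B m) := fun m => hτ m (hB m)
  have hset' : ∀ m, MeasurableSet (τ m ⁻¹' B m) := fun m => h𝓕 m _ (hset m)
  set f : ι → Ω → ℝ≥0∞ := fun m => (τ m ⁻¹' B m).indicator (if m = n then Y else 1) with hf
  have hfm : ∀ m, Measurable[𝓕 m] (f m) := by
    intro m
    by_cases hmn : m = n
    · subst hmn
      simp only [hf, if_true]
      exact hY.indicator (hset m)
    · simp only [hf, hmn, if_false]
      exact (measurable_const (a := (1 : ℝ≥0∞))).indicator (hset m)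
  have hindf : iIndepFun f P := by
    rw [iIndepFun_iff_iIndep]
    exact iIndep_of_iIndep_of_le hind fun m => (hfm m).comap_le
  have h := lintegral_prod_eq_prod_lintegral_of_indepFun Finset.univ f hindf
    fun m => (hfm m).mono (h𝓕 m) le_rfl
  rw [← Finset.mul_prod_erase _ _ (Finset.mem_univ n)] at h
  have h1 : ∀ ω, ∏ m, f m ω = (⋂ m, τ m ⁻¹' B m).indicator Y ω := by
    intro ω
    by_cases hω : ω ∈ ⋂ m, τ m ⁻¹' B m
    · rw [indicator_of_mem hω, Finset.prod_eq_single n]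
      · simp only [hf, if_true]
        rw [indicator_of_mem (mem_iInter.1 hω n)]
      · intro m _ hmn
        simp only [hf, hmn, if_false]
        rw [indicator_of_mem (mem_iInter.1 hω m), Pi.one_apply]
      · simp
    · rw [indicator_of_notMem hω]
      obtain ⟨m, hm⟩ := not_forall.1 (fun hh => hω (mem_iInter.2 hh))
      exact Finset.prod_eq_zero (Finset.mem_univ m) (indicator_of_notMem hm _)
  have h2 : ∫⁻ ω, f n ω ∂P = ∫⁻ ω in τ n ⁻¹' B n, Y ω ∂P := by
    simp only [hf, if_true]
    exact lintegral_indicator (hset' n) _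
  have h3 : ∀ m ∈ Finset.univ.erase n, ∫⁻ ω, f m ω ∂P = P (τ m ⁻¹' B m) := by
    intro m hm
    simp only [hf, Finset.ne_of_mem_erase hm, if_false]
    exact lintegral_indicator_one (hset' m)
  rw [lintegral_congr h1, lintegral_indicator (MeasurableSet.iInter hset'), h2,
    Finset.prod_congr rfl h3] at h
  exact h

/-- Given independent observations `τ m`, a variable that depends on the `n`-th source of randomness
only has the same conditional expectation given all observations as given `τ n`. -/
theorem condLExp_comap_of_iIndep (h𝓕 : ∀ n, 𝓕 n ≤ mΩ) (hind : iIndep 𝓕 P)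
    (hτ : ∀ n, Measurable[𝓕 n] (τ n)) {n : ι} {Y : Ω → ℝ≥0∞} (hY : Measurable[𝓕 n] Y) :
    P⁻[Y|MeasurableSpace.comap (fun ω m => τ m ω) inferInstance] =ᵐ[P]
      P⁻[Y|MeasurableSpace.comap (τ n) inferInstance] := by
  classical
  have hτm : ∀ m, Measurable (τ m) := fun m => (hτ m).mono (h𝓕 m) le_rfl
  have hτall : Measurable fun ω m => τ m ω := measurable_pi_iff.2 hτm
  have hle : MeasurableSpace.comap (τ n) inferInstance ≤
      MeasurableSpace.comap (fun ω m => τ m ω) inferInstance := by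
    have : τ n = (fun x : ι → ℝ => x n) ∘ fun ω m => τ m ω := rfl
    rw [this, ← MeasurableSpace.comap_comp]
    exact MeasurableSpace.comap_mono (measurable_pi_apply n).comap_le
  -- variables with finite expectation: finite measures on the space of data agree on boxes
  have hfinite : ∀ Y : Ω → ℝ≥0∞, Measurable[𝓕 n] Y → ∫⁻ ω, Y ω ∂P ≠ ⊤ →
      P⁻[Y|MeasurableSpace.comap (fun ω m => τ m ω) inferInstance] =ᵐ[P]
        P⁻[Y|MeasurableSpace.comap (τ n) inferInstance] := by
    intro Y hY hYfin
    set Z := P⁻[Y|MeasurableSpace.comap (τ n) inferInstance] with hZ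
    have hZm : Measurable[MeasurableSpace.comap (τ n) inferInstance] Z := measurable_condLExp _ _ _
    have hZ𝓕 : Measurable[𝓕 n] Z := hZm.mono (hτ n).comap_le le_rfl
    have hZint : ∀ B, MeasurableSet B →
        ∫⁻ ω in τ n ⁻¹' B, Z ω ∂P = ∫⁻ ω in τ n ⁻¹' B, Y ω ∂P := fun B hB =>
      setLIntegral_condLExp (hτm n).comap_le P Y ⟨B, hB, rfl⟩
    have : IsFiniteMeasure (P.withDensity Z) := isFiniteMeasure_withDensity (by
      rw [hZ, lintegral_condLExp (hτm n).comap_le]; exact hYfin)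
    have hbox : ∀ B : ι → Set ℝ, (∀ m, MeasurableSet (B m)) →
        (P.withDensity Z).map (fun ω m => τ m ω) (univ.pi B) =
          (P.withDensity Y).map (fun ω m => τ m ω) (univ.pi B) := by
      intro B hB
      have hpre : (fun ω m => τ m ω) ⁻¹' univ.pi B = ⋂ m, τ m ⁻¹' B m := by
        ext ω; simp
      rw [Measure.map_apply hτall (MeasurableSet.univ_pi hB),
        Measure.map_apply hτall (MeasurableSet.univ_pi hB), hpre,
        withDensity_apply _ (MeasurableSet.iInter fun m => hτm m (hB m)),
        withDensity_apply _ (MeasurableSet.iInter fun m => hτm m (hB m)),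
        setLIntegral_iInter_of_iIndep h𝓕 hind hτ hZ𝓕 hB,
        setLIntegral_iInter_of_iIndep h𝓕 hind hτ hY hB, hZint _ (hB n)]
    have hext : (P.withDensity Z).map (fun ω m => τ m ω) =
        (P.withDensity Y).map (fun ω m => τ m ω) := by
      refine ext_of_generate_finite _ generateFrom_pi.symm isPiSystem_pi ?_ ?_
      · rintro _ ⟨B, hB, rfl⟩
        exact hbox B fun m => hB m (mem_univ m)
      · rw [← pi_univ univ]
        exact hbox _ fun m => MeasurableSet.univ
    refine (ae_eq_condLExp hτall.comap_le P Y (hZm.mono hle le_rfl) ?_).symm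
    rintro _ ⟨C, hC, rfl⟩
    have := congrArg (fun μ => μ C) hext
    simpa only [Measure.map_apply hτall hC, withDensity_apply _ (hτall hC)] using this
  -- a general variable is a countable sum of bounded ones
  set d : ℕ → Ω → ℝ≥0∞ := fun k ω => (@SimpleFunc.eapproxDiff Ω (𝓕 n) Y k ω : ℝ≥0∞) with hd
  have hsum : Y = ∑' k, d k := by
    ext ω
    rw [tsum_apply (Pi.summable.2 fun _ => ENNReal.summable)]
    exact (@SimpleFunc.tsum_eapproxDiff Ω (𝓕 n) Y hY ω).symm
  have hdm : ∀ k, Measurable[𝓕 n] (d k) := fun k =>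
    (@SimpleFunc.measurable Ω _ (𝓕 n) _ (@SimpleFunc.eapproxDiff Ω (𝓕 n) Y k)).coe_nnreal_ennreal
  have hdfin : ∀ k, ∫⁻ ω, d k ω ∂P ≠ ⊤ := by
    intro k
    obtain ⟨C, hC⟩ := (@SimpleFunc.finite_range Ω _ (𝓕 n)
      (@SimpleFunc.eapproxDiff Ω (𝓕 n) Y k)).bddAbove
    refine ((lintegral_mono (g := fun _ => (C : ℝ≥0∞)) fun ω => ?_).trans_lt ?_).ne
    · exact ENNReal.coe_le_coe.2 (hC ⟨ω, rfl⟩)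
    · simp
  have hdm' : ∀ k, AEMeasurable (d k) P := fun k => ((hdm k).mono (h𝓕 n) le_rfl).aemeasurable
  rw [hsum]
  refine (condLExp_tsum _ hdm').trans (EventuallyEq.trans ?_ (condLExp_tsum _ hdm').symm)
  filter_upwards [ae_all_iff.2 fun k => hfinite (d k) (hdm k) (hdfin k)] with ω hω
  rw [tsum_apply (Pi.summable.2 fun _ => ENNReal.summable),
    tsum_apply (Pi.summable.2 fun _ => ENNReal.summable)]
  exact tsum_congr hω

end Independence

/-! ### Conditional expectations given the absorption times -/

section CondExp

variable {Ω : Type*} [MeasurableSpace Ω] {P : Measure Ω} [IsProbabilityMeasure P] {p N : ℕ}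
  {π : Fin p → ℝ} {T : ℝ → Matrix (Fin p) (Fin p) ℝ}

theorem IsSubIntensity.measurable_absorptionDensity (hT : IsSubIntensity T) (π : Fin p → ℝ) :
    Measurable (absorptionDensity π T) := by
  unfold absorptionDensity
  exact Finset.measurable_fun_sum _ fun i _ => ((hT.measurable_exitDensity i).comp
      (measurable_const.prodMk measurable_id)).const_mul _

/-- The density of the absorption time is positive at the absorption time. -/
theorem IsMarkovJumpProcess.ae_absorptionDensity_pos {X : ℝ → Ω → State p}
    (hX : IsMarkovJumpProcess P π T X) (hT : IsSubIntensity T) (hπ : π ∈ stdSimplex ℝ (Fin p))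
    (hgood : ∀ᵐ ω ∂P, IsAbsorbedPath X ω) :
    ∀ᵐ ω ∂P, 0 < absorptionDensity π T (absorptionTime X ω) := by
  have hset : MeasurableSet {x | absorptionDensity π T x ≤ 0} :=
    measurableSet_le (hT.measurable_absorptionDensity π) measurable_const
  have h := hX.hasJointDensity_one hT hπ hgood _ hset
  rw [ae_iff]
  simp only [not_lt]
  change P (absorptionTime X ⁻¹' {x | absorptionDensity π T x ≤ 0}) = 0
  have h1 : ∫⁻ ω in absorptionTime X ⁻¹' {x | absorptionDensity π T x ≤ 0}, (1 : Ω → ℝ≥0∞) ω ∂P =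
      P (absorptionTime X ⁻¹' {x | absorptionDensity π T x ≤ 0}) := by simp
  rw [← h1, h]
  refine (setLIntegral_congr_fun (g := fun _ => 0) hset fun x hx => ?_).trans lintegral_zero
  simp only [indicator_apply]
  split_ifs
  · exact ENNReal.ofReal_eq_zero.2 hx
  · rfl

/-- Bayes' formula for one process. No integrability is needed: where the density of the absorption
time vanishes, so does `y`. -/
theorem IsMarkovJumpProcess.condLExp_absorptionTime {X : ℝ → Ω → State p}
    (hX : IsMarkovJumpProcess P π T X) (hT : IsSubIntensity T) (hπ : π ∈ stdSimplex ℝ (Fin p))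
    (hgood : ∀ᵐ ω ∂P, IsAbsorbedPath X ω) {Y : Ω → ℝ≥0∞} {y : ℝ → ℝ≥0∞} (hy : Measurable y)
    (hYy : HasJointDensity P X Y y) :
    P⁻[Y|MeasurableSpace.comap (absorptionTime X) inferInstance] =ᵐ[P] fun ω =>
      y (absorptionTime X ω) / ENNReal.ofReal (absorptionDensity π T (absorptionTime X ω)) := by
  have hτ := hX.measurable_absorptionTime
  have hfm := hT.measurable_absorptionDensity π
  set f : ℝ → ℝ≥0∞ := (Ici 0).indicator fun x => ENNReal.ofReal (absorptionDensity π T x) with hf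
  have hfm' : Measurable f := hfm.ennreal_ofReal.indicator measurableSet_Ici
  have hlaw : P.map (absorptionTime X) = volume.withDensity f := by
    ext B hB
    rw [Measure.map_apply hτ hB, withDensity_apply _ hB,
      ← hX.hasJointDensity_one hT hπ hgood B hB]
    simp
  have hset : MeasurableSet {x | f x = 0} := hfm' (measurableSet_singleton 0)
  have hnull : P (absorptionTime X ⁻¹' {x | f x = 0}) = 0 := by
    rw [← Measure.map_apply hτ hset, hlaw, withDensity_apply _ hset]
    exact (setLIntegral_congr_fun (g := fun _ => 0) hset fun x hx => hx).trans lintegral_zero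
  -- the joint density vanishes where the density of the absorption time does
  have hy0 : ∀ᵐ x, f x = 0 → y x = 0 := by
    have := hYy _ hset
    rw [Measure.restrict_eq_zero.2 hnull, lintegral_zero_measure, eq_comm,
      lintegral_eq_zero_iff hy, EventuallyEq, ae_restrict_iff' hset] at this
    exact this
  have hY' : (fun ω => y (absorptionTime X ω) /
      ENNReal.ofReal (absorptionDensity π T (absorptionTime X ω))) =ᵐ[P]
      fun ω => (fun x => y x / f x) (absorptionTime X ω) := by
    filter_upwards [hgood] with ω hω
    simp only [hf]
    rw [indicator_of_mem (mem_Ici.2 hω.pos.le)]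
  refine EventuallyEq.trans (EventuallyEq.symm ?_) hY'.symm
  refine ae_eq_condLExp hτ.comap_le P Y
    ((hy.div hfm').comp (comap_measurable (absorptionTime X))) ?_
  have hyf : Measurable fun x => y x / f x := hy.div hfm'
  rintro _ ⟨B, hB, rfl⟩
  rw [hYy B hB, ← setLIntegral_map (f := fun x => y x / f x) hB hyf hτ, hlaw,
    setLIntegral_withDensity_eq_setLIntegral_mul _ hfm' hyf hB]
  refine lintegral_congr_ae (ae_restrict_of_ae ?_)
  filter_upwards [hy0] with x hx
  simp only [Pi.mul_apply]
  by_cases hfx : f x = 0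
  · rw [hfx, hx hfx, zero_mul]
  · have hft : f x ≠ ⊤ := by
      simp only [hf, indicator_apply]
      split_ifs <;> simp
    exact ENNReal.mul_div_cancel hfx hft

/-- The σ-algebra generated by the path of a process on `[0, ∞)`. -/
abbrev pathSigma (X : ℝ → Ω → State p) : MeasurableSpace Ω :=
  MeasurableSpace.comap (fun ω (t : Ici (0 : ℝ)) => X t ω) inferInstance

omit [MeasurableSpace Ω] in
theorem measurable_pathSigma (X : ℝ → Ω → State p) (t : ℝ) (ht : 0 ≤ t) :
    Measurable[pathSigma X] (X t) :=
  (measurable_pi_apply (⟨t, ht⟩ : Ici (0 : ℝ))).comp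
    (comap_measurable fun ω (t : Ici (0 : ℝ)) => X t ω)

variable {X : Fin N → ℝ → Ω → State p}

omit [IsProbabilityMeasure P] in
theorem IsMarkovJumpProcess.pathSigma_le {X : ℝ → Ω → State p}
    (hX : IsMarkovJumpProcess P π T X) : pathSigma X ≤ ‹MeasurableSpace Ω› :=
  Measurable.comap_le (measurable_pi_iff.2 fun t => hX.measurable t t.2)

/-- Bayes' formula: the conditional expectation, given all absorption times, of a functional of the
`n`-th path. -/
theorem condLExp_dataSigma (hT : IsSubIntensity T) (hπ : π ∈ stdSimplex ℝ (Fin p))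
    (hX : ∀ n, IsMarkovJumpProcess P π T (X n))
    (hindep : iIndepFun (fun n ω (t : Ici (0 : ℝ)) => X n t ω) P)
    (hgood : ∀ n, ∀ᵐ ω ∂P, IsAbsorbedPath (X n) ω) {n : Fin N} {Y : Ω → ℝ≥0∞} {y : ℝ → ℝ≥0∞}
    (hY : Measurable[pathSigma (X n)] Y) (hy : Measurable y) (hYy : HasJointDensity P (X n) Y y) :
    P⁻[Y|dataSigma X] =ᵐ[P] fun ω => y (absorptionTime (X n) ω) /
      ENNReal.ofReal (absorptionDensity π T (absorptionTime (X n) ω)) := by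
  rw [iIndepFun_iff_iIndep] at hindep
  refine EventuallyEq.trans ?_ ((hX n).condLExp_absorptionTime hT hπ (hgood n) hy hYy)
  exact condLExp_comap_of_iIndep (fun m => (hX m).pathSigma_le) hindep
    (fun m => @measurable_absorptionTime Ω (pathSigma (X m)) p (X m) (hX m).hasRegularPaths
      (measurable_pathSigma (X m))) hY

end CondExp

/-! ### The explicit conditional statistics -/

section Explicit

variable {p : ℕ} {π : Fin p → ℝ} {T : ℝ → Matrix (Fin p) (Fin p) ℝ}

theorem ofReal_Ibar (hT : IsSubIntensity T) {s x : ℝ} (hs : 0 ≤ s) (hsx : s ≤ x)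
    (hf : 0 < absorptionDensity π T x) (i : Fin p) :
    ENNReal.ofReal (Ibar π T x s (Sum.inl i)) =
      ENNReal.ofReal (stateProb π T s (Sum.inl i) * exitDensity T i s x) /
        ENNReal.ofReal (absorptionDensity π T x) := by
  rw [Ibar, iphDensity_eq hT (hs.trans hsx), vecMul_subTransition hT π hs,
    subTransition_mulVec_exitRate hT hs hsx, ENNReal.ofReal_div_of_pos hf]

theorem Ibar_nonneg (hT : IsSubIntensity T) (hπ : π ∈ stdSimplex ℝ (Fin p)) {s x : ℝ} (hs : 0 ≤ s)
    (hsx : s ≤ x) (hf : 0 < absorptionDensity π T x) (i : State p) : 0 ≤ Ibar π T x s i := by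
  rcases i with i | i
  · rw [Ibar, iphDensity_eq hT (hs.trans hsx), vecMul_subTransition hT π hs,
      subTransition_mulVec_exitRate hT hs hsx]
    exact div_nonneg (mul_nonneg (hT.stateProb_nonneg hπ hs _) (hT.exitDensity_nonneg hsx i)) hf.le
  · exact le_rfl

theorem lintegral_dNbar_inl (hT : IsSubIntensity T) {x : ℝ} (hx : 0 < x)
    (hf : 0 < absorptionDensity π T x) (i j : Fin p) {g : ℝ → ℝ≥0∞} (hg : Measurable g) :
    ∫⁻ s, g s ∂dNbar π T x (Sum.inl i) (Sum.inl j) =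
      (∫⁻ s in Ioc 0 x, g s * ENNReal.ofReal (stateProb π T s (Sum.inl i) * zeroExtend T s i j *
        exitDensity T j s x)) / ENNReal.ofReal (absorptionDensity π T x) := by
  have hk : Measurable fun s => ENNReal.ofReal (stateProb π T s (Sum.inl i) * zeroExtend T s i j *
      exitDensity T j s x / absorptionDensity π T x) :=
    (((((hT.continuous_stateProb π _).measurable.mul (hT.measurable_zeroExtend i j)).mul
      ((hT.measurable_exitDensity j).comp (measurable_id.prodMk measurable_const))).div_const
        _).ennreal_ofReal)
  have hcongr : dNbar π T x (Sum.inl i) (Sum.inl j) = (volume.restrict (Ioc 0 x)).withDensity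
      fun s => ENNReal.ofReal (stateProb π T s (Sum.inl i) * zeroExtend T s i j *
        exitDensity T j s x / absorptionDensity π T x) := by
    refine withDensity_congr_ae ?_
    filter_upwards [ae_restrict_mem measurableSet_Ioc] with s hs
    rw [iphDensity_eq hT hx.le, vecMul_subTransition hT π hs.1.le,
      subTransition_mulVec_exitRate hT hs.1.le hs.2, zeroExtend_of_nonneg T hs.1.le]
  rw [hcongr, lintegral_withDensity_eq_lintegral_mul _ hk hg, div_eq_mul_inv,
    ← lintegral_mul_const' _ _ (ENNReal.inv_ne_top.2 (ENNReal.ofReal_pos.2 hf).ne')]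
  refine lintegral_congr fun s => ?_
  simp only [Pi.mul_apply]
  rw [ENNReal.ofReal_div_of_pos hf, div_eq_mul_inv]
  ring

/-- Under the Dirac mass only the value of the density at `x` matters. -/
theorem dNbar_inl_inr (hT : IsSubIntensity T) {x : ℝ} (hx : 0 < x)
    (hf : 0 < absorptionDensity π T x) (i : Fin p) (u : Unit) :
    dNbar π T x (Sum.inl i) (Sum.inr u) =
      (ENNReal.ofReal (stateProb π T x (Sum.inl i) * exitRate (zeroExtend T) x i) /
        ENNReal.ofReal (absorptionDensity π T x)) • Measure.dirac x := by
  rw [← withDensity_const, dNbar]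
  refine withDensity_congr_ae ?_
  rw [ae_dirac_eq]
  change ENNReal.ofReal ((π ᵥ* subTransition T 0 x) i * exitRate T x i / iphDensity π T x) =
    ENNReal.ofReal (stateProb π T x (Sum.inl i) * exitRate (zeroExtend T) x i) /
      ENNReal.ofReal (absorptionDensity π T x)
  rw [iphDensity_eq hT hx.le, vecMul_subTransition hT π hx.le, ENNReal.ofReal_div_of_pos hf,
    exitRate_zeroExtend hx.le]

theorem dNbar_compl (hT : IsSubIntensity T) {x : ℝ} (hx : 0 < x)
    (hf : 0 < absorptionDensity π T x) (i j : State p) :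
    dNbar π T x i j (Ioc 0 x)ᶜ = 0 := by
  rcases i with i | i
  · rcases j with j | j
    · refine withDensity_absolutelyContinuous _ _ ?_
      rw [Measure.restrict_apply measurableSet_Ioc.compl]
      simp
    · rw [dNbar_inl_inr hT hx hf]
      simp [hx]
  · simp [dNbar]

theorem dNbar_restrict (hT : IsSubIntensity T) {x : ℝ} (hx : 0 < x)
    (hf : 0 < absorptionDensity π T x) (i j : State p) :
    (dNbar π T x i j).restrict (Ioc 0 x) = dNbar π T x i j :=
  Measure.restrict_eq_self_of_ae_mem (dNbar_compl hT hx hf i j)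

theorem measurable_setLIntegral_Ioc {k : ℝ → ℝ → ℝ≥0∞}
    (hk : Measurable fun q : ℝ × ℝ => k q.1 q.2) :
    Measurable fun x => ∫⁻ s in Ioc 0 x, k s x := by
  have h : ∀ x, ∫⁻ s in Ioc 0 x, k s x =
      ∫⁻ s, {q : ℝ × ℝ | q.2 ∈ Ioc 0 q.1}.indicator (fun q => k q.2 q.1) (x, s) := by
    intro x
    rw [← lintegral_indicator measurableSet_Ioc]
    rfl
  simp_rw [h]
  refine Measurable.lintegral_prod_right' (Measurable.indicator (hk.comp measurable_swap) ?_)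
  exact (measurableSet_lt measurable_const measurable_snd).inter
    (measurableSet_le measurable_snd measurable_fst)

end Explicit

theorem measurable_lintegral_occ {Ω : Type*} [MeasurableSpace Ω] {p : ℕ} {X : ℝ → Ω → State p}
    (hX : HasRegularPaths X) (hm : ∀ t, 0 ≤ t → Measurable (X t)) (i : State p) {g : ℝ → ℝ≥0∞}
    (hg : Measurable g) :
    Measurable fun ω => ∫⁻ s in Ioi 0, g s * ENNReal.ofReal (occ X i (max s 0) ω) :=
  Measurable.lintegral_prod_left' (f := fun q : ℝ × Ω =>
    g q.1 * ENNReal.ofReal (occ X i (max q.1 0) q.2))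
    ((hg.comp measurable_fst).mul (measurable_occ_prod hX hm i).ennreal_ofReal)

section CondExp

variable {Ω : Type*} [MeasurableSpace Ω] {P : Measure Ω} [IsProbabilityMeasure P] {p N : ℕ}
  {π : Fin p → ℝ} {T : ℝ → Matrix (Fin p) (Fin p) ℝ} {X : Fin N → ℝ → Ω → State p}

variable (hT : IsSubIntensity T) (hπ : π ∈ stdSimplex ℝ (Fin p))
    (hX : ∀ n, IsMarkovJumpProcess P π T (X n))
    (hindep : iIndepFun (fun n ω (t : Ici (0 : ℝ)) => X n t ω) P)
    (hgood : ∀ n, ∀ᵐ ω ∂P, IsAbsorbedPath (X n) ω)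

include hT hπ hX hgood in
theorem ae_isAbsorbedPath_and_pos : ∀ᵐ ω ∂P, ∀ n, IsAbsorbedPath (X n) ω ∧
    0 < absorptionDensity π T (absorptionTime (X n) ω) :=
  ae_all_iff.2 fun n => (hgood n).and ((hX n).ae_absorptionDensity_pos hT hπ (hgood n))

include hT hπ hX hindep hgood

/-- The conditional probability of a transient state: zero after absorption, whatever `Ibar` is. -/
theorem condLExp_state (n : Fin N) (i : Fin p) {s : ℝ} (hs : 0 ≤ s) :
    P⁻[{ω | X n s ω = Sum.inl i}.indicator 1|dataSigma X] =ᵐ[P] fun ω =>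
      (Ici s).indicator (fun x => ENNReal.ofReal (Ibar π T x s (Sum.inl i)))
        (absorptionTime (X n) ω) := by
  have hset : MeasurableSet[pathSigma (X n)] {ω | X n s ω = Sum.inl i} :=
    measurable_pathSigma (X n) s hs (measurableSet_singleton (Sum.inl i))
  refine (condLExp_dataSigma hT hπ hX hindep hgood (measurable_const.indicator hset)
    (((measurable_const.mul ((hT.measurable_exitDensity i).comp
      (measurable_const.prodMk measurable_id))).ennreal_ofReal).indicator measurableSet_Ici)
    ((hX n).hasJointDensity_state hT hπ (hgood n) hs i)).trans ?_
  filter_upwards [ae_isAbsorbedPath_and_pos hT hπ hX hgood] with ω hω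
  by_cases hsτ : s ≤ absorptionTime (X n) ω
  · rw [indicator_of_mem (mem_Ici.2 hsτ), indicator_of_mem (mem_Ici.2 hsτ),
      ofReal_Ibar hT hs hsτ (hω n).2]
    rfl
  · rw [indicator_of_notMem (by simpa using hsτ), indicator_of_notMem (by simpa using hsτ),
      ENNReal.zero_div]

theorem condLExp_occupation (n : Fin N) (i : Fin p) {g : ℝ → ℝ≥0∞} (hg : Measurable g) :
    P⁻[fun ω => ∫⁻ s in Ioi 0, g s * ENNReal.ofReal (occ (X n) (Sum.inl i) (max s 0) ω)|
        dataSigma X] =ᵐ[P]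
      fun ω => ∫⁻ s in Ioc 0 (absorptionTime (X n) ω),
        g s * ENNReal.ofReal (Ibar π T (absorptionTime (X n) ω) s (Sum.inl i)) := by
  have hk : Measurable fun q : ℝ × ℝ => g q.1 * ENNReal.ofReal
      (stateProb π T q.1 (Sum.inl i) * exitDensity T i q.1 q.2) :=
    (hg.comp measurable_fst).mul ((((hT.continuous_stateProb π _).measurable.comp
      measurable_fst).mul (hT.measurable_exitDensity i)).ennreal_ofReal)
  have hY : Measurable[pathSigma (X n)] fun ω =>
      ∫⁻ s in Ioi 0, g s * ENNReal.ofReal (occ (X n) (Sum.inl i) (max s 0) ω) :=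
    @measurable_lintegral_occ Ω (pathSigma (X n)) p (X n) (hX n).hasRegularPaths
      (measurable_pathSigma (X n)) (Sum.inl i) g hg
  refine (condLExp_dataSigma hT hπ hX hindep hgood hY (measurable_setLIntegral_Ioc hk)
    ((hX n).hasJointDensity_occupation hT hπ (hgood n) hg i)).trans ?_
  filter_upwards [ae_isAbsorbedPath_and_pos hT hπ hX hgood] with ω hω
  rw [div_eq_mul_inv, ← lintegral_mul_const' _ _
    (ENNReal.inv_ne_top.2 (ENNReal.ofReal_pos.2 (hω n).2).ne')]
  refine setLIntegral_congr_fun measurableSet_Ioc fun s hs => ?_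
  rw [ofReal_Ibar hT hs.1.le hs.2 (hω n).2, div_eq_mul_inv, mul_assoc]

theorem condLExp_jumpMeasure (n : Fin N) {i j : State p} (hij : i ≠ j) {g : ℝ → ℝ≥0∞}
    (hg : Measurable g) :
    P⁻[fun ω => ∫⁻ s, g s ∂jumpMeasure (X n) i j ω|dataSigma X] =ᵐ[P]
      fun ω => ∫⁻ s, g s ∂dNbar π T (absorptionTime (X n) ω) i j := by
  have hY : Measurable[pathSigma (X n)] fun ω => ∫⁻ s, g s ∂jumpMeasure (X n) i j ω :=
    (Measure.measurable_lintegral hg).comp (@measurable_jumpMeasure Ω (pathSigma (X n)) p (X n)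
      (hX n).hasRegularPaths (measurable_pathSigma (X n)) i j hij)
  rcases i with i | i
  · rcases j with j | j
    · have hk : Measurable fun q : ℝ × ℝ => g q.1 * ENNReal.ofReal
          (stateProb π T q.1 (Sum.inl i) * zeroExtend T q.1 i j * exitDensity T j q.1 q.2) :=
        (hg.comp measurable_fst).mul (((((hT.continuous_stateProb π _).measurable.mul
          (hT.measurable_zeroExtend i j)).comp measurable_fst).mul
            (hT.measurable_exitDensity j)).ennreal_ofReal)
      refine (condLExp_dataSigma hT hπ hX hindep hgood hY (measurable_setLIntegral_Ioc hk)
        ((hX n).hasJointDensity_jump hT hπ (hgood n) (fun h => hij (by rw [h])) hg)).trans ?_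
      filter_upwards [ae_isAbsorbedPath_and_pos hT hπ hX hgood] with ω hω
      rw [lintegral_dNbar_inl hT (hω n).1.pos (hω n).2 i j hg]
    · refine (condLExp_dataSigma hT hπ hX hindep hgood hY ((hg.mul
        (((hT.continuous_stateProb π _).measurable.mul
          (hT.measurable_exitRate_zeroExtend i)).ennreal_ofReal)).indicator measurableSet_Ioi)
        ((hX n).hasJointDensity_exit hT hπ (hgood n) i hg)).trans ?_
      filter_upwards [ae_isAbsorbedPath_and_pos hT hπ hX hgood] with ω hω
      rw [indicator_of_mem (mem_Ioi.2 (hω n).1.pos), dNbar_inl_inr hT (hω n).1.pos (hω n).2,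
        lintegral_smul_measure, lintegral_dirac' _ hg, smul_eq_mul, Pi.mul_apply, mul_div_assoc,
        mul_comm]
      rfl
  · have h0 : (fun ω => ∫⁻ s, g s ∂jumpMeasure (X n) (Sum.inr i) j ω) =ᵐ[P] fun _ => 0 := by
      filter_upwards [hgood n] with ω hω
      rw [hω.jumpMeasure_absorbing hij, lintegral_zero_measure]
    refine (condLExp_congr_ae h0).trans ?_
    filter_upwards with ω
    rw [dNbar, lintegral_zero_measure]
    exact congrFun (condLExp_zero P) ω

end CondExp

/-! ### Conditional expectations of the complete-data statistics -/

section CompleteData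

variable {Ω : Type*} [MeasurableSpace Ω] {P : Measure Ω} [IsProbabilityMeasure P] {p N : ℕ}
  {π : Fin p → ℝ} {T : ℝ → Matrix (Fin p) (Fin p) ℝ} {X : Fin N → ℝ → Ω → State p}

omit [IsProbabilityMeasure P] in
theorem dataSigma_le (hX : ∀ n, IsMarkovJumpProcess P π T (X n)) :
    dataSigma X ≤ ‹MeasurableSpace Ω› :=
  (measurable_pi_iff.2 fun n => (hX n).measurable_absorptionTime).comap_le

omit [MeasurableSpace Ω] in
theorem measurable_absorptionTime_dataSigma (n : Fin N) :
    Measurable[dataSigma X] (absorptionTime (X n)) :=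
  (measurable_pi_apply n).comp (comap_measurable fun ω n => absorptionTime (X n) ω)

theorem IsMarkovJumpProcess.integrable_occ {X : ℝ → Ω → State p}
    (hX : IsMarkovJumpProcess P π T X) (i : State p) {s : ℝ} (hs : 0 ≤ s) :
    Integrable (occ X i s) P := by
  rw [occ_eq_indicator]
  exact (integrable_const 1).indicator (measurableSet_state hX.measurable hs i)

variable (hT : IsSubIntensity T) (hπ : π ∈ stdSimplex ℝ (Fin p))
    (hX : ∀ n, IsMarkovJumpProcess P π T (X n))
    (hindep : iIndepFun (fun n ω (t : Ici (0 : ℝ)) => X n t ω) P)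
    (hgood : ∀ n, ∀ᵐ ω ∂P, IsAbsorbedPath (X n) ω)

include hT hπ hX hindep hgood in
theorem condExp_occ_inl (n : Fin N) (i : Fin p) {s : ℝ} (hs : 0 ≤ s) :
    P[occ (X n) (Sum.inl i) s|dataSigma X] =ᵐ[P] fun ω =>
      (Ici s).indicator (fun x => Ibar π T x s (Sum.inl i)) (absorptionTime (X n) ω) := by
  have hset := measurableSet_state (hX n).measurable hs (Sum.inl i)
  have h := toReal_condLExp (dataSigma X) (f := {ω | X n s ω = Sum.inl i}.indicator 1) (μ := P)
    (measurable_const.indicator hset).aemeasurable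
    (by rw [lintegral_indicator_one hset]; exact measure_ne_top _ _)
  have hocc : (fun ω => ({ω | X n s ω = Sum.inl i}.indicator (1 : Ω → ℝ≥0∞) ω).toReal) =
      occ (X n) (Sum.inl i) s := by
    ext ω
    by_cases hω : X n s ω = Sum.inl i <;> simp [occ, hω]
  rw [hocc] at h
  refine h.symm.trans ?_
  filter_upwards [condLExp_state hT hπ hX hindep hgood n i hs,
    ae_isAbsorbedPath_and_pos hT hπ hX hgood] with ω hω1 hω2
  rw [hω1]
  by_cases hsτ : s ≤ absorptionTime (X n) ω
  · rw [indicator_of_mem (mem_Ici.2 hsτ), indicator_of_mem (mem_Ici.2 hsτ),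
      ENNReal.toReal_ofReal (Ibar_nonneg hT hπ hs hsτ (hω2 n).2 _)]
  · rw [indicator_of_notMem (by simpa using hsτ), indicator_of_notMem (by simpa using hsτ),
      ENNReal.toReal_zero]

omit [IsProbabilityMeasure P] in
include hX in
theorem startCount_absorbing : ∀ᵐ ω ∂P, startCount X absorbingState ω = 0 := by
  have h0 : ∀ n, ∀ᵐ ω ∂P, X n 0 ω ≠ absorbingState := fun n => by
    rw [ae_iff]; simpa using (hX n).initial_absorbing
  filter_upwards [ae_all_iff.2 h0] with ω hω
  simp [startCount, hω]

omit [MeasurableSpace Ω] in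
theorem startCount_eq_sum_occ (i : State p) (ω : Ω) :
    (startCount X i ω : ℝ) = ∑ n, occ (X n) i 0 ω := by
  simp [startCount, occ]

include hT hπ hX hindep hgood in
theorem condExp_startCount (i : State p) :
    P[fun ω => (startCount X i ω : ℝ)|dataSigma X] =ᵐ[P]
      fun ω => Bbar π T (fun n => absorptionTime (X n) ω) i := by
  rcases i with i | i
  · have h1 : (fun ω => (startCount X (Sum.inl i) ω : ℝ)) = ∑ n, occ (X n) (Sum.inl i) 0 := by
      ext ω
      rw [startCount_eq_sum_occ, Finset.sum_apply]
    rw [h1]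
    refine (condExp_finsetSum (fun n _ => (hX n).integrable_occ _ le_rfl) _).trans ?_
    filter_upwards [ae_all_iff.2 fun n => condExp_occ_inl hT hπ hX hindep hgood n i le_rfl,
      ae_isAbsorbedPath_and_pos hT hπ hX hgood] with ω hω1 hω2
    rw [Finset.sum_apply, Bbar]
    refine Finset.sum_congr rfl fun n _ => ?_
    rw [hω1 n, indicator_of_mem (mem_Ici.2 (hω2 n).1.pos.le), Ibar,
      vecMul_subTransition hT π le_rfl, stateProb_zero hT]
  · have h0 : (fun ω => (startCount X (Sum.inr i) ω : ℝ)) =ᵐ[P] 0 := by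
      filter_upwards [startCount_absorbing hX] with ω hω
      rw [hω, Nat.cast_zero, Pi.zero_apply]
    refine (condExp_congr_ae h0).trans ?_
    rw [condExp_zero]
    rfl

include hT hπ hX hgood in
/-- The law of the absorption time has no atoms. -/
theorem ae_absorptionTime_ne (n : Fin N) (s : ℝ) : ∀ᵐ ω ∂P, absorptionTime (X n) ω ≠ s := by
  have h := (hX n).hasJointDensity_one hT hπ (hgood n) {s} (measurableSet_singleton s)
  rw [Measure.restrict_singleton, Real.volume_singleton, zero_smul, lintegral_zero_measure] at h
  rw [ae_iff]
  simpa [preimage] using h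

include hT hπ hX hindep hgood in
/-- For the absorbing state the conditional expectation is the indicator of `τ ≤ s`. On `s ≤ τ` it
is the value `0` of `Ibar`, except on the null event `τ = s`. -/
theorem condExp_occ (n : Fin N) (i : State p) {s : ℝ} (hs : 0 ≤ s) :
    ∀ᵐ ω ∂P, s ≤ absorptionTime (X n) ω →
      P[occ (X n) i s|dataSigma X] ω = Ibar π T (absorptionTime (X n) ω) s i := by
  rcases i with i | i
  · filter_upwards [condExp_occ_inl hT hπ hX hindep hgood n i hs] with ω hω hsτ
    rw [hω, indicator_of_mem (mem_Ici.2 hsτ)]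
  · have hset : MeasurableSet[dataSigma X] {ω | absorptionTime (X n) ω ≤ s} :=
      measurable_absorptionTime_dataSigma n measurableSet_Iic
    have h0 : occ (X n) (Sum.inr i) s =ᵐ[P]
        {ω | absorptionTime (X n) ω ≤ s}.indicator (fun _ => (1 : ℝ)) := by
      filter_upwards [hgood n] with ω hω
      have := hω.eq_absorbing_iff s hs
      by_cases h : absorptionTime (X n) ω ≤ s
      · rw [indicator_of_mem (show ω ∈ {ω | absorptionTime (X n) ω ≤ s} from h), occ,
          if_pos (this.2 h)]
      · rw [indicator_of_notMem (show ω ∉ {ω | absorptionTime (X n) ω ≤ s} from h), occ,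
          if_neg fun hh => h (this.1 hh)]
    have h1 := condExp_of_stronglyMeasurable (μ := P) (dataSigma_le hX)
      (stronglyMeasurable_const.indicator hset)
      ((integrable_const (1 : ℝ)).indicator (dataSigma_le hX _ hset))
    filter_upwards [condExp_congr_ae (m := dataSigma X) h0,
      ae_absorptionTime_ne hT hπ hX hgood n s] with ω hω hne hsτ
    rw [hω, h1, indicator_of_notMem
      (show ω ∉ {ω | absorptionTime (X n) ω ≤ s} from (hsτ.lt_of_ne hne.symm).not_ge)]
    rfl

omit [MeasurableSpace Ω] in
theorem HasRegularPaths.toReal_jumpMeasure_Ioc {X : ℝ → Ω → State p} (hX : HasRegularPaths X)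
    {i j : State p} (hij : i ≠ j) (s : ℝ) (ω : Ω) :
    (jumpMeasure X i j ω (Ioc 0 s)).toReal = jumpCount X i j s ω := by
  have hfin : (jumpTimes X i j ω ∩ Ioc 0 s).Finite :=
    (hX.finite_allJumpTimes ω s).subset
      (inter_subset_inter (jumpTimes_subset_allJumpTimes hij ω) fun u hu => hu.2)
  rw [jumpMeasure_apply _ _ _ _ measurableSet_Ioc, jumpCount, ← hfin.cast_ncard_eq]
  simp

include hT hπ hX hindep hgood in
theorem condExp_jumpCount (n : Fin N) {i j : State p} (hij : i ≠ j) {s : ℝ} (hs : 0 ≤ s) :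
    Integrable (jumpCount (X n) i j s) P ∧ P[jumpCount (X n) i j s|dataSigma X] =ᵐ[P]
      fun ω => (dNbar π T (absorptionTime (X n) ω) i j).real (Ioc 0 s) := by
  have hc : jumpCount (X n) i j s = fun ω => (jumpMeasure (X n) i j ω (Ioc 0 s)).toReal :=
    funext fun ω => ((hX n).hasRegularPaths.toReal_jumpMeasure_Ioc hij s ω).symm
  have hm : Measurable fun ω => jumpMeasure (X n) i j ω (Ioc 0 s) :=
    measurable_jumpMeasure_Ioc (hX n).hasRegularPaths (hX n).measurable hij 0 s
  have hfin := ((hX n).lintegral_jumpMeasure_lt_top hT hπ hij le_rfl hs).ne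
  rw [hc]
  refine ⟨integrable_toReal_of_lintegral_ne_top hm.aemeasurable hfin, ?_⟩
  refine (toReal_condLExp (dataSigma X) hm.aemeasurable hfin).symm.trans ?_
  have h := condLExp_jumpMeasure hT hπ hX hindep hgood n hij
    ((measurable_const (a := (1 : ℝ≥0∞))).indicator (measurableSet_Ioc (a := 0) (b := s)))
  simp only [lintegral_indicator_const measurableSet_Ioc, one_mul] at h
  filter_upwards [h] with ω hω
  rw [hω, measureReal_def]

end CompleteData

/-! ### Extended conditional expectations -/

section ExtendedCondExp

theorem coe_ennreal_sub_add_sub (a b c d : ℝ≥0∞) :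
    ((a : EReal) - c) + ((b : EReal) - d) =
      ((a + b : ℝ≥0∞) : EReal) - ((c + d : ℝ≥0∞) : EReal) := by
  rw [EReal.coe_ennreal_add, EReal.coe_ennreal_add, EReal.add_sub_add_comm]
  · exact Or.inl (EReal.coe_ennreal_ne_bot c)
  · exact Or.inr (EReal.coe_ennreal_ne_bot d)

theorem toENNReal_sub_add {a c : ℝ≥0∞} (ha : a < ⊤) :
    ((a : EReal) - c).toENNReal + c = a + (-((a : EReal) - c)).toENNReal := by
  lift a to NNReal using ha.ne
  induction c using ENNReal.recTopCoe with
  | top => simp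
  | coe c =>
    have h : (((a : ℝ≥0∞) : EReal) - ((c : ℝ≥0∞) : EReal)) = (((a : ℝ) - c : ℝ) : EReal) := by
      rw [EReal.coe_sub]; rfl
    rw [h, ← EReal.coe_neg, EReal.real_coe_toENNReal, EReal.real_coe_toENNReal,
      ← ENNReal.ofReal_coe_nnreal, ← ENNReal.ofReal_coe_nnreal]
    rcases le_total (a : ℝ) c with hac | hac
    · rw [ENNReal.ofReal_of_nonpos (by linarith),
        ← ENNReal.ofReal_add a.coe_nonneg (by linarith), zero_add]
      congr 1
      ring
    · rw [ENNReal.ofReal_of_nonpos (p := -((a : ℝ) - c)) (by linarith),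
        ← ENNReal.ofReal_add (by linarith) c.coe_nonneg, add_zero]
      congr 1
      ring

theorem coe_ennreal_sub_eq_of_add_eq {x y a c : ℝ≥0∞} (hx : x < ⊤) (ha : a < ⊤)
    (h : x + c = a + y) : (a : EReal) - c = (x : EReal) - y := by
  lift a to NNReal using ha.ne
  lift x to NNReal using hx.ne
  induction c using ENNReal.recTopCoe with
  | top =>
    have hy : y = ⊤ := by
      by_contra hy
      exact ENNReal.add_ne_top.2 ⟨ENNReal.coe_ne_top, hy⟩ (h.symm.trans (by simp))
    rw [hy]
    simp
  | coe c =>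
    have hy : y ≠ ⊤ := fun hy => by
      rw [hy, add_top] at h
      exact ENNReal.add_ne_top.2 ⟨ENNReal.coe_ne_top, ENNReal.coe_ne_top⟩ h
    lift y to NNReal using hy
    have h' : (x : ℝ) + c = a + y := by exact_mod_cast h
    have h1 : ∀ u v : NNReal, (((u : ℝ≥0∞) : EReal) - ((v : ℝ≥0∞) : EReal)) =
        (((u : ℝ) - v : ℝ) : EReal) := fun u v => by rw [EReal.coe_sub]; rfl
    rw [h1, h1]
    congr 1
    linarith

variable {Ω : Type*} {m : MeasurableSpace Ω} [mΩ : MeasurableSpace Ω] {P : Measure Ω}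

/-- `ξ` is the difference of non-negative variables `A` and `C`, of which `A` and its conditional
expectation are finite, and `Z` is the difference of their conditional expectations. Unlike
`HasCondExp`, this does not refer to the positive and the negative part of `ξ`, and so it is
visibly stable under sums. -/
def HasSplitCondExp (P : Measure Ω) (m : MeasurableSpace Ω) (ξ Z : Ω → EReal) : Prop :=
  ∃ A C : Ω → ℝ≥0∞, AEMeasurable A P ∧ AEMeasurable C P ∧ (∀ᵐ ω ∂P, A ω < ⊤) ∧
    (∀ᵐ ω ∂P, P⁻[A|m] ω < ⊤) ∧ (∀ᵐ ω ∂P, ξ ω = (A ω : EReal) - C ω) ∧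
    ∀ᵐ ω ∂P, Z ω = (P⁻[A|m] ω : EReal) - P⁻[C|m] ω

theorem HasSplitCondExp.congr {ξ Z ξ' Z' : Ω → EReal} (h : HasSplitCondExp P m ξ Z)
    (hξ : ξ' =ᵐ[P] ξ) (hZ : Z' =ᵐ[P] Z) : HasSplitCondExp P m ξ' Z' := by
  obtain ⟨A, C, hA, hC, hAt, hAt', h1, h2⟩ := h
  refine ⟨A, C, hA, hC, hAt, hAt', ?_, ?_⟩
  · filter_upwards [h1, hξ] with ω h h' using h'.trans h
  · filter_upwards [h2, hZ] with ω h h' using h'.trans h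

/-- A variable without positive part. -/
theorem hasSplitCondExp_neg {C : Ω → ℝ≥0∞} (hC : AEMeasurable C P) :
    HasSplitCondExp P m (fun ω => -(C ω : EReal)) fun ω => -(P⁻[C|m] ω : EReal) := by
  refine ⟨0, C, aemeasurable_const, hC, ?_, ?_, ?_, ?_⟩
  · simp
  · rw [condLExp_zero]; simp
  · simp
  · rw [condLExp_zero]; simp

theorem hasSplitCondExp_zero : HasSplitCondExp P m (fun _ => 0) fun _ => 0 := by
  refine (hasSplitCondExp_neg (P := P) (m := m) (C := 0) aemeasurable_const).congr ?_ ?_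
  · simp
  · rw [condLExp_zero]; simp

theorem HasSplitCondExp.add {ξ Z ξ' Z' : Ω → EReal} (h : HasSplitCondExp P m ξ Z)
    (h' : HasSplitCondExp P m ξ' Z') :
    HasSplitCondExp P m (fun ω => ξ ω + ξ' ω) fun ω => Z ω + Z' ω := by
  obtain ⟨A, C, hA, hC, hAt, hAt', h1, h2⟩ := h
  obtain ⟨B, D, hB, hD, hBt, hBt', h3, h4⟩ := h'
  have hAB := condLExp_add_left (mΩ := m) B hA
  have hCD := condLExp_add_left (mΩ := m) D hC
  refine ⟨A + B, C + D, hA.add hB, hC.add hD, ?_, ?_, ?_, ?_⟩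
  · filter_upwards [hAt, hBt] with ω ha hb using ENNReal.add_lt_top.2 ⟨ha, hb⟩
  · filter_upwards [hAt', hBt', hAB] with ω ha hb hab
    rw [hab]
    exact ENNReal.add_lt_top.2 ⟨ha, hb⟩
  · filter_upwards [h1, h3] with ω h1 h3
    rw [h1, h3, coe_ennreal_sub_add_sub]
    rfl
  · filter_upwards [h2, h4, hAB, hCD] with ω h2 h4 hab hcd
    rw [h2, h4, coe_ennreal_sub_add_sub, hab, hcd]
    rfl

theorem HasSplitCondExp.sum {ι : Type*} (s : Finset ι) {ξ Z : ι → Ω → EReal}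
    (h : ∀ i ∈ s, HasSplitCondExp P m (ξ i) (Z i)) :
    HasSplitCondExp P m (fun ω => ∑ i ∈ s, ξ i ω) fun ω => ∑ i ∈ s, Z i ω := by
  classical
  induction s using Finset.induction_on with
  | empty => simpa using hasSplitCondExp_zero
  | insert i s hi ih =>
    simp only [Finset.sum_insert hi]
    exact (h i (Finset.mem_insert_self i s)).add
      (ih fun j hj => h j (Finset.mem_insert_of_mem hj))

/-- For `ξ = A - C` the positive and the negative part satisfy `ξ⁺ + C = A + ξ⁻` and `ξ⁺ ≤ A`.
Taking conditional expectations of these relations gives the claim. -/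
theorem HasSplitCondExp.hasCondExp {ξ Z : Ω → EReal} (h : HasSplitCondExp P m ξ Z) :
    HasCondExp P m ξ Z := by
  obtain ⟨A, C, hA, hC, hAt, hAt', h1, h2⟩ := h
  have hξ : AEMeasurable ξ P := by
    refine AEMeasurable.congr (f := fun ω => (A ω : EReal) + -(C ω : EReal)) ?_ ?_
    · exact hA.coe_ereal_ennreal.add (continuous_neg.measurable.comp_aemeasurable
        hC.coe_ereal_ennreal)
    · filter_upwards [h1] with ω h
      rw [h, sub_eq_add_neg]
  have hle : (fun ω => (ξ ω).toENNReal) ≤ᵐ[P] A := by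
    filter_upwards [h1] with ω h
    rw [h]
    calc ((A ω : EReal) - C ω).toENNReal ≤ (A ω : EReal).toENNReal :=
          EReal.toENNReal_le_toENNReal ((EReal.sub_le_sub le_rfl
            (EReal.coe_ennreal_nonneg _)).trans_eq (sub_zero _))
      _ = A ω := EReal.toENNReal_coe
  have hadd : (fun ω => (ξ ω).toENNReal) + C =ᵐ[P] A + fun ω => (-ξ ω).toENNReal := by
    filter_upwards [h1, hAt] with ω h ha
    simp only [Pi.add_apply]
    rw [h, toENNReal_sub_add ha]
  have hfin : ∀ᵐ ω ∂P, P⁻[fun ω => (ξ ω).toENNReal|m] ω < ⊤ := by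
    filter_upwards [condLExp_mono (mΩ := m) hle, hAt'] with ω h h' using h.trans_lt h'
  refine ⟨hξ, hfin, ?_⟩
  filter_upwards [h2, hfin, hAt', condLExp_congr_ae (mΩ := m) hadd,
    condLExp_add_right (mΩ := m) (fun ω => (ξ ω).toENNReal) hC,
    condLExp_add_left (mΩ := m) (fun ω => (-ξ ω).toENNReal) hA] with ω h2 hx ha h3 h4 h5
  rw [h2]
  refine coe_ennreal_sub_eq_of_add_eq hx ha ?_
  rw [h4, h5] at h3
  exact h3

theorem log_prod_eq_sum_log {ι : Type*} (s : Finset ι) (f : ι → ℝ≥0∞) :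
    ENNReal.log (∏ i ∈ s, f i) = ∑ i ∈ s, ENNReal.log (f i) := by
  classical
  induction s using Finset.induction_on with
  | empty => simp
  | insert i s hi ih => rw [Finset.prod_insert hi, Finset.sum_insert hi, ENNReal.log_mul_add, ih]

theorem ereal_sum_mul_of_nonneg {ι : Type*} (s : Finset ι) {b : ι → ℝ} (hb : ∀ i ∈ s, 0 ≤ b i)
    (c : EReal) : ((∑ i ∈ s, b i : ℝ) : EReal) * c = ∑ i ∈ s, (b i : EReal) * c := by
  classical
  induction s using Finset.induction_on with
  | empty => simp
  | insert i s hi ih =>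
    rw [Finset.sum_insert hi, Finset.sum_insert hi, EReal.coe_add, EReal.right_distrib_of_nonneg,
      ih fun j hj => hb j (Finset.mem_insert_of_mem hj)]
    · exact EReal.coe_nonneg.2 (hb i (Finset.mem_insert_self i s))
    · exact EReal.coe_nonneg.2 (Finset.sum_nonneg fun j hj => hb j (Finset.mem_insert_of_mem hj))

theorem measurable_elog : Measurable elog :=
  ENNReal.measurable_log.comp ENNReal.measurable_ofReal

theorem elog_ne_top (x : ℝ) : elog x ≠ ⊤ := by
  rw [elog, Ne, ENNReal.log_eq_top_iff]
  exact ENNReal.ofReal_ne_top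

theorem toENNReal_elog {x : ℝ} (hx : 0 ≤ x) :
    (elog x).toENNReal = ENNReal.ofReal (Real.posLog x) := by
  rw [elog, ENNReal.log_ofReal, Real.posLog]
  split_ifs with h
  · have : x = 0 := le_antisymm h hx
    simp [this]
  · rw [EReal.real_coe_toENNReal]
    rcases le_total (Real.log x) 0 with h | h
    · rw [max_eq_left h, ENNReal.ofReal_of_nonpos h, ENNReal.ofReal_zero]
    · rw [max_eq_right h]

theorem elog_nonpos {x : ℝ} (hx : x ≤ 1) : elog x ≤ 0 := by
  rw [elog, ← ENNReal.log_one]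
  exact ENNReal.log_monotone (by simpa using hx)

end ExtendedCondExp

/-! ### The terms of the log-likelihood -/

section LogLikelihood

theorem IsSubIntensity.intervalIntegrable_Ibar_mul {p : ℕ} {π : Fin p → ℝ}
    {T₀ T : ℝ → Matrix (Fin p) (Fin p) ℝ} (hT₀ : IsSubIntensity T₀) (hT : IsSubIntensity T)
    {x : ℝ} (hx : 0 ≤ x) (i : Fin p) (j : State p) :
    IntervalIntegrable (fun s => Ibar π T₀ x s (Sum.inl i) * intensity T s (Sum.inl i) j)
      volume 0 x := by
  have h : IntervalIntegrable (fun s => (stateProb π T₀ s (Sum.inl i) * exitDensity T₀ i s x /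
      iphDensity π T₀ x) * intensity (zeroExtend T) s (Sum.inl i) j) volume 0 x :=
    (hT.entrywiseIntegrable_intensity _ _ 0 x).continuousOn_mul
      (((hT₀.continuous_stateProb π _).mul (hT₀.continuous_exitDensity_left i x)).div_const
        _).continuousOn
  refine h.congr fun s hs => ?_
  rw [uIoc_of_le hx] at hs
  rw [intensity_zeroExtend hs.1.le, Ibar, vecMul_subTransition hT₀ π hs.1.le,
    subTransition_mulVec_exitRate hT₀ hs.1.le hs.2]

/-- No jumps occur after absorption, so the time horizon `H` plays no role in the first term. -/
theorem IsAbsorbedPath.transitionTerm_eq {Ω : Type*} {p : ℕ} {X : ℝ → Ω → State p} {ω : Ω}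
    (h : IsAbsorbedPath X ω) (T : ℝ → Matrix (Fin p) (Fin p) ℝ) {H : ℝ}
    (hH : absorptionTime X ω ≤ H) {i j : State p} (hij : i ≠ j) :
    transitionTerm T H X i j ω =
      eintegral (fun s => elog (intensity T s i j)) (jumpMeasure X i j ω) +
        -((∫ s in (0 : ℝ)..H, occ X i s ω * intensity T s i j : ℝ) : EReal) := by
  rw [transitionTerm, h.jumpMeasure_restrict hij hH, sub_eq_add_neg]

/-- The integral is a finite sum over the jump times. -/
theorem IsAbsorbedPath.lintegral_jumpMeasure_lt_top {Ω : Type*} {p : ℕ} {X : ℝ → Ω → State p}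
    {ω : Ω} (h : IsAbsorbedPath X ω) (hX : HasRegularPaths X) {i j : State p} (hij : i ≠ j)
    {g : ℝ → ℝ≥0∞} (hgm : Measurable g) (hg : ∀ s, g s ≠ ⊤) : ∫⁻ s, g s ∂jumpMeasure X i j ω < ⊤ := by
  have hfin : (jumpTimes X i j ω).Finite := by
    refine (hX.finite_allJumpTimes ω (absorptionTime X ω)).subset fun s hs => ?_
    exact ⟨jumpTimes_subset_allJumpTimes hij ω hs, (h.jumpTimes_subset hij hs).2⟩
  have : Fintype (jumpTimes X i j ω) := hfin.fintype
  rw [jumpMeasure, lintegral_sum_measure, tsum_fintype]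
  refine ENNReal.sum_lt_top.2 fun s _ => ?_
  rw [lintegral_dirac' _ hgm]
  exact (hg s).lt_top

variable {Ω : Type*} [MeasurableSpace Ω] {P : Measure Ω} [IsProbabilityMeasure P] {p N : ℕ}
  {π₀ : Fin p → ℝ} {T₀ T : ℝ → Matrix (Fin p) (Fin p) ℝ} {X : Fin N → ℝ → Ω → State p}

/-- The time spent in a transient state, weighted with a rate, as a Lebesgue integral over the whole
half-line. -/
theorem ofReal_integral_occ {X : ℝ → Ω → State p} (hX : HasRegularPaths X)
    (hm : ∀ t, 0 ≤ t → Measurable (X t)) (hT : IsSubIntensity T) {ω : Ω} (h : IsAbsorbedPath X ω)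
    {H : ℝ} (hH : absorptionTime X ω ≤ H) (i : Fin p) {j : State p} (hij : Sum.inl i ≠ j) :
    ENNReal.ofReal (∫ s in (0 : ℝ)..H, occ X (Sum.inl i) s ω * intensity T s (Sum.inl i) j) =
      ∫⁻ s in Ioi 0, ENNReal.ofReal (intensity T s (Sum.inl i) j) *
        ENNReal.ofReal (occ X (Sum.inl i) (max s 0) ω) := by
  have hocc : Measurable fun s => occ X (Sum.inl i) (max s 0) ω :=
    (measurable_occ_prod hX hm (Sum.inl i)).comp (measurable_id.prodMk measurable_const)
  have hocc0 : ∀ s, 0 ≤ occ X (Sum.inl i) s ω := fun s => by rw [occ]; split_ifs <;> norm_num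
  have hocc1 : ∀ s, occ X (Sum.inl i) s ω ≤ 1 := fun s => by rw [occ]; split_ifs <;> norm_num
  have hH0 : 0 ≤ H := h.pos.le.trans hH
  have hint : IntervalIntegrable (fun s => occ X (Sum.inl i) (max s 0) ω *
      intensity (zeroExtend T) s (Sum.inl i) j) volume 0 H := by
    refine (hT.entrywiseIntegrable_intensity (Sum.inl i) j 0 H).norm.mono_fun'
      (hocc.mul (hT.measurable_intensity_zeroExtend _ _)).aestronglyMeasurable
      (ae_of_all _ fun s => ?_)
    simp only
    rw [norm_mul, Real.norm_of_nonneg (hocc0 _)]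
    exact mul_le_of_le_one_left (norm_nonneg _) (hocc1 _)
  rw [ofReal_intervalIntegral hH0 (hint.congr fun s hs => ?_) fun s hs =>
    mul_nonneg (hocc0 s) (hT.intensity_nonneg hs.1.le hij),
    ← lintegral_indicator measurableSet_Ioc, ← lintegral_indicator measurableSet_Ioi]
  · refine lintegral_congr fun s => ?_
    by_cases hs0 : 0 < s
    swap
    · rw [indicator_of_notMem (fun hs => hs0 hs.1),
        indicator_of_notMem (notMem_Ioi.2 (not_lt.1 hs0))]
    rw [indicator_of_mem (mem_Ioi.2 hs0), max_eq_left hs0.le]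
    by_cases hsH : s ≤ H
    · rw [indicator_of_mem (mem_Ioc.2 ⟨hs0, hsH⟩), ENNReal.ofReal_mul (hocc0 s), mul_comm]
    · -- the state is left for good by the time `H`
      have hz : occ X (Sum.inl i) s ω = 0 := by
        rw [occ, (h.eq_absorbing_iff s hs0.le).2 (hH.trans (not_le.1 hsH).le), if_neg (by simp)]
      rw [indicator_of_notMem (fun hs => hsH hs.2), hz, ENNReal.ofReal_zero, mul_zero]
  · rw [uIoc_of_le hH0] at hs
    rw [max_eq_left hs.1.le, intensity_zeroExtend hs.1.le]

variable (hT₀ : IsSubIntensity T₀) (hπ₀ : π₀ ∈ stdSimplex ℝ (Fin p))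
    (hX : ∀ n, IsMarkovJumpProcess P π₀ T₀ (X n))
    (hindep : iIndepFun (fun n ω (t : Ici (0 : ℝ)) => X n t ω) P)
    (hgood : ∀ n, ∀ᵐ ω ∂P, IsAbsorbedPath (X n) ω)

include hT₀ hπ₀ hX hindep hgood

/-- The contribution of the initial state: since `x ≤ 1`, it has no positive part. -/
theorem hasSplitCondExp_start (n : Fin N) (i : Fin p) {x : ℝ} (hx : x ≤ 1) :
    HasSplitCondExp P (dataSigma X) (fun ω => if X n 0 ω = Sum.inl i then elog x else 0)
      fun ω => (Ibar π₀ T₀ (absorptionTime (X n) ω) 0 (Sum.inl i) : EReal) * elog x := by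
  have hset := measurableSet_state (hX n).measurable le_rfl (Sum.inl i)
  set ν := (-elog x).toENNReal with hν
  have hνx : elog x = -(ν : EReal) := by
    rw [hν, EReal.coe_toENNReal (EReal.neg_nonneg.2 (elog_nonpos hx)), neg_neg]
  set I : Ω → ℝ≥0∞ := {ω | X n 0 ω = Sum.inl i}.indicator 1 with hI
  have hIm : Measurable I := measurable_const.indicator hset
  refine (hasSplitCondExp_neg (C := ν • I) (hIm.const_smul ν).aemeasurable).congr ?_ ?_
  · refine ae_of_all _ fun ω => ?_
    by_cases hω : X n 0 ω = Sum.inl i <;> simp [hI, hω, hνx]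
  · filter_upwards [condLExp_smul (mΩ := dataSigma X) I hIm.aemeasurable ν,
      condLExp_state hT₀ hπ₀ hX hindep hgood n i le_rfl,
      ae_isAbsorbedPath_and_pos hT₀ hπ₀ hX hgood] with ω h1 h2 h3
    have hnn := Ibar_nonneg hT₀ hπ₀ le_rfl (h3 n).1.pos.le (h3 n).2 (Sum.inl i)
    rw [h1, Pi.smul_apply, h2, indicator_of_mem (mem_Ici.2 (h3 n).1.pos.le), hνx, smul_eq_mul,
      EReal.coe_ennreal_mul, EReal.coe_ennreal_ofReal, max_eq_left hnn, mul_neg, mul_comm]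

/-- The contribution of the occupation times: it has no positive part. For the absorbing state it
vanishes, since its exit rates do. -/
theorem hasSplitCondExp_occupation (hT : IsSubIntensity T) (n : Fin N) {i j : State p}
    (hij : i ≠ j) {H : Ω → ℝ} (hH : ∀ ω, absorptionTime (X n) ω ≤ H ω) :
    HasSplitCondExp P (dataSigma X)
      (fun ω => -((∫ s in (0 : ℝ)..H ω, occ (X n) i s ω * intensity T s i j : ℝ) : EReal))
      fun ω => -((∫ s in (0 : ℝ)..absorptionTime (X n) ω,
        Ibar π₀ T₀ (absorptionTime (X n) ω) s i * intensity T s i j : ℝ) : EReal) := by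
  rcases i with i | i
  swap
  · have h0 : ∀ s, intensity T s (Sum.inr i) j = 0 := fun s => by
      rcases j with j | j <;> simp [intensity]
    simpa [h0] using hasSplitCondExp_zero (P := P) (m := dataSigma X)
  have hg : Measurable fun s => ENNReal.ofReal (intensity T s (Sum.inl i) j) :=
    (hT.measurable_intensity _ _).ennreal_ofReal
  refine (hasSplitCondExp_neg (measurable_lintegral_occ (hX n).hasRegularPaths (hX n).measurable
    (Sum.inl i) hg).aemeasurable).congr ?_ ?_
  · filter_upwards [hgood n] with ω hω
    rw [← ofReal_integral_occ (hX n).hasRegularPaths (hX n).measurable hT hω (hH ω) i hij,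
      EReal.coe_ennreal_ofReal, max_eq_left]
    refine intervalIntegral.integral_nonneg (hω.pos.le.trans (hH ω)) fun s hs => ?_
    refine mul_nonneg ?_ (hT.intensity_nonneg hs.1 hij)
    rw [occ]
    split_ifs <;> norm_num
  · filter_upwards [condLExp_occupation hT₀ hπ₀ hX hindep hgood n i hg,
      ae_isAbsorbedPath_and_pos hT₀ hπ₀ hX hgood] with ω h1 h2
    have hτ := (h2 n).1.pos
    have hnn : ∀ s, 0 ≤ s → s ≤ absorptionTime (X n) ω →
        0 ≤ Ibar π₀ T₀ (absorptionTime (X n) ω) s (Sum.inl i) * intensity T s (Sum.inl i) j :=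
      fun s hs hsτ =>
        mul_nonneg (Ibar_nonneg hT₀ hπ₀ hs hsτ (h2 n).2 _) (hT.intensity_nonneg hs hij)
    have h3 : ∫⁻ s in Ioc 0 (absorptionTime (X n) ω), ENNReal.ofReal (intensity T s (Sum.inl i) j) *
        ENNReal.ofReal (Ibar π₀ T₀ (absorptionTime (X n) ω) s (Sum.inl i)) =
        ENNReal.ofReal (∫ s in (0 : ℝ)..absorptionTime (X n) ω,
          Ibar π₀ T₀ (absorptionTime (X n) ω) s (Sum.inl i) * intensity T s (Sum.inl i) j) := by
      rw [ofReal_intervalIntegral hτ.le (hT₀.intervalIntegrable_Ibar_mul hT hτ.le i j)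
        fun s hs => hnn s hs.1.le hs.2]
      refine setLIntegral_congr_fun measurableSet_Ioc fun s hs => ?_
      rw [ENNReal.ofReal_mul (Ibar_nonneg hT₀ hπ₀ hs.1.le hs.2 (h2 n).2 _), mul_comm]
    rw [h1, h3, EReal.coe_ennreal_ofReal, max_eq_left]
    exact intervalIntegral.integral_nonneg hτ.le fun s hs => hnn s hs.1 hs.2

omit [IsProbabilityMeasure P] hπ₀ hX hindep hgood in
/-- For transient `j` the integrand is the locally integrable function of the hypothesis times a
continuous weight; for absorbing `j` the measure is a point mass. -/
theorem lintegral_dNbar_posPart_lt_top (hT : IsSubIntensity T) {i j : State p} (hij : i ≠ j)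
    (hlog : ∀ i j : Fin p, i ≠ j →
      LocallyIntegrableOn (fun s => Real.posLog (T s i j) * T₀ s i j) (Ici 0))
    {x : ℝ} (hx : 0 < x) (hf : 0 < absorptionDensity π₀ T₀ x) :
    ∫⁻ s, (elog (intensity T s i j)).toENNReal ∂dNbar π₀ T₀ x i j < ⊤ := by
  have hg : Measurable fun s => (elog (intensity T s i j)).toENNReal :=
    (measurable_elog.comp (hT.measurable_intensity i j)).ereal_toENNReal
  have hpos := (ENNReal.ofReal_pos.2 hf).ne'
  rcases i with i | i
  swap
  · simp [dNbar]
  rcases j with j | j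
  · have hij' : i ≠ j := fun h => hij (by rw [h])
    rw [lintegral_dNbar_inl hT₀ hx hf i j hg]
    refine ENNReal.div_lt_top (ne_of_lt ?_) hpos
    have hint : IntegrableOn (fun s => Real.posLog (T s i j) * T₀ s i j *
        (stateProb π₀ T₀ s (Sum.inl i) * exitDensity T₀ j s x)) (Icc 0 x) :=
      ((hlog i j hij').integrableOn_compact_subset Icc_subset_Ici_self
        isCompact_Icc).mul_continuousOn
        ((hT₀.continuous_stateProb π₀ _).mul (hT₀.continuous_exitDensity_left j x)).continuousOn
        isCompact_Icc
    refine lt_of_eq_of_lt ?_ (hint.mono_set Ioc_subset_Icc_self).lintegral_lt_top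
    refine setLIntegral_congr_fun measurableSet_Ioc fun s hs => ?_
    rw [toENNReal_elog (hT.intensity_nonneg hs.1.le hij), ← ENNReal.ofReal_mul Real.posLog_nonneg,
      zeroExtend_of_nonneg T₀ hs.1.le]
    congr 1
    simp only [intensity, Matrix.fromBlocks_apply₁₁]
    ring
  · rw [dNbar_inl_inr hT₀ hx hf, lintegral_smul_measure, lintegral_dirac' _ hg]
    refine ENNReal.mul_lt_top (ENNReal.div_lt_top ENNReal.ofReal_ne_top hpos) ?_
    rw [lt_top_iff_ne_top, Ne, EReal.toENNReal_eq_top_iff]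
    exact elog_ne_top _

/-- The contribution of the jumps. -/
theorem hasSplitCondExp_jump (hT : IsSubIntensity T)
    (hlog : ∀ i j : Fin p, i ≠ j →
      LocallyIntegrableOn (fun s => Real.posLog (T s i j) * T₀ s i j) (Ici 0))
    (n : Fin N) {i j : State p} (hij : i ≠ j) :
    HasSplitCondExp P (dataSigma X)
      (fun ω => eintegral (fun s => elog (intensity T s i j)) (jumpMeasure (X n) i j ω))
      fun ω => eintegral (fun s => elog (intensity T s i j))
        (dNbar π₀ T₀ (absorptionTime (X n) ω) i j) := by
  have hm := measurable_elog.comp (hT.measurable_intensity i j)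
  have hg1 : Measurable fun s => (elog (intensity T s i j)).toENNReal := hm.ereal_toENNReal
  have hg2 : Measurable fun s => (-elog (intensity T s i j)).toENNReal :=
    (continuous_neg.measurable.comp hm).ereal_toENNReal
  have hJ := measurable_jumpMeasure (hX n).hasRegularPaths (hX n).measurable hij
  have h1 := condLExp_jumpMeasure hT₀ hπ₀ hX hindep hgood n hij hg1
  have h2 := condLExp_jumpMeasure hT₀ hπ₀ hX hindep hgood n hij hg2
  refine ⟨fun ω => ∫⁻ s, (elog (intensity T s i j)).toENNReal ∂jumpMeasure (X n) i j ω,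
    fun ω => ∫⁻ s, (-elog (intensity T s i j)).toENNReal ∂jumpMeasure (X n) i j ω,
    ((Measure.measurable_lintegral hg1).comp hJ).aemeasurable,
    ((Measure.measurable_lintegral hg2).comp hJ).aemeasurable, ?_, ?_, ae_of_all _ fun ω => rfl, ?_⟩
  · filter_upwards [hgood n] with ω hω
    exact hω.lintegral_jumpMeasure_lt_top (hX n).hasRegularPaths hij hg1 fun s => by
      rw [Ne, EReal.toENNReal_eq_top_iff]; exact elog_ne_top _
  · filter_upwards [h1, ae_isAbsorbedPath_and_pos hT₀ hπ₀ hX hgood] with ω h1 h3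
    rw [h1]
    exact lintegral_dNbar_posPart_lt_top hT₀ hT hij hlog (h3 n).1.pos (h3 n).2
  · filter_upwards [h1, h2] with ω h1 h2
    rw [h1, h2]
    rfl

theorem hasCondExp_completeLogLikelihood (hT : IsSubIntensity T)
    (hlog : ∀ i j : Fin p, i ≠ j →
      LocallyIntegrableOn (fun s => Real.posLog (T s i j) * T₀ s i j) (Ici 0))
    {π : Fin p → ℝ} (hπ : π ∈ stdSimplex ℝ (Fin p)) :
    HasCondExp P (dataSigma X) (completeLogLikelihood π T X)
      fun ω => Lbar₀ π₀ T₀ (fun n => absorptionTime (X n) ω) π +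
        ∑ i : State p, ∑ j ∈ Finset.univ.erase i,
          Lbar π₀ T₀ (fun n => absorptionTime (X n) ω) T i j := by
  have hH : ∀ n ω, absorptionTime (X n) ω ≤ ⨆ n, absorptionTime (X n) ω := fun n ω =>
    le_ciSup (f := fun n => absorptionTime (X n) ω) (Set.finite_range _).bddAbove n
  have h0 := HasSplitCondExp.sum Finset.univ fun i _ => HasSplitCondExp.sum Finset.univ fun n _ =>
    hasSplitCondExp_start hT₀ hπ₀ hX hindep hgood n i
      (x := π i) (by exact (mem_Icc_of_mem_stdSimplex hπ i).2)
  have h1 := HasSplitCondExp.sum Finset.univ fun (i : State p) _ =>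
    HasSplitCondExp.sum (Finset.univ.erase i) fun j hj => HasSplitCondExp.sum Finset.univ fun n _ =>
      (hasSplitCondExp_jump hT₀ hπ₀ hX hindep hgood hT hlog n (Finset.ne_of_mem_erase hj).symm).add
        (hasSplitCondExp_occupation hT₀ hπ₀ hX hindep hgood hT n (Finset.ne_of_mem_erase hj).symm
          (hH n))
  refine ((h0.add h1).congr ?_ ?_).hasCondExp
  · filter_upwards [ae_all_iff.2 hgood] with ω hω
    simp only [completeLogLikelihood, completeLikelihood, ENNReal.log_mul_add, log_prod_eq_sum_log,
      EReal.log_exp]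
    congr 1
    · refine Finset.sum_congr rfl fun i _ => ?_
      rw [startCount, ← Finset.prod_pow_eq_pow_sum, log_prod_eq_sum_log]
      refine Finset.sum_congr rfl fun n _ => ?_
      split_ifs <;> simp [elog]
    · refine Finset.sum_congr rfl fun i _ => Finset.sum_congr rfl fun j hj =>
        Finset.sum_congr rfl fun n _ => ?_
      exact (hω n).transitionTerm_eq T (hH n ω) (Finset.ne_of_mem_erase hj).symm
  · filter_upwards [ae_isAbsorbedPath_and_pos hT₀ hπ₀ hX hgood] with ω hω
    simp only [Lbar₀, Lbar]
    congr 1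
    · refine Finset.sum_congr rfl fun i _ => ?_
      rw [← ereal_sum_mul_of_nonneg _ fun n _ =>
        Ibar_nonneg hT₀ hπ₀ le_rfl (hω n).1.pos.le (hω n).2 (Sum.inl i)]
      congr 2
      rw [Bbar]
      refine Finset.sum_congr rfl fun n _ => ?_
      rw [Ibar, vecMul_subTransition hT₀ π₀ le_rfl, stateProb_zero hT₀]
    · refine Finset.sum_congr rfl fun i _ => Finset.sum_congr rfl fun j _ =>
        Finset.sum_congr rfl fun n _ => ?_
      rw [dNbar_restrict hT₀ (hω n).1.pos (hω n).2, sub_eq_add_neg]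

end LogLikelihood

end

theorem mainTheorem1 {Ω : Type*} [MeasurableSpace Ω] (P : Measure Ω) [IsProbabilityMeasure P]
    {Θ : Type*} {p N : ℕ} (T : Θ → ℝ → Matrix (Fin p) (Fin p) ℝ)
    (hT : ∀ θ, IsSubIntensity (T θ))
    (π₀ : Fin p → ℝ) (hπ₀ : π₀ ∈ stdSimplex ℝ (Fin p)) (θ₀ : Θ)
    (X : Fin N → ℝ → Ω → State p)
    (hX : ∀ n, IsMarkovJumpProcess P π₀ (T θ₀) (X n))
    (hindep : iIndepFun (fun n ω (t : Ici (0 : ℝ)) => X n t ω) P)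
    (habs : ∀ n, ∀ᵐ ω ∂P, ∃ t, 0 ≤ t ∧ X n t ω = absorbingState) :
    -- the conditional expected log-likelihood
    (∀ π ∈ stdSimplex ℝ (Fin p), ∀ θ,
      (∀ i j, i ≠ j →
        LocallyIntegrableOn (fun s => Real.posLog (T θ s i j) * T θ₀ s i j) (Ici 0)) →
      HasCondExp P (dataSigma X) (completeLogLikelihood π (T θ) X)
        fun ω => Lbar₀ π₀ (T θ₀) (fun n => absorptionTime (X n) ω) π +
          ∑ i : State p, ∑ j ∈ Finset.univ.erase i,
            Lbar π₀ (T θ₀) (fun n => absorptionTime (X n) ω) (T θ) i j) ∧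
    -- the conditional expected numbers of initiations
    (∀ i : State p, P[fun ω => (startCount X i ω : ℝ) | dataSigma X] =ᵐ[P]
      fun ω => Bbar π₀ (T θ₀) (fun n => absorptionTime (X n) ω) i) ∧
    -- the conditional expected occupation indicators
    (∀ n (i : State p) s, 0 ≤ s → ∀ᵐ ω ∂P, s ≤ absorptionTime (X n) ω →
      P[occ (X n) i s | dataSigma X] ω =
        Ibar π₀ (T θ₀) (absorptionTime (X n) ω) s i) ∧
    -- the conditional expected counting processes
    (∀ n (i j : State p), j ≠ i → ∀ s, 0 ≤ s →
      Integrable (jumpCount (X n) i j s) P ∧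
      P[jumpCount (X n) i j s | dataSigma X] =ᵐ[P]
        fun ω => (dNbar π₀ (T θ₀) (absorptionTime (X n) ω) i j).real (Ioc 0 s)) := by
  have hgood : ∀ n, ∀ᵐ ω ∂P, IsAbsorbedPath (X n) ω := fun n =>
    (hX n).ae_isAbsorbedPath (hT θ₀) hπ₀ (habs n)
  exact ⟨fun π hπ θ hlog =>
      hasCondExp_completeLogLikelihood (hT θ₀) hπ₀ hX hindep hgood (hT θ) hlog hπ,
    fun i => condExp_startCount (hT θ₀) hπ₀ hX hindep hgood i,
    fun n i s hs => condExp_occ (hT θ₀) hπ₀ hX hindep hgood n i hs,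
    fun n i j hji s hs => condExp_jumpCount (hT θ₀) hπ₀ hX hindep hgood n hji.symm hs⟩
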